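/- Let $\Phi_a\subset\mathbb{R}^2$ be a homogeneous Poisson point process of density $\lambda_a>0$ (the access points, APs), and let $(g_x)_{x\in\Phi_a}$ be i.i.d. exponential random variables of mean $1$, independent of $\Phi_a$. Let $x^*=\arg\min_{x\in\Phi_a}|x|$ be the AP nearest to the origin $o$, and let $\mathcal{V}^*=\{y\in\mathbb{R}^2: |y-x^*|<|y-x| \text{ for all } x\in\Phi_a\setminus\{x^*\}\}$ be its Voronoi cell. For $P_a>0$, $\alpha_a>2$ and a receiver position $x_R\in\mathbb{R}^2$, let $$I_{x_R,a}=\sum_{x\in\Phi_a\setminus\mathcal{V}^*}P_a\,g_x\,|x-x_R|^{-\alpha_a}$$ be the AP-generated interference power at $x_R$. Conditioning on $x^*=p$ is understood through a regular conditional distribution given $x^*$ (so for almost every $p$ with respect to the law of $x^*$, and then for all $x_R\in\mathbb{R}^2$ simultaneously, including $x_R=x^*$), and the case $x^*=o$, in which $o\in\Phi_a$, is understood through the Palm distribution at $o$ of the marked process. Then, conditionally on $x^*$, for every $x_R\in\mathbb{R}^2$ the sum $I_{x_R,a}$ converges almost surely, the Laplace transform $\mathcal{L}_{I_{x_R,a}}(s\mid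 x^*)=\mathbb{E}(e^{-sI_{x_R,a}}\mid x^*)$ exists for all $s\ge 0$, and for all $s\in\mathbb{R}$ for which it exists it equals $$\mathcal{L}_{I_{x_R,a}}(s\mid x^*)=\exp\left\{-2\pi\int_0^\infty\lambda_{x_R,a}(r)\,r\,\gamma(sP_ar^{-\alpha_a})\,dr\right\},\qquad \gamma(t)=1-\frac{1}{1+t},$$ with a convergent integral. Here, for $x_R\ne o$, $$\lambda_{x_R,a}(r)=\begin{cases}\lambda_a, & r>|x^*|+|x_R|,\\ 0, & r\le\big||x^*|-|x_R|\big| \text{ and } |x^*|>|x_R|,\\ \lambda_a, & r\le\big||x^*|-|x_R|\big| \text{ and } |x^*|<|x_R|,\\ \lambda_a/2, & r\le\big||x^*|-|x_R|\big| \text{ and } |x^*|=|x_R| \ (\text{i.e. } r=0),\\ \lambda_a\left(1-\frac1\pi\arccos(d)\right), & \text{otherwise},\end{cases}\qquad d=\frac{r^2-(|x^*|^2-|x_R|^2)}{2r|x_R|},$$ and $\lambda_{x_R,a}(r)=\lambda_a\,\mathbb{I}(r\ge|x^*|)$ for $x_R=o$. -/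

import Mathlib

open MeasureTheory ProbabilityTheory

/-- The Euclidean plane. -/
abbrev Plane : Type := EuclideanSpace ℝ (Fin 2)

/-- A marked configuration: the positions `c.1 n` of the access points, and the channel gains
`c.2 n` of their transmissions. -/
abbrev Config : Type := (ℕ → Plane) × (ℕ → ℝ)

/-- The number of points of the random sequence `X` that lie in `B`. -/
noncomputable def pointCount {Ω : Type*} (X : ℕ → Ω → Plane) (B : Set Plane) (ω : Ω) : ℕ∞ :=
  {n : ℕ | X n ω ∈ B}.encard

/-- The points `X 0, X 1, …` (listed in an arbitrary measurable order) form a homogeneous Poisson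
point process of density `lam` in the plane: the number of points in a Borel set `B` of finite area
`|B|` is Poisson distributed with mean `lam * |B|`, and the numbers of points in finitely many
pairwise disjoint Borel sets are independent. -/
structure IsHomogeneousPPP {Ω : Type*} [MeasurableSpace Ω] (μ : Measure Ω)
    (X : ℕ → Ω → Plane) (lam : ℝ) : Prop where
  measurable : ∀ n, Measurable (X n)
  poisson : ∀ B : Set Plane, MeasurableSet B → volume B < ⊤ → ∀ k : ℕ,
    μ {ω | pointCount X B ω = (k : ℕ∞)} = poissonMeasure (lam * volume.real B).toNNReal {k}
  indep : ∀ (m : ℕ) (B : Fin m → Set Plane), (∀ i, MeasurableSet (B i)) →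
    Pairwise (fun i j => Disjoint (B i) (B j)) →
    iIndepFun (fun i => pointCount X (B i)) μ

/-- The channel gains `g n` are i.i.d. exponential random variables of mean `1`, independent of
the positions `X`. -/
structure IsRayleighFading {Ω : Type*} [MeasurableSpace Ω] (μ : Measure Ω)
    (X : ℕ → Ω → Plane) (g : ℕ → Ω → ℝ) : Prop where
  measurable : ∀ n, Measurable (g n)
  law : ∀ n, μ.map (g n) = expMeasure 1
  iIndep : iIndepFun g μ
  indep_positions : IndepFun (fun ω n => X n ω) (fun ω n => g n ω) μ

open Classical in
/-- The point of the configuration `φ` that is closest to the origin. (If several points are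
closest, the first one in the list; if there is none, the origin. Both events are null events for
a homogeneous Poisson process.) -/
noncomputable def nearestPoint (φ : ℕ → Plane) : Plane :=
  if h : ∃ n, ∀ m, ‖φ n‖ ≤ ‖φ m‖ then φ (Nat.find h) else 0

/-- The (open) Voronoi cell of `c` with respect to the point set `Φ`. -/
def voronoiCell (Φ : Set Plane) (c : Plane) : Set Plane :=
  {y | ∀ x ∈ Φ \ {c}, ‖y - c‖ < ‖y - x‖}

open Classical in
/-- The power received at `xR` from the `n`-th access point, which is silent if it lies in the
Voronoi cell of the access point closest to the origin. -/
noncomputable def receivedPower (P α : ℝ) (xR : Plane) (c : Config) (n : ℕ) : ℝ :=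
  if c.1 n ∈ voronoiCell (Set.range c.1) (nearestPoint c.1) then 0
  else P * c.2 n * ‖c.1 n - xR‖ ^ (-α)

/-- The access-point generated interference power at `xR`. -/
noncomputable def interference (P α : ℝ) (xR : Plane) (c : Config) : ℝ :=
  ∑' n, receivedPower P α xR c n

/-- `γ(t) = 1 - 1 / (1 + t)`. -/
noncomputable def gammaFun (t : ℝ) : ℝ := 1 - 1 / (1 + t)

/-- The equivalent density at distance `r` from the receiver, where `a = |x*|` and `b = |x_R|`. -/
noncomputable def equivDensity (lam a b r : ℝ) : ℝ :=
  if b = 0 then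
    (if a ≤ r then lam else 0)
  else if a + b < r then lam
  else if r ≤ |a - b| then
    (if b < a then 0 else if a < b then lam else lam / 2)
  else lam * (1 - Real.arccos ((r ^ 2 - (a ^ 2 - b ^ 2)) / (2 * r * b)) / Real.pi)

/-- Under the law `Q` of the configuration, the Laplace transform `s ↦ E[exp (-s I)]` of the random
variable `I` exists for all `s ≥ 0`, and for all real `s` for which it exists it is equal to
`exp (-2π ∫₀^∞ dens(r) r γ(s P r^(-α)) dr)`, with a convergent integral. -/
def HasRadialLaplaceTransform (Q : Measure Config) (I : Config → ℝ) (P α : ℝ) (dens : ℝ → ℝ) :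
    Prop :=
  (∀ s : ℝ, 0 ≤ s → Integrable (fun c => Real.exp (-s * I c)) Q) ∧
  ∀ s : ℝ, Integrable (fun c => Real.exp (-s * I c)) Q →
    IntegrableOn (fun r : ℝ => dens r * r * gammaFun (s * P * r ^ (-α))) (Set.Ioi 0) ∧
    ∫ c, Real.exp (-s * I c) ∂Q =
      Real.exp (-(2 * Real.pi) *
        ∫ r in Set.Ioi (0 : ℝ), dens r * r * gammaFun (s * P * r ^ (-α)))

/-- The Palm distribution at the origin of the marked stationary point process `(X, g)` of density
`lam`, i.e. its conditional law given that there is a point at the origin: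
`Q(A) = (lam |B|)⁻¹ E[#{n : X n ∈ B, (X - X n, g) ∈ A}]`, for a set `B` of positive finite area. -/
noncomputable def palmLaw {Ω : Type*} [MeasurableSpace Ω] (μ : Measure Ω)
    (X : ℕ → Ω → Plane) (g : ℕ → Ω → ℝ) (lam : ℝ) (B : Set Plane) : Measure Config :=
  (ENNReal.ofReal lam * volume B)⁻¹ •
    Measure.sum (fun n => (μ.restrict {ω | X n ω ∈ B}).map
      (fun ω => ((fun m => X m ω - X n ω, fun m => g m ω) : Config)))

open scoped ENNReal
open Filter Topology

/-! The nearest point `x*` lies in its own Voronoi cell and no other point of the configuration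
does, so the interference is the sum over all points other than `x*`. Given `x* = p`, those points
form a Poisson process of density `lam` on the set of `x` with `‖x‖ > ‖p‖`, and the gains remain
i.i.d. exponential. Averaging `exp (-s I)` over the gains turns each point at distance `r` from the
receiver into a factor `1 / (1 + s P r^(-α))`. The Laplace functional of the Poisson process then
gives `exp (-lam ∫ γ(s P ‖x - xR‖^(-α)) dx)` over `‖x‖ > ‖p‖`. Polar coordinates centred at `xR`
finish the computation: the part of the circle of radius `r` about `xR` lying outside the disc of
radius `‖p‖` about the origin has angle `2π equivDensity 1 ‖p‖ ‖xR‖ r`, up to a null set of radii.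

The probabilistic core is Mecke's formula (`lintegral_tsum_restrict_ne`), derived from the
independence of counts on disjoint sets. Cut the plane into the cells of a countable partition; a
point in a cell is independent of the process outside that cell; refine the partitions until only
the point itself is removed. To make this limit meaningful, a locally finite measure is encoded by
its values on countably many test sets, that is, by a point of a countable product of copies of `[0,
∞]`.

Mecke's formula is used twice. Applied to the event that no other point is as near to the origin as
`x` and that the farther points satisfy a given condition, it factorises the joint law of the
nearest point and the points beyond it (`measure_nearestPoint_testValues_mem`); disintegration
yields the conditional law. Applied to the process seen from one of its points in `B`, it shows that
the Palm process without its point at the origin behaves like the original process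
(`isPoissonBeyond_palmPositions`). Both cases are instances of `IsPoissonBeyond`, from which
everything about the interference follows.

All transforms are first computed as integrals with values in `[0, ∞]`. For negative `s` the formula
for the expectation of `exp` of a positive sum holds even when both sides are infinite. Existence of
the Laplace transform therefore means finiteness of the right-hand side, and this yields the
convergence of the integral. -/

/-! ### Counting measures and moments of Poisson counts. -/

/-- The counting measure of a sequence of points of the plane. -/
noncomputable def pointMeasure (φ : ℕ → Plane) : Measure Plane :=
  Measure.sum fun n => Measure.dirac (φ n)

lemma lintegral_pointMeasure (φ : ℕ → Plane) {f : Plane → ℝ≥0∞} (hf : Measurable f) :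
    ∫⁻ x, f x ∂(pointMeasure φ) = ∑' n, f (φ n) := by
  simp [pointMeasure, lintegral_sum_measure, lintegral_dirac' _ hf]

lemma pointMeasure_apply (φ : ℕ → Plane) {B : Set Plane} (hB : MeasurableSet B) :
    pointMeasure φ B = ∑' n, B.indicator 1 (φ n) := by
  simp [pointMeasure, Measure.sum_apply _ hB, Measure.dirac_apply' _ hB]

lemma measurable_pointMeasure : Measurable pointMeasure := by
  refine Measure.measurable_of_measurable_coe _ fun B hB => ?_
  simp_rw [pointMeasure_apply _ hB]
  exact Measurable.tsum fun n =>
    (measurable_one.indicator hB).comp (measurable_pi_apply n)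

lemma pointMeasure_apply_eq_zero_iff (φ : ℕ → Plane) {B : Set Plane} (hB : MeasurableSet B) :
    pointMeasure φ B = 0 ↔ ∀ n, φ n ∉ B := by
  simp [pointMeasure_apply _ hB, ENNReal.tsum_eq_zero]

lemma pointMeasure_eq_pointCount {Ω : Type*} (X : ℕ → Ω → Plane) {B : Set Plane}
    (hB : MeasurableSet B) (ω : Ω) :
    pointMeasure (fun n => X n ω) B = (pointCount X B ω : ℝ≥0∞) := by
  rw [pointMeasure_apply _ hB, pointCount, ← ENNReal.tsum_set_one,
    tsum_subtype {n | X n ω ∈ B} fun _ => (1 : ℝ≥0∞)]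
  rfl

namespace IsHomogeneousPPP

variable {Ω : Type*} [MeasurableSpace Ω] {μ : Measure Ω} {X : ℕ → Ω → Plane} {lam : ℝ}

lemma measurable_seq (hX : IsHomogeneousPPP μ X lam) : Measurable fun ω n => X n ω :=
  measurable_pi_lambda _ hX.measurable

lemma measurable_pointMeasure (hX : IsHomogeneousPPP μ X lam) :
    Measurable fun ω => pointMeasure (fun n => X n ω) :=
  _root_.measurable_pointMeasure.comp hX.measurable_seq

lemma measurable_pointMeasure_apply (hX : IsHomogeneousPPP μ X lam) {B : Set Plane}
    (hB : MeasurableSet B) : Measurable fun ω => pointMeasure (fun n => X n ω) B :=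
  (Measure.measurable_coe hB).comp hX.measurable_pointMeasure

lemma measurable_pointCount (hX : IsHomogeneousPPP μ X lam) {B : Set Plane}
    (hB : MeasurableSet B) : Measurable (pointCount X B) := by
  refine measurable_to_countable' fun k => ?_
  have : pointCount X B ⁻¹' {k} =
      (fun ω => pointMeasure (fun n => X n ω) B) ⁻¹' {(k : ℝ≥0∞)} := by
    ext ω
    simp [pointMeasure_eq_pointCount X hB]
  rw [this]
  exact hX.measurable_pointMeasure_apply hB (measurableSet_singleton _)

lemma map_pointCount [IsProbabilityMeasure μ] (hX : IsHomogeneousPPP μ X lam) {B : Set Plane}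
    (hB : MeasurableSet B) (hB' : volume B < ⊤) :
    μ.map (pointCount X B) =
      (poissonMeasure (lam * volume.real B).toNNReal).map (Nat.cast : ℕ → ℕ∞) := by
  have hm := hX.measurable_pointCount hB
  have hc : Measurable (Nat.cast : ℕ → ℕ∞) := measurable_of_countable _
  set P := poissonMeasure (lam * volume.real B).toNNReal
  have h1 : ∀ k : ℕ, μ.map (pointCount X B) {(k : ℕ∞)} = P.map (Nat.cast : ℕ → ℕ∞) {(k : ℕ∞)} := by
    intro k
    rw [Measure.map_apply hm (measurableSet_singleton _),
      Measure.map_apply hc (measurableSet_singleton _)]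
    have : (Nat.cast : ℕ → ℕ∞) ⁻¹' {(k : ℕ∞)} = {k} := by ext; simp
    rw [this, ← hX.poisson B hB hB' k]
    rfl
  have hcoe : (Set.range (Nat.cast : ℕ → ℕ∞)) = ({⊤} : Set ℕ∞)ᶜ := by
    ext k
    exact ENat.ne_top_iff_exists.symm
  have h2 : μ.map (pointCount X B) ({⊤}ᶜ) = P.map (Nat.cast : ℕ → ℕ∞) ({⊤}ᶜ) := by
    have hU : ({⊤}ᶜ : Set ℕ∞) = ⋃ k : ℕ, {(k : ℕ∞)} := by
      rw [← hcoe]; ext; simp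
    have hd : Pairwise (Function.onFun Disjoint fun k : ℕ => ({(k : ℕ∞)} : Set ℕ∞)) := by
      intro i j hij
      simpa [Function.onFun] using hij
    rw [hU, measure_iUnion hd fun _ => measurableSet_singleton _,
      measure_iUnion hd fun _ => measurableSet_singleton _]
    exact tsum_congr h1
  have := Measure.isProbabilityMeasure_map (μ := μ) hm.aemeasurable
  have := Measure.isProbabilityMeasure_map (μ := P) hc.aemeasurable
  refine Measure.ext_of_singleton fun k => ?_
  induction k using ENat.recTopCoe with
  | coe k => exact h1 k
  -- The hypothesis prescribes the probabilities of finite counts only; the mass of `⊤` is what the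
  -- total mass `1` leaves over.
  | top =>
    have e1 := prob_compl_eq_one_sub (μ := μ.map (pointCount X B))
      (measurableSet_singleton (⊤ : ℕ∞)).compl
    have e2 := prob_compl_eq_one_sub (μ := P.map (Nat.cast : ℕ → ℕ∞))
      (measurableSet_singleton (⊤ : ℕ∞)).compl
    rw [compl_compl] at e1 e2
    rw [e1, e2, h2]

lemma lintegral_comp_pointCount [IsProbabilityMeasure μ] (hX : IsHomogeneousPPP μ X lam)
    (hlam : 0 ≤ lam) {B : Set Plane} (hB : MeasurableSet B) (hB' : volume B < ⊤)
    (F : ℕ∞ → ℝ≥0∞) :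
    ∫⁻ ω, F (pointCount X B ω) ∂μ =
      ∑' k : ℕ, ENNReal.ofReal (Real.exp (-(lam * volume.real B)) *
        (lam * volume.real B) ^ k / k.factorial) * F k := by
  have hF : Measurable F := measurable_of_countable _
  rw [← lintegral_map hF (hX.measurable_pointCount hB), hX.map_pointCount hB hB',
    lintegral_map hF (measurable_of_countable _), poissonMeasure, lintegral_sum_measure]
  refine tsum_congr fun k => ?_
  rw [lintegral_smul_measure, lintegral_dirac,
    Real.coe_toNNReal _ (mul_nonneg hlam measureReal_nonneg)]
  rfl

lemma lintegral_pow_pointCount [IsProbabilityMeasure μ] (hX : IsHomogeneousPPP μ X lam)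
    (hlam : 0 ≤ lam) {B : Set Plane} (hB : MeasurableSet B) (hB' : volume B < ⊤)
    (F : ℕ∞ → ℝ≥0∞) {z : ℝ} (hz : 0 ≤ z) (hF : ∀ k : ℕ, F k = ENNReal.ofReal (z ^ k)) :
    ∫⁻ ω, F (pointCount X B ω) ∂μ =
      ENNReal.ofReal (Real.exp (lam * volume.real B * (z - 1))) := by
  have hr : 0 ≤ lam * volume.real B := mul_nonneg hlam measureReal_nonneg
  rw [hX.lintegral_comp_pointCount hlam hB hB']
  set r := lam * volume.real B
  have hs : HasSum (fun k : ℕ => Real.exp (-r) * ((r * z) ^ k / k.factorial))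
      (Real.exp (-r) * Real.exp (r * z)) := by
    refine HasSum.mul_left _ ?_
    rw [Real.exp_eq_exp_ℝ]
    exact NormedSpace.expSeries_div_hasSum_exp (r * z)
  have h : ∀ k : ℕ, ENNReal.ofReal (Real.exp (-r) * r ^ k / k.factorial) * F k =
      ENNReal.ofReal (Real.exp (-r) * ((r * z) ^ k / k.factorial)) := by
    intro k
    rw [hF, ← ENNReal.ofReal_mul (by positivity), mul_pow]
    congr 1
    ring
  simp_rw [h]
  rw [← ENNReal.ofReal_tsum_of_nonneg (fun k => by positivity) hs.summable, hs.tsum_eq,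
    ← Real.exp_add]
  congr 2
  ring

lemma lintegral_pointCount [IsProbabilityMeasure μ] (hX : IsHomogeneousPPP μ X lam)
    (hlam : 0 ≤ lam) {B : Set Plane} (hB : MeasurableSet B) (hB' : volume B < ⊤) :
    ∫⁻ ω, (pointCount X B ω : ℝ≥0∞) ∂μ = ENNReal.ofReal lam * volume B := by
  have hr : 0 ≤ lam * volume.real B := mul_nonneg hlam measureReal_nonneg
  have hvol : ENNReal.ofReal lam * volume B = ENNReal.ofReal (lam * volume.real B) := by
    rw [ENNReal.ofReal_mul hlam, Measure.real, ENNReal.ofReal_toReal hB'.ne]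
  rw [hX.lintegral_comp_pointCount hlam hB hB' (fun k => (k : ℝ≥0∞)), hvol]
  set r := lam * volume.real B
  -- The term `k = 0` vanishes, and the shift turns `k * r ^ k / k!` into `r` times the exponential
  -- series.
  rw [tsum_eq_zero_add' ENNReal.summable]
  have hs : HasSum (fun k : ℕ => Real.exp (-r) * r * (r ^ k / k.factorial))
      (Real.exp (-r) * r * Real.exp r) := by
    refine HasSum.mul_left _ ?_
    rw [Real.exp_eq_exp_ℝ]
    exact NormedSpace.expSeries_div_hasSum_exp r
  have h : ∀ k : ℕ, ENNReal.ofReal (Real.exp (-r) * r ^ (k + 1) / (k + 1).factorial) *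
      (((k + 1 : ℕ) : ℕ∞) : ℝ≥0∞) = ENNReal.ofReal (Real.exp (-r) * r * (r ^ k / k.factorial)) := by
    intro k
    have : (((k + 1 : ℕ) : ℕ∞) : ℝ≥0∞) = ENNReal.ofReal ((k : ℝ) + 1) := by
      rw [← Nat.cast_succ, ENNReal.ofReal_natCast]; simp
    rw [this, ← ENNReal.ofReal_mul (by positivity), Nat.factorial_succ]
    congr 1
    push_cast
    field_simp
    ring
  simp_rw [h]
  rw [← ENNReal.ofReal_tsum_of_nonneg (fun k => by positivity) hs.summable, hs.tsum_eq]
  have e : Real.exp (-r) * r * Real.exp r = r := by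
    rw [mul_right_comm, ← Real.exp_add]; simp
  simp [e]

lemma lintegral_pointMeasure_apply [IsProbabilityMeasure μ] (hX : IsHomogeneousPPP μ X lam)
    (hlam : 0 ≤ lam) {B : Set Plane} (hB : MeasurableSet B) (hB' : volume B < ⊤) :
    ∫⁻ ω, pointMeasure (fun n => X n ω) B ∂μ = ENNReal.ofReal lam * volume B := by
  simp_rw [pointMeasure_eq_pointCount X hB]
  exact hX.lintegral_pointCount hlam hB hB'

lemma ae_pointMeasure_lt_top [IsProbabilityMeasure μ] (hX : IsHomogeneousPPP μ X lam)
    (hlam : 0 ≤ lam) {B : Set Plane} (hB : MeasurableSet B) (hB' : volume B < ⊤) :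
    ∀ᵐ ω ∂μ, pointMeasure (fun n => X n ω) B < ⊤ := by
  refine ae_lt_top (hX.measurable_pointMeasure_apply hB) ?_
  rw [hX.lintegral_pointMeasure_apply hlam hB hB']
  exact ENNReal.mul_ne_top ENNReal.ofReal_ne_top hB'.ne

lemma measure_pointMeasure_eq_zero [IsProbabilityMeasure μ] (hX : IsHomogeneousPPP μ X lam)
    (hlam : 0 ≤ lam) {B : Set Plane} (hB : MeasurableSet B) (hB' : volume B < ⊤) :
    μ {ω | pointMeasure (fun n => X n ω) B = 0} =
      ENNReal.ofReal (Real.exp (-(lam * volume.real B))) := by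
  have h := hX.poisson B hB hB' 0
  rw [poissonMeasure_singleton, Real.coe_toNNReal _ (mul_nonneg hlam measureReal_nonneg)] at h
  simp_rw [pointMeasure_eq_pointCount X hB]
  simpa using h

lemma iIndepFun_pointCount (hX : IsHomogeneousPPP μ X lam) {ι : Type*} [Finite ι]
    (B : ι → Set Plane) (hB : ∀ i, MeasurableSet (B i))
    (hd : Pairwise (Function.onFun Disjoint B)) : iIndepFun (fun i => pointCount X (B i)) μ := by
  obtain ⟨n, ⟨e⟩⟩ := Finite.exists_equiv_fin ι
  have h := hX.indep n (fun i => B (e.symm i)) (fun i => hB _)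
    (fun i j hij => hd (e.symm.injective.ne hij))
  simpa using h.precomp e.injective

/-- The number of points in `B` is independent of the point process outside `B`. -/
lemma indepFun_pointCount_pointMeasure [IsProbabilityMeasure μ] (hX : IsHomogeneousPPP μ X lam)
    {J : Type*} {B : Set Plane} (hB : MeasurableSet B) (C : J → Set Plane)
    (hC : ∀ j, MeasurableSet (C j)) (hd : ∀ j, Disjoint B (C j)) :
    IndepFun (pointCount X B) (fun ω j => pointMeasure (fun n => X n ω) (C j)) μ := by
  classical
  refine IndepFun.indepFun_process (hX.measurable_pointCount hB)
    (fun j => hX.measurable_pointMeasure_apply (hC j)) fun I => ?_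
  -- The finitely many sets `C i` may overlap. They are replaced by the atoms of the algebra they
  -- generate, with `B` as the extra index `none`, to obtain a disjoint family.
  let D : Option (Set I) → Set Plane := fun o =>
    o.elim B fun S => (⋂ i : I, {x | x ∈ C i ↔ i ∈ S}) \ B
  have hD : ∀ o, MeasurableSet (D o) := by
    rintro (_ | S)
    · exact hB
    · refine (MeasurableSet.iInter fun i => ?_).diff hB
      by_cases hi : i ∈ S
      · simpa [hi] using hC i
      · simp only [hi, iff_false]
        exact (hC i).compl
  have hDd : Pairwise (Function.onFun Disjoint D) := by
    rintro (_ | S) (_ | S') h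
    · exact absurd rfl h
    · exact Set.disjoint_left.2 fun x hx hx' => hx'.2 hx
    · exact Set.disjoint_left.2 fun x hx hx' => hx.2 hx'
    · refine Set.disjoint_left.2 fun x hx hx' => h ?_
      congr 1
      ext i
      exact (Set.mem_iInter.1 hx.1 i).symm.trans (Set.mem_iInter.1 hx'.1 i)
  have hi := hX.iIndepFun_pointCount D hD hDd
  have h2 := hi.indepFun_finset {none} (Finset.univ.erase none) (by simp)
    (fun o => hX.measurable_pointCount (hD o))
  -- The count in `C i` is the sum of the counts in the atoms that it contains.
  let ψ : ((o : (Finset.univ.erase (none : Option (Set I)) : Finset _)) → ℕ∞) → I → ℝ≥0∞ :=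
    fun v i => ∑ S : Set I, if i ∈ S then ((v ⟨some S, by simp⟩ : ℕ∞) : ℝ≥0∞) else 0
  have hψ : Measurable ψ := measurable_pi_lambda _ fun i => Finset.measurable_sum _ fun S _ => by
    split_ifs
    · exact (measurable_of_countable _).comp (measurable_pi_apply _)
    · exact measurable_const
  have hφ : Measurable fun v : ({none} : Finset (Option (Set I))) → ℕ∞ => v ⟨none, by simp⟩ :=
    measurable_pi_apply _
  have h3 := h2.comp hφ hψ
  suffices h : (fun ω (i : I) => pointMeasure (fun n => X n ω) (C i)) =
      ψ ∘ fun ω o => pointCount X (D o) ω by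
    rw [h]
    exact h3
  funext ω i
  have hU : C i = ⋃ S ∈ (Finset.univ.filter fun S : Set I => i ∈ S), D (some S) := by
    ext x
    simp only [Finset.mem_filter, Finset.mem_univ, true_and, Set.mem_iUnion, exists_prop]
    constructor
    · intro hx
      exact ⟨{i | x ∈ C i}, hx, by simp, fun hxB => Set.disjoint_left.1 (hd i) hxB hx⟩
    · rintro ⟨S, hS, hx⟩
      exact (Set.mem_iInter.1 hx.1 i).2 hS
  rw [hU, measure_biUnion_finset (f := fun S => D (some S))
    (fun S _ S' _ h => hDd (fun h' => h (Option.some.inj h'))) (fun S _ => hD _),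
    Finset.sum_filter]
  simp only [Function.comp, ψ]
  exact Finset.sum_congr rfl fun S _ => by
    split_ifs
    · exact pointMeasure_eq_pointCount X (hD _) ω
    · rfl

end IsHomogeneousPPP

/-! ### Laplace functionals of the Poisson process, with values in `[0, ∞]`. -/

/-- The exponential `[0, ∞] → [1, ∞]`. -/
noncomputable def expPos (x : ℝ≥0∞) : ℝ≥0∞ := EReal.exp x

/-- The function `x ↦ exp (-x)` on `[0, ∞]`. -/
noncomputable def expNeg (x : ℝ≥0∞) : ℝ≥0∞ := (expPos x)⁻¹

lemma continuous_expPos : Continuous expPos :=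
  ENNReal.continuous_exp.comp continuous_coe_ennreal_ereal

lemma continuous_expNeg : Continuous expNeg := continuous_inv.comp continuous_expPos

lemma expPos_zero : expPos 0 = 1 := by simp [expPos]

lemma expNeg_zero : expNeg 0 = 1 := by simp [expNeg, expPos_zero]

lemma expPos_add (x y : ℝ≥0∞) : expPos (x + y) = expPos x * expPos y := by
  simp [expPos, EReal.exp_add]

lemma one_le_expPos (x : ℝ≥0∞) : 1 ≤ expPos x := by
  simpa [expPos] using EReal.coe_ennreal_nonneg x

lemma expPos_top : expPos ⊤ = ⊤ := by simp [expPos]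

lemma expNeg_add (x y : ℝ≥0∞) : expNeg (x + y) = expNeg x * expNeg y := by
  rw [expNeg, expPos_add, ENNReal.mul_inv]
  · rfl
  · exact Or.inl (one_pos.trans_le (one_le_expPos x)).ne'
  · exact Or.inr (one_pos.trans_le (one_le_expPos y)).ne'

lemma expNeg_le_one (x : ℝ≥0∞) : expNeg x ≤ 1 := by
  simpa [expNeg] using one_le_expPos x

lemma monotone_expPos : Monotone expPos := fun x y h => by
  simpa [expPos] using h

lemma antitone_expNeg : Antitone expNeg := fun _ _ h =>
  ENNReal.inv_le_inv.2 (monotone_expPos h)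

lemma expPos_ofReal {r : ℝ} (hr : 0 ≤ r) :
    expPos (ENNReal.ofReal r) = ENNReal.ofReal (Real.exp r) := by
  rw [expPos, EReal.coe_ennreal_ofReal, max_eq_left hr, EReal.exp_coe]

lemma expNeg_ofReal {r : ℝ} (hr : 0 ≤ r) :
    expNeg (ENNReal.ofReal r) = ENNReal.ofReal (Real.exp (-r)) := by
  rw [expNeg, expPos_ofReal hr, Real.exp_neg, ENNReal.ofReal_inv_of_pos (Real.exp_pos r)]

lemma map_sum_of_map_add {E : ℝ≥0∞ → ℝ≥0∞} (h0 : E 0 = 1) (h : ∀ x y, E (x + y) = E x * E y)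
    {ι : Type*} (s : Finset ι) (f : ι → ℝ≥0∞) : E (∑ i ∈ s, f i) = ∏ i ∈ s, E (f i) := by
  classical
  induction s using Finset.induction_on with
  | empty => simpa using h0
  | insert i s hi ih => rw [Finset.sum_insert hi, Finset.prod_insert hi, h, ih]

namespace IsHomogeneousPPP

variable {Ω : Type*} [MeasurableSpace Ω] {μ : Measure Ω} {X : ℕ → Ω → Plane} {lam : ℝ}

/-- The integral of a simple function is a sum over its level sets, whose counts are independent, so
its exponential is a product of one-set factors. Keeping `E` and `D` abstract treats both signs at
once: `E = expPos`, `D = expPos - 1`, and `E = expNeg`, `D = 1 - expNeg`. -/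
lemma lintegral_simpleFunc [IsProbabilityMeasure μ] (hX : IsHomogeneousPPP μ X lam)
    {E D : ℝ≥0∞ → ℝ≥0∞} (hE0 : E 0 = 1) (hEadd : ∀ x y, E (x + y) = E x * E y)
    (hD0 : D 0 = 0)
    (h : ∀ (c : ℝ≥0∞) (B : Set Plane), c ≠ ⊤ → MeasurableSet B → volume B < ⊤ →
      ∫⁻ ω, E (c * (pointCount X B ω : ℝ≥0∞)) ∂μ = E (ENNReal.ofReal lam * (D c * volume B)))
    (f : SimpleFunc Plane ℝ≥0∞) (hf : ∀ x, f x ≠ ⊤)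
    (hf' : ∀ c, c ≠ 0 → volume (f ⁻¹' {c}) < ⊤) :
    ∫⁻ ω, E (∫⁻ x, f x ∂(pointMeasure fun n => X n ω)) ∂μ =
      E (ENNReal.ofReal lam * ∫⁻ x, D (f x)) := by
  have h1 : ∀ ω, E (∫⁻ x, f x ∂(pointMeasure fun n => X n ω)) =
      ∏ c : f.range, E (c * (pointCount X (f ⁻¹' {c.1}) ω : ℝ≥0∞)) := by
    intro ω
    rw [SimpleFunc.lintegral_eq_lintegral, SimpleFunc.lintegral, ← Finset.sum_coe_sort,
      map_sum_of_map_add hE0 hEadd]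
    refine Finset.prod_congr rfl fun c _ => ?_
    rw [pointMeasure_eq_pointCount X (f.measurableSet_preimage _)]
  have h2 : ∫⁻ x, D (f x) = ∑ c : f.range, D c * volume (f ⁻¹' {c.1}) := by
    have := (f.map D).lintegral_eq_lintegral volume
    rw [SimpleFunc.map_lintegral, ← Finset.sum_coe_sort] at this
    exact this
  have hind : iIndepFun (fun (c : f.range) ω =>
      E (c * (pointCount X (f ⁻¹' {c.1}) ω : ℝ≥0∞))) μ := by
    refine (hX.iIndepFun_pointCount (fun c : f.range => f ⁻¹' {c.1})
      (fun c => f.measurableSet_preimage _) fun c c' hc => ?_).comp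
      (fun c k => E (c * (k : ℝ≥0∞))) fun c => measurable_of_countable _
    refine Set.disjoint_left.2 fun x hx hx' => hc (Subtype.ext ?_)
    exact hx.symm.trans hx'
  simp_rw [h1]
  rw [lintegral_prod_eq_prod_lintegral_of_indepFun _ _ hind, h2, Finset.mul_sum,
    map_sum_of_map_add hE0 hEadd]
  · refine Finset.prod_congr rfl fun c _ => ?_
    by_cases hc : (c : ℝ≥0∞) = 0
    · simp [hc, hE0, hD0]
    · refine h _ _ ?_ (f.measurableSet_preimage _) (hf' _ hc)
      obtain ⟨x, hx⟩ := SimpleFunc.mem_range.1 c.2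
      rw [← hx]
      exact hf x
  · intro c
    exact (measurable_of_countable (fun k : ℕ∞ => E (c * (k : ℝ≥0∞)))).comp
      (hX.measurable_pointCount (f.measurableSet_preimage _))

/-- Increasing simple approximations carry the formula to all measurable functions. The limit under
the expectation is monotone convergence when `E` is increasing and dominated convergence when `E ≤
1`. -/
lemma lintegral_of_simpleFunc [IsProbabilityMeasure μ] (hX : IsHomogeneousPPP μ X lam)
    {E D : ℝ≥0∞ → ℝ≥0∞} (hE : Continuous E) (hE0 : E 0 = 1) (hEadd : ∀ x y, E (x + y) = E x * E y)
    (hE' : Monotone E ∨ ∀ x, E x ≤ 1) (hD : Continuous D) (hDm : Monotone D) (hD0 : D 0 = 0)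
    (h : ∀ (c : ℝ≥0∞) (B : Set Plane), c ≠ ⊤ → MeasurableSet B → volume B < ⊤ →
      ∫⁻ ω, E (c * (pointCount X B ω : ℝ≥0∞)) ∂μ = E (ENNReal.ofReal lam * (D c * volume B)))
    {f : Plane → ℝ≥0∞} (hf : Measurable f) :
    ∫⁻ ω, E (∑' n, f (X n ω)) ∂μ = E (ENNReal.ofReal lam * ∫⁻ x, D (f x)) := by
  simp_rw [← lintegral_pointMeasure _ hf]
  -- The cut-off to a ball gives the nonzero level sets finite area, and `eapprox` takes finite
  -- values only.
  let F : ℕ → SimpleFunc Plane ℝ≥0∞ := fun j =>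
    (SimpleFunc.eapprox f j).restrict (Metric.ball 0 j)
  have hF : ∀ j x, F j x = (Metric.ball 0 (j : ℝ)).indicator (SimpleFunc.eapprox f j) x :=
    fun j x => SimpleFunc.restrict_apply _ Metric.isOpen_ball.measurableSet x
  have hFm : ∀ x, Monotone fun j => F j x := by
    intro x i j hij
    simp only [hF]
    refine (Set.indicator_le_indicator (SimpleFunc.monotone_eapprox f hij x)).trans ?_
    exact Set.indicator_le_indicator_of_subset
      (Metric.ball_subset_ball (by exact_mod_cast hij)) (fun _ => zero_le) x
  have hFt : ∀ x, Tendsto (fun j => F j x) atTop (𝓝 (f x)) := by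
    intro x
    have h1 : Tendsto (fun j => SimpleFunc.eapprox f j x) atTop (𝓝 (f x)) := by
      rw [← SimpleFunc.iSup_eapprox_apply hf]
      exact tendsto_atTop_iSup fun i j hij => SimpleFunc.monotone_eapprox f hij x
    refine h1.congr' ?_
    obtain ⟨k, hk⟩ := exists_nat_gt ‖x‖
    filter_upwards [eventually_ge_atTop k] with j hj
    rw [hF, Set.indicator_of_mem]
    have : (k : ℝ) ≤ j := by exact_mod_cast hj
    simpa using hk.trans_le this
  have hkey : ∀ j, ∫⁻ ω, E (∫⁻ x, F j x ∂(pointMeasure fun n => X n ω)) ∂μ =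
      E (ENNReal.ofReal lam * ∫⁻ x, D (F j x)) := by
    intro j
    refine hX.lintegral_simpleFunc hE0 hEadd hD0 h (F j) (fun x => ?_) fun c hc => ?_
    · rw [hF]
      refine ne_top_of_le_ne_top (SimpleFunc.eapprox_lt_top f j x).ne ?_
      exact Set.indicator_le_self _ _ x
    · refine (measure_mono fun x hx => ?_).trans_lt (measure_ball_lt_top (x := 0) (r := j))
      by_contra hx'
      refine hc ?_
      rw [← Set.mem_singleton_iff.1 hx, hF, Set.indicator_of_notMem hx']
  have hcont : ∀ M : Measure Plane, Tendsto (fun j => ∫⁻ x, F j x ∂M) atTop (𝓝 (∫⁻ x, f x ∂M)) :=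
    fun M => lintegral_tendsto_of_tendsto_of_monotone (fun j => (F j).measurable.aemeasurable)
      (ae_of_all _ hFm) (ae_of_all _ hFt)
  have hmeas : ∀ j, Measurable fun ω => E (∫⁻ x, F j x ∂(pointMeasure fun n => X n ω)) :=
    fun j => hE.measurable.comp
      ((Measure.measurable_lintegral (F j).measurable).comp hX.measurable_pointMeasure)
  have hpt : ∀ ω, Tendsto (fun j => E (∫⁻ x, F j x ∂(pointMeasure fun n => X n ω))) atTop
      (𝓝 (E (∫⁻ x, f x ∂(pointMeasure fun n => X n ω)))) :=
    fun ω => (hE.tendsto _).comp (hcont _)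
  have hL : Tendsto (fun j => ∫⁻ ω, E (∫⁻ x, F j x ∂(pointMeasure fun n => X n ω)) ∂μ) atTop
      (𝓝 (∫⁻ ω, E (∫⁻ x, f x ∂(pointMeasure fun n => X n ω)) ∂μ)) := by
    rcases hE' with hE' | hE'
    · refine lintegral_tendsto_of_tendsto_of_monotone (fun j => (hmeas j).aemeasurable)
        (ae_of_all _ fun ω i j hij => hE' (lintegral_mono fun x => hFm x hij)) (ae_of_all _ hpt)
    · exact tendsto_lintegral_of_dominated_convergence (fun _ => 1) hmeas
        (fun j => ae_of_all _ fun ω => hE' _) (by simp) (ae_of_all _ hpt)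
  have hR : Tendsto (fun j => E (ENNReal.ofReal lam * ∫⁻ x, D (F j x))) atTop
      (𝓝 (E (ENNReal.ofReal lam * ∫⁻ x, D (f x)))) := by
    refine (hE.tendsto _).comp (ENNReal.Tendsto.const_mul ?_ (Or.inr ENNReal.ofReal_ne_top))
    exact lintegral_tendsto_of_tendsto_of_monotone
      (fun j => (hD.measurable.comp (F j).measurable).aemeasurable)
      (ae_of_all _ fun x i j hij => hDm (hFm x hij))
      (ae_of_all _ fun x => (hD.tendsto _).comp (hFt x))
  simp_rw [hkey] at hL
  exact tendsto_nhds_unique hL hR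

/-- For one set this is the generating function `E z^N = exp (lam |B| (z - 1))` at `z = exp r`. No
finiteness is assumed: the version with infinite values is what decides, for negative `s`, whether
the Laplace transform exists. -/
theorem lintegral_expPos [IsProbabilityMeasure μ] (hX : IsHomogeneousPPP μ X lam)
    (hlam : 0 ≤ lam) {f : Plane → ℝ≥0∞} (hf : Measurable f) :
    ∫⁻ ω, expPos (∑' n, f (X n ω)) ∂μ =
      expPos (ENNReal.ofReal lam * ∫⁻ x, (expPos (f x) - 1)) := by
  refine hX.lintegral_of_simpleFunc (D := fun x => expPos x - 1) continuous_expPos expPos_zero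
    expPos_add (Or.inl monotone_expPos) ?_ ?_ ?_ ?_ hf
  · exact (ENNReal.continuous_sub_right 1).comp continuous_expPos
  · exact fun x y h => tsub_le_tsub_right (monotone_expPos h) _
  · simp [expPos_zero]
  · intro c B hc hB hB'
    obtain ⟨r, hr, rfl⟩ : ∃ r : ℝ, 0 ≤ r ∧ c = ENNReal.ofReal r :=
      ⟨c.toReal, ENNReal.toReal_nonneg, (ENNReal.ofReal_toReal hc).symm⟩
    rw [hX.lintegral_pow_pointCount hlam hB hB' (fun k => expPos (ENNReal.ofReal r * (k : ℝ≥0∞)))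
      (Real.exp_pos r).le]
    · have h1 : 0 ≤ Real.exp r - 1 := by linarith [Real.one_le_exp hr]
      rw [expPos_ofReal hr, ← ENNReal.ofReal_one, ← ENNReal.ofReal_sub _ zero_le_one,
        ← ENNReal.ofReal_toReal hB'.ne, ← ENNReal.ofReal_mul h1,
        ← ENNReal.ofReal_mul hlam, expPos_ofReal, Measure.real]
      · ring_nf
      · positivity
    · intro k
      rw [ENat.toENNReal_coe, ← ENNReal.ofReal_natCast, ← ENNReal.ofReal_mul hr,
        expPos_ofReal (by positivity), ← Real.exp_nat_mul, mul_comm]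

theorem lintegral_expNeg [IsProbabilityMeasure μ] (hX : IsHomogeneousPPP μ X lam)
    (hlam : 0 ≤ lam) {f : Plane → ℝ≥0∞} (hf : Measurable f) :
    ∫⁻ ω, expNeg (∑' n, f (X n ω)) ∂μ =
      expNeg (ENNReal.ofReal lam * ∫⁻ x, (1 - expNeg (f x))) := by
  refine hX.lintegral_of_simpleFunc (D := fun x => 1 - expNeg x) continuous_expNeg expNeg_zero
    expNeg_add (Or.inr expNeg_le_one) ?_ ?_ ?_ ?_ hf
  · exact (ENNReal.continuous_sub_left ENNReal.one_ne_top).comp continuous_expNeg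
  · exact fun x y h => tsub_le_tsub_left (antitone_expNeg h) _
  · simp [expNeg_zero]
  · intro c B hc hB hB'
    obtain ⟨r, hr, rfl⟩ : ∃ r : ℝ, 0 ≤ r ∧ c = ENNReal.ofReal r :=
      ⟨c.toReal, ENNReal.toReal_nonneg, (ENNReal.ofReal_toReal hc).symm⟩
    rw [hX.lintegral_pow_pointCount hlam hB hB' (fun k => expNeg (ENNReal.ofReal r * (k : ℝ≥0∞)))
      (Real.exp_pos (-r)).le]
    · have h1 : 0 ≤ 1 - Real.exp (-r) := by
        have : Real.exp (-r) ≤ 1 := Real.exp_le_one_iff.2 (by linarith)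
        linarith
      rw [expNeg_ofReal hr, ← ENNReal.ofReal_one, ← ENNReal.ofReal_sub _ (Real.exp_pos _).le,
        ← ENNReal.ofReal_toReal hB'.ne, ← ENNReal.ofReal_mul h1,
        ← ENNReal.ofReal_mul hlam, expNeg_ofReal, Measure.real]
      · ring_nf
      · positivity
    · intro k
      rw [ENat.toENNReal_coe, ← ENNReal.ofReal_natCast, ← ENNReal.ofReal_mul hr,
        expNeg_ofReal (by positivity), ← Real.exp_nat_mul]
      ring_nf

end IsHomogeneousPPP

/-! ### Encoding locally finite measures by their values on countably many test sets. -/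

/-- The index set of a countable family of bounded Borel sets determining every locally finite
measure on the plane. -/
abbrev TestIndex : Type := (Σ n, MeasurableSpace.countablePartition Plane n) × ℕ

/-- A countable family of bounded Borel sets determining every locally finite measure. -/
def testSet (j : TestIndex) : Set Plane := j.1.2.1 ∩ Metric.ball 0 j.2

lemma measurableSet_testSet (j : TestIndex) : MeasurableSet (testSet j) :=
  (MeasurableSpace.measurableSet_countablePartition _ j.1.2.2).inter
    Metric.isOpen_ball.measurableSet

/-- The values of a measure on the test sets. -/
noncomputable def testValues (M : Measure Plane) : TestIndex → ℝ≥0∞ := fun j => M (testSet j)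

lemma measurable_testValues : Measurable testValues :=
  measurable_pi_lambda _ fun j => Measure.measurable_coe (measurableSet_testSet j)

/-- A π-λ argument starting from finite unions of partition cells, on which the value is a finite
sum of test values. Cutting with a ball keeps all values finite, so that complements become
subtractions. -/
lemma exists_measurable_apply_inter_ball (k : ℕ) {B : Set Plane} (hB : MeasurableSet B) :
    ∃ G : (TestIndex → ℝ≥0∞) → ℝ≥0∞, Measurable G ∧ ∀ M : Measure Plane,
      (∀ k : ℕ, M (Metric.ball 0 k) < ⊤) → M (B ∩ Metric.ball 0 k) = G (testValues M) := by
  have hgen : (inferInstance : MeasurableSpace Plane) =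
      .generateFrom {s | ∃ n, MeasurableSet[countableFiltration Plane n] s} := by
    rw [Set.ofPred_exists, MeasurableSpace.generateFrom_iUnion_measurableSet
      (countableFiltration Plane), iSup_countableFiltration]
  have hpi : IsPiSystem {s | ∃ n, MeasurableSet[countableFiltration Plane n] s} := by
    rw [Set.ofPred_exists]
    exact isPiSystem_iUnion_of_monotone _
      (fun n ↦ @MeasurableSpace.isPiSystem_measurableSet _ (countableFiltration Plane n))
      fun _ _ ↦ (countableFiltration Plane).mono
  have hbasic : ∀ n (s : Set Plane), MeasurableSet[countableFiltration Plane n] s →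
      ∃ G : (TestIndex → ℝ≥0∞) → ℝ≥0∞, Measurable G ∧ ∀ M : Measure Plane,
      (∀ k : ℕ, M (Metric.ball 0 k) < ⊤) → M (s ∩ Metric.ball 0 k) = G (testValues M) := by
    intro n s hs
    obtain ⟨S, hS, rfl⟩ :=
      (MeasurableSpace.measurableSet_generateFrom_countablePartition_iff n s).1 hs
    refine ⟨fun t => ∑ u : S, t (⟨n, u.1, hS u.2⟩, k),
      Finset.measurable_sum _ fun u _ => measurable_pi_apply _, fun M _ => ?_⟩
    have : (⋃₀ (S : Set (Set Plane))) ∩ Metric.ball 0 (k : ℝ) =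
        ⋃ u ∈ S, u ∩ Metric.ball 0 (k : ℝ) := by
      simp [Set.sUnion_eq_biUnion, Set.iUnion_inter]
    rw [this, measure_biUnion_finset, ← Finset.sum_coe_sort]
    · rfl
    · intro u hu v hv huv
      exact (MeasurableSpace.disjoint_countablePartition (hS hu) (hS hv) huv).mono
        Set.inter_subset_left Set.inter_subset_left
    · exact fun u hu => (MeasurableSpace.measurableSet_countablePartition n (hS hu)).inter
        Metric.isOpen_ball.measurableSet
  -- `G₀` returns the mass of the whole ball, from which the complement step subtracts.
  obtain ⟨G₀, hG₀, hG₀'⟩ := hbasic 0 Set.univ (@MeasurableSet.univ _ (countableFiltration Plane 0))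
  induction B, hB using MeasurableSpace.induction_on_inter hgen hpi with
  | empty => exact ⟨0, measurable_zero, by simp⟩
  | basic s hs =>
    obtain ⟨n, hn⟩ := hs
    exact hbasic n s hn
  | compl s hs ih =>
    obtain ⟨G, hG, hG'⟩ := ih
    refine ⟨fun t => G₀ t - G t, hG₀.sub hG, fun M hM => ?_⟩
    change _ = G₀ _ - G _
    rw [← hG₀' M hM, ← hG' M hM, ← measure_sdiff]
    · congr 1
      ext x
      simp only [Set.mem_inter_iff, Set.mem_compl_iff, Set.mem_sdiff, Set.mem_univ]
      tauto
    · exact Set.inter_subset_inter_left _ (Set.subset_univ s)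
    · exact (hs.inter Metric.isOpen_ball.measurableSet).nullMeasurableSet
    · exact ((measure_mono Set.inter_subset_right).trans_lt (hM k)).ne
  | iUnion s hd hs ih =>
    choose G hG hG' using ih
    refine ⟨fun t => ∑' i, G i t, Measurable.tsum hG, fun M hM => ?_⟩
    rw [Set.iUnion_inter, measure_iUnion]
    · exact tsum_congr fun i => hG' i M hM
    · exact fun i j hij => (hd hij).mono Set.inter_subset_left Set.inter_subset_left
    · exact fun i => (hs i).inter Metric.isOpen_ball.measurableSet

/-- The same π-λ argument with a parameter, starting from measurable rectangles. -/
lemma exists_measurable_slice_inter_ball {Y : Type*} [MeasurableSpace Y] (k : ℕ)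
    {V : Set (Y × Plane)} (hV : MeasurableSet V) :
    ∃ G : Y × (TestIndex → ℝ≥0∞) → ℝ≥0∞, Measurable G ∧ ∀ (y : Y) (M : Measure Plane),
      (∀ k : ℕ, M (Metric.ball 0 k) < ⊤) →
        M ({x | (y, x) ∈ V} ∩ Metric.ball 0 k) = G (y, testValues M) := by
  obtain ⟨G₀, hG₀, hG₀'⟩ := exists_measurable_apply_inter_ball k MeasurableSet.univ
  induction V, hV using MeasurableSpace.induction_on_inter generateFrom_prod.symm isPiSystem_prod
    with
  | empty => exact ⟨0, measurable_zero, by simp⟩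
  | basic s hs =>
    obtain ⟨A, hA, B, hB, rfl⟩ := hs
    obtain ⟨G, hG, hG'⟩ := exists_measurable_apply_inter_ball k (B := B) hB
    refine ⟨fun q => A.indicator 1 q.1 * G q.2, ?_, fun y M hM => ?_⟩
    · exact ((measurable_one.indicator hA).comp measurable_fst).mul (hG.comp measurable_snd)
    · by_cases hy : y ∈ A
      · simp [hy, ← hG' M hM]
      · simp [hy]
  | compl s hs ih =>
    obtain ⟨G, hG, hG'⟩ := ih
    refine ⟨fun q => G₀ q.2 - G q, (hG₀.comp measurable_snd).sub hG, fun y M hM => ?_⟩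
    have hs' : MeasurableSet {x | (y, x) ∈ s} := measurable_prodMk_left hs
    change _ = G₀ _ - G _
    rw [← hG₀' M hM, ← hG' y M hM, ← measure_sdiff]
    · congr 1
      ext x
      simp only [Set.mem_inter_iff, Set.mem_compl_iff, Set.mem_sdiff, Set.mem_univ,
        Set.mem_ofPred_eq]
      tauto
    · exact Set.inter_subset_inter_left _ (Set.subset_univ _)
    · exact (hs'.inter Metric.isOpen_ball.measurableSet).nullMeasurableSet
    · exact ((measure_mono Set.inter_subset_right).trans_lt (hM k)).ne
  | iUnion s hd hs ih =>
    choose G hG hG' using ih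
    refine ⟨fun t => ∑' i, G i t, Measurable.tsum hG, fun y M hM => ?_⟩
    have : {x | (y, x) ∈ ⋃ i, s i} ∩ Metric.ball 0 (k : ℝ) =
        ⋃ i, {x | (y, x) ∈ s i} ∩ Metric.ball 0 (k : ℝ) := by
      ext x; simp
    rw [this, measure_iUnion]
    · exact tsum_congr fun i => hG' i y M hM
    · intro i j hij
      exact Set.disjoint_left.2 fun x hx hx' => Set.disjoint_left.1 (hd hij) hx.1 hx'.1
    · exact fun i => (measurable_prodMk_left (hs i)).inter Metric.isOpen_ball.measurableSet

/-- Integrals with respect to a locally finite measure are measurable functions of its values on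
the test sets. -/
lemma exists_measurable_lintegral_eq {Y : Type*} [MeasurableSpace Y] {f : Y × Plane → ℝ≥0∞}
    (hf : Measurable f) :
    ∃ G : Y × (TestIndex → ℝ≥0∞) → ℝ≥0∞, Measurable G ∧ ∀ (y : Y) (M : Measure Plane),
      (∀ k : ℕ, M (Metric.ball 0 k) < ⊤) → ∫⁻ x, f (y, x) ∂M = G (y, testValues M) := by
  refine Measurable.ennreal_induction (motive := fun f : Y × Plane → ℝ≥0∞ =>
    ∃ G : Y × (TestIndex → ℝ≥0∞) → ℝ≥0∞, Measurable G ∧ ∀ (y : Y) (M : Measure Plane),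
      (∀ k : ℕ, M (Metric.ball 0 k) < ⊤) → ∫⁻ x, f (y, x) ∂M = G (y, testValues M)) ?_ ?_ ?_ hf
  · intro c V hV
    choose G hG hG' using fun k => exists_measurable_slice_inter_ball k hV
    refine ⟨fun q => c * ⨆ k, G k q, (Measurable.iSup hG).const_mul c, fun y M hM => ?_⟩
    have hV' : MeasurableSet {x | (y, x) ∈ V} := measurable_prodMk_left hV
    have h1 : ∀ x, V.indicator (fun _ => c) (y, x) =
        ({x | (y, x) ∈ V}).indicator (fun _ => c) x := fun x => rfl
    simp_rw [h1]
    rw [lintegral_indicator_const hV']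
    simp_rw [← hG' _ y M hM]
    rw [← Monotone.measure_iUnion]
    · congr 2
      ext x
      simp only [Set.mem_iUnion, Set.mem_inter_iff, exists_and_left]
      exact ⟨fun h => ⟨h, by simpa using exists_nat_gt ‖x‖⟩, fun h => h.1⟩
    · intro i j hij
      exact Set.inter_subset_inter_right _ (Metric.ball_subset_ball (by exact_mod_cast hij))
  · intro f g hd hf hg ihf ihg
    obtain ⟨F, hF, hF'⟩ := ihf
    obtain ⟨G, hG, hG'⟩ := ihg
    refine ⟨fun q => F q + G q, hF.add hG, fun y M hM => ?_⟩
    simp only [Pi.add_apply]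
    rw [lintegral_add_left (f := fun x => f (y, x)) (hf.comp measurable_prodMk_left),
      hF' y M hM, hG' y M hM]
  · intro f hf hm ih
    choose G hG hG' using ih
    refine ⟨fun q => ⨆ n, G n q, Measurable.iSup hG, fun y M hM => ?_⟩
    refine (lintegral_iSup (f := fun n x => f n (y, x))
      (fun n => (hf n).comp measurable_prodMk_left) fun i j hij x => hm hij (y, x)).trans ?_
    exact iSup_congr fun n => hG' n y M hM

lemma measurableSet_slice {Y Z : Type*} [MeasurableSpace Y] [MeasurableSpace Z] {V : Set (Y × Z)}
    (hV : MeasurableSet V) (y : Y) : MeasurableSet {z | (y, z) ∈ V} :=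
  measurable_prodMk_left hV

lemma measurable_restrict_measure {S : Set Plane} (hS : MeasurableSet S) :
    Measurable fun M : Measure Plane => M.restrict S := by
  refine Measure.measurable_of_measurable_coe _ fun B hB => ?_
  simp_rw [Measure.restrict_apply hB]
  exact Measure.measurable_coe (hB.inter hS)

lemma measurable_restrict_pointMeasure {Y : Type*} [MeasurableSpace Y] {V : Set (Y × Plane)}
    (hV : MeasurableSet V) :
    Measurable fun q : Y × (ℕ → Plane) => (pointMeasure q.2).restrict {x | (q.1, x) ∈ V} := by
  refine Measure.measurable_of_measurable_coe _ fun B hB => ?_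
  have h : ∀ q : Y × (ℕ → Plane), (pointMeasure q.2).restrict {x | (q.1, x) ∈ V} B =
      ∑' n, (V ∩ Prod.snd ⁻¹' B).indicator 1 (q.1, q.2 n) := by
    intro q
    rw [Measure.restrict_apply hB, pointMeasure_apply _ (hB.inter (measurableSet_slice hV _))]
    refine tsum_congr fun n => ?_
    by_cases h1 : q.2 n ∈ B <;> by_cases h2 : (q.1, q.2 n) ∈ V <;> simp [h1, h2]
  simp_rw [h]
  exact Measurable.tsum fun n => (measurable_one.indicator (hV.inter (measurable_snd hB))).comp
    (measurable_fst.prodMk ((measurable_pi_apply n).comp measurable_snd))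

/-! ### Refining partitions that separate points. -/

section Partition

open MeasurableSpace

lemma countablePartitionSet_succ_subset {Y : Type*} [MeasurableSpace Y] [CountablyGenerated Y]
    (n : ℕ) (x : Y) : countablePartitionSet (n + 1) x ⊆ countablePartitionSet n x := by
  classical
  unfold countablePartitionSet
  rw [memPartitionSet_succ]
  split_ifs
  · exact Set.inter_subset_left
  · exact Set.sdiff_subset

lemma mem_countablePartitionSet_iff_eq {Y : Type*} [MeasurableSpace Y] [CountablyGenerated Y]
    (n : ℕ) (x y : Y) :
    y ∈ countablePartitionSet n x ↔ countablePartitionSet n y = countablePartitionSet n x :=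
  (countablePartitionSet_eq_iff y (countablePartitionSet_mem n x)).symm

/-- The cells of all levels generate the σ-algebra, so two points that are never separated lie in
the same measurable sets, in particular in the same singletons. -/
lemma eq_of_forall_mem_countablePartitionSet {Y : Type*} [MeasurableSpace Y]
    [CountablyGenerated Y] [MeasurableSingletonClass Y] {x y : Y}
    (h : ∀ n, y ∈ countablePartitionSet n x) : y = x := by
  have key : ∀ s : Set Y, MeasurableSet s → (x ∈ s ↔ y ∈ s) := by
    intro s hs
    rw [← generateFrom_iUnion_countablePartition Y] at hs
    induction s, hs using generateFrom_induction with
    | hC t ht _ =>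
      obtain ⟨n, hn⟩ := Set.mem_iUnion.1 ht
      rw [← countablePartitionSet_eq_iff x hn, ← countablePartitionSet_eq_iff y hn,
        (mem_countablePartitionSet_iff_eq n x y).1 (h n)]
    | empty => simp
    | compl t _ ih => simp [ih]
    | iUnion t _ ih => simp [ih]
  exact (key {x} (measurableSet_singleton x)).1 rfl

/-- The pairs of points separated by the `n`-th partition. -/
def separatedPairs (n : ℕ) : Set (Plane × Plane) := {q | q.2 ∉ countablePartitionSet n q.1}

lemma measurableSet_separatedPairs (n : ℕ) : MeasurableSet (separatedPairs n) := by
  have : (separatedPairs n)ᶜ = ⋃ s : countablePartition Plane n, s.1 ×ˢ s.1 := by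
    ext ⟨x, y⟩
    simp only [separatedPairs, Set.mem_compl_iff, Set.mem_ofPred_eq, not_not, Set.mem_iUnion,
      Set.mem_prod]
    constructor
    · exact fun h => ⟨⟨_, countablePartitionSet_mem n x⟩, mem_countablePartitionSet n x, h⟩
    · rintro ⟨s, hx, hy⟩
      rwa [countablePartitionSet_of_mem s.2 hx]
  rw [← MeasurableSet.compl_iff, this]
  exact MeasurableSet.iUnion fun s => (measurableSet_countablePartition n s.2).prod
    (measurableSet_countablePartition n s.2)

lemma measurableSet_offDiag : MeasurableSet {q : Plane × Plane | q.2 ≠ q.1} :=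
  (measurableSet_eq_fun measurable_snd measurable_fst).compl

/-- The cells containing `x` decrease to the singleton of `x`, so the restrictions increase to the
measure off `x`; continuity from below gives the limit on each test set, and convergence in the
product is coordinatewise. -/
lemma tendsto_testValues_restrict_separatedPairs (M : Measure Plane) (x : Plane) :
    Tendsto (fun n => testValues (M.restrict {y | (x, y) ∈ separatedPairs n})) atTop
      (𝓝 (testValues (M.restrict {y | y ≠ x}))) := by
  rw [tendsto_pi_nhds]
  intro j
  simp only [testValues, Measure.restrict_apply (measurableSet_testSet j)]
  have hU : testSet j ∩ {y | y ≠ x} = ⋃ n, testSet j ∩ {y | (x, y) ∈ separatedPairs n} := by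
    rw [← Set.inter_iUnion]
    congr 1
    ext y
    simp only [Set.mem_ofPred_eq, Set.mem_iUnion, separatedPairs]
    constructor
    · intro h
      by_contra! h'
      exact h (eq_of_forall_mem_countablePartitionSet h')
    · rintro ⟨n, hn⟩ rfl
      exact hn (mem_countablePartitionSet n y)
  rw [hU]
  refine tendsto_measure_iUnion_atTop (monotone_nat_of_le_succ fun n => ?_)
  exact Set.inter_subset_inter_right _
    fun y hy h => hy (countablePartitionSet_succ_subset n x h)

end Partition

/-! ### Mecke's formula on sets of finite area. -/

namespace IsHomogeneousPPP

variable {Ω : Type*} [MeasurableSpace Ω] {μ : Measure Ω} {X : ℕ → Ω → Plane} {lam : ℝ}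

lemma measurable_testValues_restrict (hX : IsHomogeneousPPP μ X lam) {Y : Type*}
    [MeasurableSpace Y] {V : Set (Y × Plane)} (hV : MeasurableSet V) :
    Measurable fun q : Y × Ω =>
      testValues ((pointMeasure fun n => X n q.2).restrict {x | (q.1, x) ∈ V}) :=
  measurable_testValues.comp ((measurable_restrict_pointMeasure hV).comp
    (measurable_fst.prodMk (hX.measurable_seq.comp measurable_snd)))

/-- Points in a set are independent of the process outside of it. -/
lemma lintegral_setLIntegral_restrict_compl [IsProbabilityMeasure μ]
    (hX : IsHomogeneousPPP μ X lam) (hlam : 0 ≤ lam) {A S : Set Plane} (hA : MeasurableSet A)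
    (hA' : volume A < ⊤) (hS : MeasurableSet S) (hAS : A ⊆ S)
    {H : Plane × (TestIndex → ℝ≥0∞) → ℝ≥0∞} (hH : Measurable H) :
    ∫⁻ ω, ∫⁻ x in A, H (x, testValues ((pointMeasure fun n => X n ω).restrict Sᶜ))
        ∂(pointMeasure fun n => X n ω) ∂μ =
      ENNReal.ofReal lam * ∫⁻ x in A, ∫⁻ ω, H (x, testValues
        ((pointMeasure fun n => X n ω).restrict Sᶜ)) ∂μ := by
  set τ : Ω → TestIndex → ℝ≥0∞ :=
    fun ω => testValues ((pointMeasure fun n => X n ω).restrict Sᶜ) with hτdef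
  have hτ : Measurable τ := 
    measurable_testValues.comp ((measurable_restrict_measure hS.compl).comp
      hX.measurable_pointMeasure)
  have := Measure.isProbabilityMeasure_map (μ := μ) hτ.aemeasurable
  have hfin : IsFiniteMeasure (ENNReal.ofReal lam • volume.restrict A) := by
    refine ⟨?_⟩
    simp only [Measure.smul_apply, smul_eq_mul, Measure.restrict_apply_univ]
    exact ENNReal.mul_lt_top ENNReal.ofReal_lt_top hA'
  have hset : ∀ n {s}, MeasurableSet s → MeasurableSet {ω | X n ω ∈ s} :=
    fun n s hs => hX.measurable n hs
  -- On a rectangle `s ×ˢ t` the right side is the expectation of the count in `A ∩ s` times the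
  -- indicator that the process off `S` lies in `t`. Since `A ⊆ S`, the two factors are independent.
  have hprod : (ENNReal.ofReal lam • volume.restrict A).prod (μ.map τ) =
      Measure.sum fun n => (μ.restrict {ω | X n ω ∈ A}).map fun ω => (X n ω, τ ω) := by
    refine Measure.prod_eq fun s t hs ht => ?_
    rw [Measure.sum_apply _ (hs.prod ht)]
    have h1 : ∀ n, (μ.restrict {ω | X n ω ∈ A}).map (fun ω => (X n ω, τ ω)) (s ×ˢ t) =
        ∫⁻ ω, (A ∩ s).indicator 1 (X n ω) * (τ ⁻¹' t).indicator 1 ω ∂μ := by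
      intro n
      rw [Measure.map_apply ((hX.measurable n).prodMk hτ) (hs.prod ht), Measure.restrict_apply
        (((hX.measurable n).prodMk hτ) (hs.prod ht)), ← lintegral_indicator_one
        ((((hX.measurable n).prodMk hτ) (hs.prod ht)).inter (hset n hA))]
      refine lintegral_congr fun ω => ?_
      by_cases h1 : X n ω ∈ A <;> by_cases h2 : X n ω ∈ s <;> by_cases h3 : τ ω ∈ t <;>
        simp [h1, h2, h3]
    simp_rw [h1]
    have hmn : ∀ n, Measurable fun ω =>
        (A ∩ s).indicator (1 : Plane → ℝ≥0∞) (X n ω) * (τ ⁻¹' t).indicator 1 ω := fun n =>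
      ((measurable_one.indicator (hA.inter hs)).comp (hX.measurable n)).mul
        (measurable_one.indicator (hτ ht))
    rw [← lintegral_tsum fun n => (hmn n).aemeasurable]
    simp_rw [ENNReal.tsum_mul_right, ← pointMeasure_apply _ (hA.inter hs),
      pointMeasure_eq_pointCount X (hA.inter hs)]
    have hind : IndepFun (fun ω => (pointCount X (A ∩ s) ω : ℝ≥0∞))
        (fun ω => (τ ⁻¹' t).indicator (1 : Ω → ℝ≥0∞) ω) μ := by
      have h := hX.indepFun_pointCount_pointMeasure (hA.inter hs)
        (fun j : TestIndex => testSet j ∩ Sᶜ)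
        (fun j => (measurableSet_testSet j).inter hS.compl)
        (fun j => Set.disjoint_left.2 fun x hx hx' => hx'.2 (hAS hx.1))
      have h' : (fun ω (j : TestIndex) => pointMeasure (fun n => X n ω) (testSet j ∩ Sᶜ)) = τ := by
        funext ω j
        simp [τ, testValues, Measure.restrict_apply (measurableSet_testSet j)]
      rw [h'] at h
      exact h.comp (φ := fun k : ℕ∞ => (k : ℝ≥0∞)) 
        (ψ := t.indicator (1 : (TestIndex → ℝ≥0∞) → ℝ≥0∞))
        (measurable_of_countable _) (measurable_one.indicator ht)
    have hmc : Measurable fun ω => (pointCount X (A ∩ s) ω : ℝ≥0∞) :=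
      (measurable_of_countable (fun k : ℕ∞ => (k : ℝ≥0∞))).comp
        (hX.measurable_pointCount (hA.inter hs))
    have := lintegral_mul_eq_lintegral_mul_lintegral_of_indepFun hmc
      (measurable_one.indicator (hτ ht)) hind
    simp only [Pi.mul_apply] at this
    rw [this, lintegral_indicator_one (hτ ht), hX.lintegral_pointCount hlam (hA.inter hs)
      ((measure_mono Set.inter_subset_left).trans_lt hA'), Measure.map_apply hτ ht,
      Measure.smul_apply, Measure.restrict_apply hs, Set.inter_comm, smul_eq_mul]
  have h2 : ∫⁻ q, H q ∂((ENNReal.ofReal lam • volume.restrict A).prod (μ.map τ)) =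
      ENNReal.ofReal lam * ∫⁻ x in A, ∫⁻ ω, H (x, τ ω) ∂μ := by
    rw [lintegral_prod _ hH.aemeasurable, lintegral_smul_measure, smul_eq_mul]
    congr 1
    refine lintegral_congr fun x => ?_
    exact lintegral_map (hH.comp measurable_prodMk_left) hτ
  rw [← h2, hprod, lintegral_sum_measure]
  have hHω : ∀ n, Measurable fun ω => H (X n ω, τ ω) :=
    fun n => hH.comp ((hX.measurable n).prodMk hτ)
  have h3 : ∀ n, ∫⁻ q, H q ∂((μ.restrict {ω | X n ω ∈ A}).map fun ω => (X n ω, τ ω)) =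
      ∫⁻ ω, A.indicator (fun x => H (x, τ ω)) (X n ω) ∂μ := by
    intro n
    rw [lintegral_map hH ((hX.measurable n).prodMk hτ), ← lintegral_indicator (hset n hA)]
    rfl
  simp_rw [h3]
  rw [← lintegral_tsum]
  · refine lintegral_congr fun ω => ?_
    have hm : Measurable (A.indicator fun x => H (x, τ ω)) :=
      (hH.comp measurable_prodMk_right).indicator hA
    rw [← lintegral_indicator hA, lintegral_pointMeasure _ hm]
  · intro n
    exact ((hHω n).indicator (hset n hA)).aemeasurable

end IsHomogeneousPPP

namespace IsHomogeneousPPP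

variable {Ω : Type*} [MeasurableSpace Ω] {μ : Measure Ω} {X : ℕ → Ω → Plane} {lam : ℝ}

lemma measurable_lintegral_pointMeasure (hX : IsHomogeneousPPP μ X lam) {f : Ω → Plane → ℝ≥0∞}
    (hf : Measurable (Function.uncurry f)) :
    Measurable fun ω => ∫⁻ x, f ω x ∂(pointMeasure fun n => X n ω) := by
  have h : ∀ ω, ∫⁻ x, f ω x ∂(pointMeasure fun n => X n ω) = ∑' n, f ω (X n ω) :=
    fun ω => lintegral_pointMeasure _ (hf.comp measurable_prodMk_left)
  simp_rw [h]
  exact Measurable.tsum fun n => hf.comp (measurable_id.prodMk (hX.measurable n))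

lemma measurable_testValues_swap (hX : IsHomogeneousPPP μ X lam)
    {F : Plane × (TestIndex → ℝ≥0∞) → ℝ≥0∞} (hF : Measurable F) {V : Set (Plane × Plane)}
    (hV : MeasurableSet V) :
    Measurable fun q : Plane × Ω =>
      F (q.1, testValues ((pointMeasure fun n => X n q.2).restrict {y | (q.1, y) ∈ V})) :=
  hF.comp (measurable_fst.prodMk (hX.measurable_testValues_restrict hV))

lemma measurable_testValues_restrict_ne (hX : IsHomogeneousPPP μ X lam) :
    Measurable fun q : Plane × Ω =>
      testValues ((pointMeasure fun n => X n q.2).restrict {y | y ≠ q.1}) :=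
  hX.measurable_testValues_restrict (V := {q | q.2 ≠ q.1}) measurableSet_offDiag

/-- For `x` in a fixed cell, the points separated from `x` are exactly those outside that cell, a
set no longer depending on `x`; the independence statement applies on each cell, and the cells are
summed. -/
lemma lintegral_setLIntegral_separatedPairs [IsProbabilityMeasure μ]
    (hX : IsHomogeneousPPP μ X lam) (hlam : 0 ≤ lam) {A : Set Plane} (hA : MeasurableSet A)
    (hA' : volume A < ⊤) (n : ℕ) {F : Plane × (TestIndex → ℝ≥0∞) → ℝ≥0∞} (hF : Measurable F) :
    ∫⁻ ω, ∫⁻ x in A, F (x, testValues ((pointMeasure fun n => X n ω).restrict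
        {y | (x, y) ∈ separatedPairs n})) ∂(pointMeasure fun n => X n ω) ∂μ =
      ENNReal.ofReal lam * ∫⁻ x in A, ∫⁻ ω, F (x, testValues
        ((pointMeasure fun n => X n ω).restrict {y | (x, y) ∈ separatedPairs n})) ∂μ := by
  let P := MeasurableSpace.countablePartition Plane n
  have hP : ∀ s : P, MeasurableSet s.1 :=
    fun s => MeasurableSpace.measurableSet_countablePartition n s.2
  have hAP : ∀ s : P, MeasurableSet (A ∩ s.1) := fun s => hA.inter (hP s)
  have hU : A = ⋃ s : P, A ∩ s.1 := by
    rw [← Set.inter_iUnion, ← Set.sUnion_eq_iUnion,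
      MeasurableSpace.sUnion_countablePartition, Set.inter_univ]
  have hd : Pairwise (Function.onFun Disjoint fun s : P => A ∩ s.1) := by
    intro s t hst
    exact (MeasurableSpace.disjoint_countablePartition s.2 t.2
      (fun h => hst (Subtype.ext h))).mono Set.inter_subset_right Set.inter_subset_right
  have hcell : ∀ (s : P), ∀ x ∈ A ∩ s.1, {y | (x, y) ∈ separatedPairs n} = (s.1)ᶜ := by
    intro s x hx
    ext y
    simp only [separatedPairs, Set.mem_ofPred_eq, Set.mem_compl_iff,
      MeasurableSpace.countablePartitionSet_of_mem s.2 hx.2]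
  have h1 : ∀ (M ν : Measure Plane), ∫⁻ x in A, F (x, testValues (M.restrict
      {y | (x, y) ∈ separatedPairs n})) ∂ν =
      ∑' s : P, ∫⁻ x in A ∩ s.1, F (x, testValues (M.restrict (s.1)ᶜ)) ∂ν := by
    intro M ν
    conv_lhs => rw [hU]
    rw [lintegral_iUnion hAP hd]
    refine tsum_congr fun s => setLIntegral_congr_fun (hAP s) fun x hx => ?_
    simp only [hcell s x hx]
  have h2 : ∫⁻ x in A, ∫⁻ ω, F (x, testValues
        ((pointMeasure fun n => X n ω).restrict {y | (x, y) ∈ separatedPairs n})) ∂μ =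
      ∑' s : P, ∫⁻ x in A ∩ s.1, ∫⁻ ω, F (x, testValues
        ((pointMeasure fun n => X n ω).restrict (s.1)ᶜ)) ∂μ := by
    conv_lhs => rw [hU]
    rw [lintegral_iUnion hAP hd]
    refine tsum_congr fun s => setLIntegral_congr_fun (hAP s) fun x hx => ?_
    simp only [hcell s x hx]
  simp_rw [h1]
  rw [h2, lintegral_tsum, ← ENNReal.tsum_mul_left]
  · refine tsum_congr fun s => ?_
    exact hX.lintegral_setLIntegral_restrict_compl hlam (hAP s)
      ((measure_mono Set.inter_subset_left).trans_lt hA') (hP s) Set.inter_subset_right hF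
  · intro s
    simp_rw [← lintegral_indicator (hAP s)]
    refine (hX.measurable_lintegral_pointMeasure ?_).aemeasurable
    have hτ : Measurable fun ω => testValues ((pointMeasure fun n => X n ω).restrict (s.1)ᶜ) :=
      measurable_testValues.comp ((measurable_restrict_measure (hP s).compl).comp
        hX.measurable_pointMeasure)
    exact (hF.comp (measurable_snd.prodMk (hτ.comp measurable_fst))).indicator
      (measurable_snd (hAP s))

lemma ae_pointMeasure_eq_zero [IsProbabilityMeasure μ]
    (hX : IsHomogeneousPPP μ X lam) (hlam : 0 ≤ lam) {B : Set Plane} (hB : MeasurableSet B)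
    (hB' : volume B = 0) : ∀ᵐ ω ∂μ, pointMeasure (fun n => X n ω) B = 0 := by
  have h := hX.lintegral_pointMeasure_apply hlam hB (by simp [hB'])
  rw [hB', mul_zero, lintegral_eq_zero_iff (hX.measurable_pointMeasure_apply hB)] at h
  exact h

/-- The number `n` of the partition tends to infinity. Continuity of `F` gives pointwise
convergence, and boundedness together with the finite mean count in `A` gives domination. -/
lemma lintegral_setLIntegral_boundedContinuous [IsProbabilityMeasure μ]
    (hX : IsHomogeneousPPP μ X lam) (hlam : 0 ≤ lam) {A : Set Plane} (hA : MeasurableSet A)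
    (hA' : volume A < ⊤)
    (F : BoundedContinuousFunction (Plane × (TestIndex → ℝ≥0∞)) NNReal) :
    ∫⁻ ω, ∫⁻ x in A, F (x, testValues ((pointMeasure fun n => X n ω).restrict
        {y | y ≠ x})) ∂(pointMeasure fun n => X n ω) ∂μ =
      ENNReal.ofReal lam * ∫⁻ x in A, ∫⁻ ω, F (x, testValues
        (pointMeasure fun n => X n ω)) ∂μ := by
  obtain ⟨c, hc⟩ : ∃ c : NNReal, ∀ q, F q ≤ c := by
    refine ⟨nndist F 0, fun q => ?_⟩
    have := F.dist_coe_le_dist (g := 0) q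
    rw [← NNReal.coe_le_coe, coe_nndist]
    simpa [NNReal.dist_eq] using this
  have hF : Measurable fun q => (F q : ℝ≥0∞) := F.continuous.measurable.coe_nnreal_ennreal
  have hc' : ∀ q, (F q : ℝ≥0∞) ≤ c := fun q => by exact_mod_cast hc q
  have hlim : ∀ (M : Measure Plane) (x : Plane), Tendsto (fun n => (F (x, testValues (M.restrict
      {y | (x, y) ∈ separatedPairs n})) : ℝ≥0∞)) atTop
      (𝓝 (F (x, testValues (M.restrict {y | y ≠ x})))) := by
    intro M x
    refine (ENNReal.continuous_coe.comp F.continuous).continuousAt.tendsto.comp ?_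
    exact tendsto_const_nhds.prodMk_nhds (tendsto_testValues_restrict_separatedPairs M x)
  have hmeas : ∀ n, Measurable fun q : Plane × Ω =>
      (F (q.1, testValues ((pointMeasure fun n => X n q.2).restrict
        {y | (q.1, y) ∈ separatedPairs n})) : ℝ≥0∞) :=
    fun n => hX.measurable_testValues_swap hF (measurableSet_separatedPairs n)
  have hL : Tendsto (fun n => ∫⁻ ω, ∫⁻ x in A, F (x, testValues
      ((pointMeasure fun n => X n ω).restrict {y | (x, y) ∈ separatedPairs n}))
        ∂(pointMeasure fun n => X n ω) ∂μ) atTop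
      (𝓝 (∫⁻ ω, ∫⁻ x in A, F (x, testValues ((pointMeasure fun n => X n ω).restrict
        {y | y ≠ x})) ∂(pointMeasure fun n => X n ω) ∂μ)) := by
    refine tendsto_lintegral_of_dominated_convergence
      (fun ω => c * pointMeasure (fun n => X n ω) A) (fun n => ?_) (fun n => ?_) ?_ ?_
    · simp_rw [← lintegral_indicator hA]
      refine hX.measurable_lintegral_pointMeasure ?_
      exact ((hmeas n).comp measurable_swap).indicator (measurable_snd hA)
    · refine ae_of_all _ fun ω => ?_
      exact (setLIntegral_mono measurable_const fun x _ => hc' _).trans_eq (by simp)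
    · rw [lintegral_const_mul _ (hX.measurable_pointMeasure_apply hA),
        hX.lintegral_pointMeasure_apply hlam hA hA']
      exact ENNReal.mul_ne_top ENNReal.coe_ne_top
        (ENNReal.mul_ne_top ENNReal.ofReal_ne_top hA'.ne)
    · filter_upwards [hX.ae_pointMeasure_lt_top hlam hA hA'] with ω hω
      refine tendsto_lintegral_of_dominated_convergence (fun _ => c) (fun n => ?_)
        (fun n => ae_of_all _ fun x => hc' _) ?_ (ae_of_all _ fun x => hlim _ x)
      · exact (hmeas n).comp measurable_prodMk_right
      · simpa using ENNReal.mul_ne_top ENNReal.coe_ne_top hω.ne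
  have hR : Tendsto (fun n => ENNReal.ofReal lam * ∫⁻ x in A, ∫⁻ ω, F (x, testValues
      ((pointMeasure fun n => X n ω).restrict {y | (x, y) ∈ separatedPairs n})) ∂μ) atTop
      (𝓝 (ENNReal.ofReal lam * ∫⁻ x in A, ∫⁻ ω, F (x, testValues
        ((pointMeasure fun n => X n ω).restrict {y | y ≠ x})) ∂μ)) := by
    refine ENNReal.Tendsto.const_mul ?_ (Or.inr ENNReal.ofReal_ne_top)
    refine tendsto_lintegral_of_dominated_convergence (fun _ => c) (fun n => ?_)
      (fun n => ae_of_all _ fun x => ?_) ?_ (ae_of_all _ fun x => ?_)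
    · exact (hmeas n).lintegral_prod_right'
    · exact (lintegral_mono fun ω => hc' _).trans_eq (by simp)
    · simpa using ENNReal.mul_ne_top ENNReal.coe_ne_top hA'.ne
    · refine tendsto_lintegral_of_dominated_convergence (fun _ => c) (fun n => ?_)
        (fun n => ae_of_all _ fun ω => hc' _) (by simp) (ae_of_all _ fun ω => hlim _ x)
      exact (hmeas n).comp measurable_prodMk_left
  -- A fixed location almost surely carries no point, so deleting it changes nothing.
  have hRe : ∀ x, ∫⁻ ω, (F (x, testValues
      ((pointMeasure fun n => X n ω).restrict {y | y ≠ x})) : ℝ≥0∞) ∂μ =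
      ∫⁻ ω, F (x, testValues (pointMeasure fun n => X n ω)) ∂μ := by
    intro x
    refine lintegral_congr_ae ?_
    filter_upwards [hX.ae_pointMeasure_eq_zero hlam (measurableSet_singleton x)
      (measure_singleton x)] with ω hω
    rw [Measure.restrict_eq_self_of_ae_mem]
    exact compl_mem_ae_iff.2 hω
  simp_rw [hRe] at hR
  refine tendsto_nhds_unique hL (hR.congr fun n => ?_)
  exact (hX.lintegral_setLIntegral_separatedPairs hlam hA hA' n hF).symm

/-- **Mecke's formula** for the homogeneous Poisson point process. -/
theorem lintegral_setLIntegral_ne [IsProbabilityMeasure μ]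
    (hX : IsHomogeneousPPP μ X lam) (hlam : 0 ≤ lam) {A : Set Plane} (hA : MeasurableSet A)
    (hA' : volume A < ⊤) {F : Plane × (TestIndex → ℝ≥0∞) → ℝ≥0∞} (hF : Measurable F) :
    ∫⁻ ω, ∫⁻ x in A, F (x, testValues ((pointMeasure fun n => X n ω).restrict
        {y | y ≠ x})) ∂(pointMeasure fun n => X n ω) ∂μ =
      ENNReal.ofReal lam * ∫⁻ x in A, ∫⁻ ω, F (x, testValues
        (pointMeasure fun n => X n ω)) ∂μ := by
  have hτ : Measurable fun q : Plane × Ω => (q.1, testValues (pointMeasure fun n => X n q.2)) :=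
    measurable_fst.prodMk (measurable_testValues.comp
      (hX.measurable_pointMeasure.comp measurable_snd))
  have hσ : ∀ n, Measurable fun ω => (X n ω, testValues ((pointMeasure fun n => X n ω).restrict
      {y | y ≠ X n ω})) := by
    intro n
    have h : Measurable fun ω => (X n ω, ω) := (hX.measurable n).prodMk measurable_id
    have h' := hX.measurable_testValues_restrict_ne.comp h
    simp only [Function.comp_def] at h'
    exact (hX.measurable n).prodMk h'
  -- The two sides are integrals of `F` against `m₁`, the law of a point in `A` together with the
  -- rest of the process, and `m₂`, a product law. Introducing them by an existential keeps them
  -- opaque to rewriting.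
  obtain ⟨m₁, hm₁⟩ : ∃ m, m = Measure.sum fun n => (μ.restrict {ω | X n ω ∈ A}).map fun ω =>
    (X n ω, testValues ((pointMeasure fun n => X n ω).restrict {y | y ≠ X n ω})) := ⟨_, rfl⟩
  obtain ⟨m₂, hm₂⟩ : ∃ m, m = ((ENNReal.ofReal lam • volume.restrict A).prod μ).map
    fun q : Plane × Ω => (q.1, testValues (pointMeasure fun n => X n q.2)) := ⟨_, rfl⟩
  have hfin : IsFiniteMeasure (ENNReal.ofReal lam • volume.restrict A) := by
    refine ⟨?_⟩
    simp only [Measure.smul_apply, smul_eq_mul, Measure.restrict_apply_univ]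
    exact ENNReal.mul_lt_top ENNReal.ofReal_lt_top hA'
  have h1 : ∀ {G : Plane × (TestIndex → ℝ≥0∞) → ℝ≥0∞}, Measurable G → ∫⁻ q, G q ∂m₁ =
      ∫⁻ ω, ∫⁻ x in A, G (x, testValues ((pointMeasure fun n => X n ω).restrict
        {y | y ≠ x})) ∂(pointMeasure fun n => X n ω) ∂μ := by
    intro G hG
    have hset : ∀ n, MeasurableSet {ω | X n ω ∈ A} := fun n => hX.measurable n hA
    rw [hm₁, lintegral_sum_measure]
    have h3 : ∀ n, ∫⁻ q, G q ∂((μ.restrict {ω | X n ω ∈ A}).map fun ω =>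
        (X n ω, testValues ((pointMeasure fun n => X n ω).restrict {y | y ≠ X n ω}))) =
        ∫⁻ ω, A.indicator (fun x => G (x, testValues ((pointMeasure fun n => X n ω).restrict
          {y | y ≠ x}))) (X n ω) ∂μ := by
      intro n
      rw [lintegral_map hG (hσ n), ← lintegral_indicator (hset n)]
      rfl
    simp_rw [h3]
    rw [← lintegral_tsum]
    · refine lintegral_congr fun ω => ?_
      rw [← lintegral_indicator hA, lintegral_pointMeasure]
      have hω : Measurable fun x : Plane => (x, ω) := measurable_prodMk_right
      have h' := hX.measurable_testValues_restrict_ne.comp hω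
      simp only [Function.comp_def] at h'
      exact (hG.comp (measurable_id.prodMk h')).indicator hA
    · intro n
      exact (((hG.comp (hσ n))).indicator (hset n)).aemeasurable
  have h2 : ∀ {G : Plane × (TestIndex → ℝ≥0∞) → ℝ≥0∞}, Measurable G → ∫⁻ q, G q ∂m₂ =
      ENNReal.ofReal lam * ∫⁻ x in A, ∫⁻ ω, G (x, testValues
        (pointMeasure fun n => X n ω)) ∂μ := by
    intro G hG
    have hGτ := hG.comp hτ
    simp only [Function.comp_def] at hGτ
    rw [hm₂, lintegral_map hG hτ, lintegral_prod _ hGτ.aemeasurable,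
      lintegral_smul_measure, smul_eq_mul]
  have hfin₂ : IsFiniteMeasure m₂ := by
    rw [hm₂]
    infer_instance
  -- Bounded continuous functions determine a finite measure here, so the preceding limit identifies
  -- the two measures and hence covers every measurable `F`.
  have h : m₂ = m₁ := by
    refine ext_of_forall_lintegral_eq_of_IsFiniteMeasure fun F => ?_
    have hF : Measurable fun q => (F q : ℝ≥0∞) := F.continuous.measurable.coe_nnreal_ennreal
    rw [h1 hF, h2 hF]
    exact (hX.lintegral_setLIntegral_boundedContinuous hlam hA hA' F).symm
  rw [← h1 hF, ← h2 hF, h]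

end IsHomogeneousPPP

/-! ### Mecke's formula for functionals of locally bounded measures. -/

/-- A measure on the plane that is finite on bounded sets. -/
def LocallyBounded (M : Measure Plane) : Prop := ∀ k : ℕ, M (Metric.ball 0 k) < ⊤

lemma LocallyBounded.restrict {M : Measure Plane} (hM : LocallyBounded M) (S : Set Plane) :
    LocallyBounded (M.restrict S) := fun k =>
  (Measure.restrict_apply_le _ _).trans_lt (hM k)

/-- A functional of a parameter and a locally bounded measure that is a measurable function of the
parameter and of the values of the measure on the test sets. -/
def TestMeasurable {Y : Type*} [MeasurableSpace Y] (Φ : Y → Measure Plane → ℝ≥0∞) : Prop :=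
  ∃ F : Y × (TestIndex → ℝ≥0∞) → ℝ≥0∞, Measurable F ∧
    ∀ y M, LocallyBounded M → Φ y M = F (y, testValues M)

section TestMeasurable

variable {Y : Type*} [MeasurableSpace Y]

lemma testMeasurable_lintegral {f : Y → Plane → ℝ≥0∞} (hf : Measurable (Function.uncurry f)) :
    TestMeasurable fun y M => ∫⁻ x, f y x ∂M :=
  exists_measurable_lintegral_eq hf

lemma testMeasurable_apply {V : Set (Y × Plane)} (hV : MeasurableSet V) :
    TestMeasurable fun y M => M {x | (y, x) ∈ V} := by
  have h := testMeasurable_lintegral (f := fun y x => V.indicator 1 (y, x))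
    (measurable_one.indicator hV)
  convert h using 3 with y M
  exact (lintegral_indicator_one (measurableSet_slice hV y)).symm

lemma TestMeasurable.comp {Φ : Y → Measure Plane → ℝ≥0∞} (hΦ : TestMeasurable Φ)
    {G : Y × ℝ≥0∞ → ℝ≥0∞} (hG : Measurable G) : TestMeasurable fun y M => G (y, Φ y M) := by
  obtain ⟨F, hF, h⟩ := hΦ
  exact ⟨fun q => G (q.1, F q), hG.comp (measurable_fst.prodMk hF),
    fun y M hM => congrArg (fun z => G (y, z)) (h y M hM)⟩

lemma TestMeasurable.mul {Φ Ψ : Y → Measure Plane → ℝ≥0∞} (hΦ : TestMeasurable Φ)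
    (hΨ : TestMeasurable Ψ) : TestMeasurable fun y M => Φ y M * Ψ y M := by
  obtain ⟨F, hF, h⟩ := hΦ
  obtain ⟨G, hG, h'⟩ := hΨ
  exact ⟨fun q => F q * G q, hF.mul hG, fun y M hM => congrArg₂ (· * ·) (h y M hM) (h' y M hM)⟩

lemma testMeasurable_restrict {V : Set (Y × Plane)} (hV : MeasurableSet V)
    {G : Y × (TestIndex → ℝ≥0∞) → ℝ≥0∞} (hG : Measurable G) :
    TestMeasurable fun y M => G (y, testValues (M.restrict {x | (y, x) ∈ V})) := by
  have h : ∀ j, TestMeasurable fun y M => M {x | (y, x) ∈ V ∩ Prod.snd ⁻¹' testSet j} :=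
    fun j => testMeasurable_apply (hV.inter (measurable_snd (measurableSet_testSet j)))
  choose F hF hF' using h
  refine ⟨fun q => G (q.1, fun j => F j q), hG.comp (measurable_fst.prodMk
    (measurable_pi_lambda _ hF)), fun y M hM => ?_⟩
  change G (y, _) = G (y, _)
  congr 2
  funext j
  rw [← hF' j y M hM, testValues, Measure.restrict_apply (measurableSet_testSet j)]
  congr 1
  ext x
  simp [and_comm]

end TestMeasurable

namespace IsHomogeneousPPP

variable {Ω : Type*} [MeasurableSpace Ω] {μ : Measure Ω} {X : ℕ → Ω → Plane} {lam : ℝ}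

lemma ae_locallyBounded [IsProbabilityMeasure μ] (hX : IsHomogeneousPPP μ X lam)
    (hlam : 0 ≤ lam) : ∀ᵐ ω ∂μ, LocallyBounded (pointMeasure fun n => X n ω) :=
  ae_all_iff.2 fun _ => hX.ae_pointMeasure_lt_top hlam Metric.isOpen_ball.measurableSet
    measure_ball_lt_top

lemma lintegral_restrict_ne_eq_tsum (hX : IsHomogeneousPPP μ X lam)
    {Φ : Plane → Measure Plane → ℝ≥0∞} (hΦ : TestMeasurable Φ) {ω : Ω}
    (hω : LocallyBounded (pointMeasure fun n => X n ω)) :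
    ∫⁻ x, Φ x ((pointMeasure fun n => X n ω).restrict {y | y ≠ x})
        ∂(pointMeasure fun n => X n ω) =
      ∑' n, Φ (X n ω) ((pointMeasure fun n => X n ω).restrict {y | y ≠ X n ω}) := by
  obtain ⟨F, hF, h⟩ := hΦ
  simp_rw [fun x => h x _ (hω.restrict {y | y ≠ x})]
  have hω : Measurable fun x : Plane => (x, ω) := measurable_prodMk_right
  have h' := hX.measurable_testValues_restrict_ne.comp hω
  simp only [Function.comp_def] at h'
  exact lintegral_pointMeasure _ (hF.comp (measurable_id.prodMk h'))

/-- **Mecke's formula** for functionals determined by the test sets. -/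
theorem lintegral_tsum_restrict_ne [IsProbabilityMeasure μ] (hX : IsHomogeneousPPP μ X lam)
    (hlam : 0 ≤ lam) {Φ : Plane → Measure Plane → ℝ≥0∞} (hΦ : TestMeasurable Φ) :
    ∫⁻ ω, ∑' n, Φ (X n ω) ((pointMeasure fun n => X n ω).restrict {y | y ≠ X n ω}) ∂μ =
      ENNReal.ofReal lam * ∫⁻ x, ∫⁻ ω, Φ x (pointMeasure fun n => X n ω) ∂μ := by
  have hb := hX.ae_locallyBounded hlam
  have e1 : ∫⁻ ω, ∑' n, Φ (X n ω) ((pointMeasure fun n => X n ω).restrict {y | y ≠ X n ω}) ∂μ =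
      ∫⁻ ω, ∫⁻ x, Φ x ((pointMeasure fun n => X n ω).restrict {y | y ≠ x})
        ∂(pointMeasure fun n => X n ω) ∂μ := by
    refine lintegral_congr_ae ?_
    filter_upwards [hb] with ω hω
    exact (hX.lintegral_restrict_ne_eq_tsum hΦ hω).symm
  rw [e1]
  obtain ⟨F, hF, h⟩ := hΦ
  have e2 : ∫⁻ ω, ∫⁻ x, Φ x ((pointMeasure fun n => X n ω).restrict {y | y ≠ x})
        ∂(pointMeasure fun n => X n ω) ∂μ =
      ∫⁻ ω, ∫⁻ x, F (x, testValues ((pointMeasure fun n => X n ω).restrict {y | y ≠ x}))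
        ∂(pointMeasure fun n => X n ω) ∂μ := by
    refine lintegral_congr_ae ?_
    filter_upwards [hb] with ω hω
    exact lintegral_congr fun x => h x _ (hω.restrict _)
  have e3 : ∀ x, ∫⁻ ω, Φ x (pointMeasure fun n => X n ω) ∂μ =
      ∫⁻ ω, F (x, testValues (pointMeasure fun n => X n ω)) ∂μ := by
    intro x
    refine lintegral_congr_ae ?_
    filter_upwards [hb] with ω hω
    exact h x _ hω
  rw [e2]
  simp_rw [e3]
  -- Unit-width annuli split the plane into pieces of finite area, to which the local formula
  -- applies.
  let A : ℕ → Set Plane := fun k => {x | ⌊‖x‖⌋₊ = k}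
  have hA : ∀ k, MeasurableSet (A k) := fun k =>
    (Nat.measurable_floor.comp measurable_norm) (measurableSet_singleton k)
  have hA' : ∀ k, volume (A k) < ⊤ := by
    intro k
    refine (measure_mono fun x hx => ?_).trans_lt (measure_ball_lt_top (x := 0) (r := (k : ℝ) + 1))
    have : ⌊‖x‖⌋₊ = k := hx
    rw [mem_ball_zero_iff, ← this]
    exact Nat.lt_floor_add_one _
  have hd : Pairwise (Function.onFun Disjoint A) := fun i j hij =>
    Set.disjoint_left.2 fun x hx hx' => hij (hx.symm.trans hx')
  have hU : ⋃ k, A k = Set.univ := by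
    ext x; simp [A]
  have hsplit : ∀ (ν : Measure Plane) (f : Plane → ℝ≥0∞),
      ∫⁻ x, f x ∂ν = ∑' k, ∫⁻ x in A k, f x ∂ν := by
    intro ν f
    rw [← lintegral_iUnion hA hd, hU, setLIntegral_univ]
  have hm : Measurable fun q : Ω × Plane =>
      F (q.2, testValues ((pointMeasure fun n => X n q.1).restrict {y | y ≠ q.2})) := by
    have h' := hX.measurable_testValues_restrict_ne.comp
      (measurable_swap (α := Ω) (β := Plane))
    simp only [Function.comp_def, Prod.fst_swap, Prod.snd_swap] at h'
    exact hF.comp (measurable_snd.prodMk h')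
  rw [hsplit volume]
  simp_rw [fun ω => hsplit (pointMeasure fun n => X n ω)]
  rw [lintegral_tsum, ← ENNReal.tsum_mul_left]
  · exact tsum_congr fun k => hX.lintegral_setLIntegral_ne hlam (hA k) (hA' k) hF
  · intro k
    simp_rw [← lintegral_indicator (hA k)]
    refine (hX.measurable_lintegral_pointMeasure (f := fun ω => (A k).indicator fun x =>
      F (x, testValues ((pointMeasure fun n => X n ω).restrict {y | y ≠ x}))) ?_).aemeasurable
    exact hm.indicator (measurable_snd (hA k))

end IsHomogeneousPPP

/-! ### The nearest point: measurability, existence and absence of ties. -/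

lemma measurable_nearestPoint : Measurable nearestPoint := by
  classical
  let near : ℕ → (ℕ → Plane) → Prop := fun n φ => ∀ m, ‖φ n‖ ≤ ‖φ m‖
  have hnear : ∀ n, MeasurableSet {φ | near n φ} := by
    intro n
    have : {φ | near n φ} = ⋂ m, {φ | ‖φ n‖ ≤ ‖φ m‖} := by ext; simp [near]
    rw [this]
    exact MeasurableSet.iInter fun m => measurableSet_le (measurable_pi_apply n).norm
      (measurable_pi_apply m).norm
  -- The second alternative provides a witness even for configurations without a nearest point, so
  -- that `Nat.find` is defined everywhere.
  let p : ℕ → (ℕ → Plane) → Prop := fun n φ => near n φ ∨ ∀ k, ¬ near k φ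
  have hp : ∀ φ, ∃ n, p n φ := by
    intro φ
    by_cases h : ∃ n, near n φ
    · exact h.imp fun n hn => Or.inl hn
    · exact ⟨0, Or.inr (not_exists.1 h)⟩
  have hpm : ∀ n, MeasurableSet {φ | p n φ} := by
    intro n
    have : {φ | p n φ} = {φ | near n φ} ∪ ⋂ k, {φ | near k φ}ᶜ := by ext; simp [p]
    rw [this]
    exact (hnear n).union (MeasurableSet.iInter fun k => (hnear k).compl)
  have hf : ∀ n, Measurable fun φ : ℕ → Plane => if near n φ then φ n else 0 := fun n =>
    Measurable.ite (hnear n) (measurable_pi_apply n) measurable_const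
  have h := Measurable.find hf hpm hp
  convert h using 1
  funext φ
  by_cases hφ : ∃ n, near n φ
  · have hf1 : near (Nat.find (hp φ)) φ :=
      (Nat.find_spec (hp φ)).resolve_right fun h => hφ.elim fun n hn => h n hn
    have hf2 : Nat.find hφ = Nat.find (hp φ) := by
      refine le_antisymm (Nat.find_min' _ hf1) (Nat.find_min' _ (Or.inl (Nat.find_spec hφ)))
    rw [nearestPoint, dif_pos hφ, if_pos hf1, ← hf2]
  · rw [nearestPoint, dif_neg hφ, if_neg fun h => hφ ⟨_, h⟩]

/-- Only finitely many indices fall in a ball containing `φ 0`, so the least norm is attained there.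
-/
lemma exists_nearestPoint_eq {φ : ℕ → Plane} (hφ : LocallyBounded (pointMeasure φ)) :
    ∃ n, nearestPoint φ = φ n ∧ ∀ m, ‖φ n‖ ≤ ‖φ m‖ := by
  have h : ∃ n, ∀ m, ‖φ n‖ ≤ ‖φ m‖ := by
    obtain ⟨k, hk⟩ := exists_nat_gt ‖φ 0‖
    have hfin : {n | φ n ∈ Metric.ball (0 : Plane) k}.Finite := by
      have h := hφ k
      rw [pointMeasure_eq_pointCount (fun n (_ : Unit) => φ n) Metric.isOpen_ball.measurableSet (),
        pointCount] at h
      simpa using h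
    obtain ⟨n, hn, hmin⟩ := hfin.exists_minimalFor (fun n => ‖φ n‖) _ ⟨0, by simpa using hk⟩
    refine ⟨n, fun m => ?_⟩
    by_cases hm : φ m ∈ Metric.ball (0 : Plane) k
    · rcases le_total ‖φ n‖ ‖φ m‖ with h | h
      · exact h
      · exact hmin hm h
    · have h1 : ‖φ n‖ < k := by simpa using hn
      have h2 : (k : ℝ) ≤ ‖φ m‖ := by simpa using hm
      exact h1.le.trans h2
  classical
  exact ⟨Nat.find h, by rw [nearestPoint, dif_pos h], Nat.find_spec h⟩

namespace IsHomogeneousPPP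

variable {Ω : Type*} [MeasurableSpace Ω] {μ : Measure Ω} {X : ℕ → Ω → Plane} {lam : ℝ}

lemma measurable_nearestPoint (hX : IsHomogeneousPPP μ X lam) :
    Measurable fun ω => nearestPoint fun n => X n ω :=
  _root_.measurable_nearestPoint.comp hX.measurable_seq

/-- Almost surely, no two distinct points have the same norm. -/
lemma ae_eq_of_norm_eq [IsProbabilityMeasure μ] (hX : IsHomogeneousPPP μ X lam)
    (hlam : 0 ≤ lam) : ∀ᵐ ω ∂μ, ∀ n m, ‖X m ω‖ = ‖X n ω‖ → X m ω = X n ω := by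
  have hS : MeasurableSet {q : Plane × Plane | ‖q.2‖ = ‖q.1‖} :=
    measurableSet_eq_fun measurable_snd.norm measurable_fst.norm
  -- Mecke's formula for the number of other points on the circle through a given point: circles
  -- centred at the origin have area zero.
  have hΦ := testMeasurable_apply hS
  have h := hX.lintegral_tsum_restrict_ne hlam hΦ
  have hsph : ∀ x : Plane, {y | (x, y) ∈ {q : Plane × Plane | ‖q.2‖ = ‖q.1‖}} =
      Metric.sphere 0 ‖x‖ := by
    intro x; ext y; simp
  have hR : ∀ᵐ x : Plane, ∫⁻ ω, pointMeasure (fun n => X n ω)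
      {y | (x, y) ∈ {q : Plane × Plane | ‖q.2‖ = ‖q.1‖}} ∂μ = 0 := by
    refine ae_of_all _ fun x => ?_
    rw [hsph, hX.lintegral_pointMeasure_apply hlam Metric.isClosed_sphere.measurableSet,
      Measure.addHaar_sphere, mul_zero]
    rw [Measure.addHaar_sphere]
    exact ENNReal.zero_lt_top
  rw [lintegral_congr_ae hR, lintegral_zero, mul_zero] at h
  have hm : Measurable fun ω => ∑' n, ((pointMeasure fun n => X n ω).restrict
      {y | y ≠ X n ω}) {y | (X n ω, y) ∈ {q : Plane × Plane | ‖q.2‖ = ‖q.1‖}} := by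
    refine Measurable.tsum fun n => ?_
    have e : ∀ ω, ((pointMeasure fun n => X n ω).restrict
      {y | y ≠ X n ω}) {y | (X n ω, y) ∈ {q : Plane × Plane | ‖q.2‖ = ‖q.1‖}} =
        ∑' m, {q : Plane × Plane | ‖q.2‖ = ‖q.1‖ ∧ q.2 ≠ q.1}.indicator 1 (X n ω, X m ω) := by
      intro ω
      rw [Measure.restrict_apply (measurableSet_slice hS _), pointMeasure_apply]
      · rfl
      · exact (measurableSet_slice hS _).inter (measurableSet_singleton _).compl
    simp_rw [e]
    exact Measurable.tsum fun m => (measurable_one.indicator (hS.inter measurableSet_offDiag)).comp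
      ((hX.measurable n).prodMk (hX.measurable m))
  rw [lintegral_eq_zero_iff hm] at h
  filter_upwards [h] with ω hω n m hnm
  have h1 : ((pointMeasure fun n => X n ω).restrict {y | y ≠ X n ω})
      {y | (X n ω, y) ∈ {q : Plane × Plane | ‖q.2‖ = ‖q.1‖}} = 0 := ENNReal.tsum_eq_zero.1 hω n
  rw [Measure.restrict_apply (measurableSet_slice hS _), pointMeasure_apply_eq_zero_iff] at h1
  · by_contra hne
    exact h1 m ⟨hnm, hne⟩
  · exact (measurableSet_slice hS _).inter (measurableSet_singleton _).compl

end IsHomogeneousPPP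

/-! ### Joint law of the nearest point and the points beyond it. -/

/-- The pairs `(x, y)` such that `y` is farther from the origin than `x`. -/
def fartherPairs : Set (Plane × Plane) := {q | ‖q.1‖ < ‖q.2‖}

lemma measurableSet_fartherPairs : MeasurableSet fartherPairs :=
  measurableSet_lt measurable_fst.norm measurable_snd.norm

/-- The indicator that no point is as close to the origin as `x`, and that the points that are
farther away belong to `U`. -/
noncomputable def voidFunctional (U : Set (Plane × (TestIndex → ℝ≥0∞))) (x : Plane)
    (M : Measure Plane) : ℝ≥0∞ :=
  ({0} : Set ℝ≥0∞).indicator 1 (M {y | (x, y) ∈ fartherPairsᶜ}) *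
    U.indicator 1 (x, testValues (M.restrict {y | (x, y) ∈ fartherPairs}))

lemma testMeasurable_voidFunctional {U : Set (Plane × (TestIndex → ℝ≥0∞))}
    (hU : MeasurableSet U) : TestMeasurable (voidFunctional U) := by
  refine TestMeasurable.mul ?_ (testMeasurable_restrict measurableSet_fartherPairs
    (measurable_one.indicator hU))
  exact (testMeasurable_apply measurableSet_fartherPairs.compl).comp
    ((measurable_one.indicator (measurableSet_singleton 0)).comp measurable_snd)

/-- Only the indices at the nearest point contribute, each by the same amount. Its multiplicity
appears because repetitions in the sequence have not yet been excluded. -/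
lemma tsum_voidFunctional {φ : ℕ → Plane}
    (h1 : LocallyBounded (pointMeasure φ))
    (h2 : ∀ n m, ‖φ m‖ = ‖φ n‖ → φ m = φ n) (U : Set (Plane × (TestIndex → ℝ≥0∞))) :
    ∑' n, voidFunctional U (φ n) ((pointMeasure φ).restrict {y | y ≠ φ n}) =
      pointMeasure φ {nearestPoint φ} *
      U.indicator 1 ((nearestPoint φ), testValues ((pointMeasure φ).restrict
        {y | ((nearestPoint φ), y) ∈ fartherPairs})) := by
  obtain ⟨n₀, hn₀, hmin⟩ := exists_nearestPoint_eq h1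
  rw [hn₀, pointMeasure_apply _ (measurableSet_singleton _), ← ENNReal.tsum_mul_right]
  refine tsum_congr fun n => ?_
  have hV : MeasurableSet {y | (φ n, y) ∈ fartherPairsᶜ} :=
    measurableSet_slice measurableSet_fartherPairs.compl _
  have hVn : MeasurableSet {y | (φ n, y) ∈ fartherPairs} :=
    measurableSet_slice measurableSet_fartherPairs _
  have hne : MeasurableSet {y | y ≠ φ n} := (measurableSet_singleton _).compl
  by_cases hn : φ n = φ n₀
  · have hz : (pointMeasure φ).restrict {y | y ≠ φ n}
        {y | (φ n, y) ∈ fartherPairsᶜ} = 0 := by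
      rw [Measure.restrict_apply hV, pointMeasure_apply_eq_zero_iff _ (hV.inter hne)]
      rintro m ⟨hm1, hm2⟩
      refine hm2 (h2 n m (le_antisymm ?_ ?_))
      · simpa [fartherPairs] using hm1
      · rw [hn]; exact hmin m
    have hr : ((pointMeasure φ).restrict {y | y ≠ φ n}).restrict
        {y | (φ n, y) ∈ fartherPairs} =
        (pointMeasure φ).restrict {y | (φ n, y) ∈ fartherPairs} := by
      rw [Measure.restrict_restrict hVn]
      congr 1
      refine Set.inter_eq_left.2 fun y hy => ?_
      rintro rfl
      simp [fartherPairs] at hy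
    rw [voidFunctional, hz, hr, hn]
    simp
  · have hz : (pointMeasure φ).restrict {y | y ≠ φ n}
        {y | (φ n, y) ∈ fartherPairsᶜ} ≠ 0 := by
      rw [Measure.restrict_apply hV, Ne, pointMeasure_apply_eq_zero_iff _ (hV.inter hne)]
      intro h
      refine h n₀ ⟨?_, fun h' => hn h'.symm⟩
      simpa [fartherPairs] using hmin n
    rw [voidFunctional, Set.indicator_of_notMem (by simpa using hz)]
    simp [hn]

namespace IsHomogeneousPPP

variable {Ω : Type*} [MeasurableSpace Ω] {μ : Measure Ω} {X : ℕ → Ω → Plane} {lam : ℝ}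

/-- The two factors concern the closed disc of radius `‖x‖` and its complement, hence are
independent. -/
lemma lintegral_voidFunctional [IsProbabilityMeasure μ] (hX : IsHomogeneousPPP μ X lam)
    {U : Set (Plane × (TestIndex → ℝ≥0∞))} (hU : MeasurableSet U) (x : Plane) :
    ∫⁻ ω, voidFunctional U x (pointMeasure fun n => X n ω) ∂μ =
      μ {ω | pointMeasure (fun n => X n ω) (Metric.closedBall 0 ‖x‖) = 0} *
      μ {ω | (x, testValues ((pointMeasure fun n => X n ω).restrict
        {y | (x, y) ∈ fartherPairs})) ∈ U} := by
  have hball : {y | (x, y) ∈ fartherPairsᶜ} = Metric.closedBall 0 ‖x‖ := by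
    ext y; simp [fartherPairs]
  have hB : MeasurableSet (Metric.closedBall (0 : Plane) ‖x‖) :=
    Metric.isClosed_closedBall.measurableSet
  have hV : MeasurableSet {y | (x, y) ∈ fartherPairs} :=
    measurableSet_slice measurableSet_fartherPairs _
  have hind := hX.indepFun_pointCount_pointMeasure hB
    (fun j : TestIndex => testSet j ∩ {y | (x, y) ∈ fartherPairs})
    (fun j => (measurableSet_testSet j).inter hV)
    (fun j => by
      refine Set.disjoint_left.2 fun y hy hy' => ?_
      rw [← hball] at hy
      exact hy hy'.2)
  have h' : (fun ω (j : TestIndex) => pointMeasure (fun n => X n ω)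
      (testSet j ∩ {y | (x, y) ∈ fartherPairs})) =
      fun ω => testValues ((pointMeasure fun n => X n ω).restrict {y | (x, y) ∈ fartherPairs}) := by
    funext ω j
    simp [testValues, Measure.restrict_apply (measurableSet_testSet j)]
  rw [h'] at hind
  have hm1 : Measurable fun k : ℕ∞ => ({0} : Set ℝ≥0∞).indicator (1 : ℝ≥0∞ → ℝ≥0∞) (k : ℝ≥0∞) :=
    measurable_of_countable _
  have hm2 : Measurable fun t => U.indicator (1 : Plane × (TestIndex → ℝ≥0∞) → ℝ≥0∞) (x, t) :=
    (measurable_one.indicator hU).comp measurable_prodMk_left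
  have hτ : Measurable fun ω => testValues ((pointMeasure fun n => X n ω).restrict
      {y | (x, y) ∈ fartherPairs}) :=
    measurable_testValues.comp ((measurable_restrict_measure hV).comp hX.measurable_pointMeasure)
  have h : ∫⁻ ω, voidFunctional U x (pointMeasure fun n => X n ω) ∂μ = _ :=
    (lintegral_congr fun ω => by
      rw [voidFunctional, hball, pointMeasure_eq_pointCount X hB]
      rfl).trans <| lintegral_mul_eq_lintegral_mul_lintegral_of_indepFun
    (hm1.comp (hX.measurable_pointCount hB)) (hm2.comp hτ) (hind.comp hm1 hm2)
  rw [h]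
  congr 1
  · have hp : MeasurableSet {ω | pointMeasure (fun n => X n ω) (Metric.closedBall 0 ‖x‖) = 0} :=
      (hX.measurable_pointMeasure_apply hB) (measurableSet_singleton 0)
    rw [← lintegral_indicator_one hp]
    refine lintegral_congr fun ω => ?_
    simp only [Function.comp_apply]
    rw [← pointMeasure_eq_pointCount X hB]
    rfl
  · have hp : MeasurableSet {ω | (x, testValues ((pointMeasure fun n => X n ω).restrict
        {y | (x, y) ∈ fartherPairs})) ∈ U} := (measurable_const.prodMk hτ) hU
    rw [← lintegral_indicator_one hp]
    rfl

end IsHomogeneousPPP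

namespace IsHomogeneousPPP

variable {Ω : Type*} [MeasurableSpace Ω] {μ : Measure Ω} {X : ℕ → Ω → Plane} {lam : ℝ}

lemma measure_closedBall_eq_zero [IsProbabilityMeasure μ] (hX : IsHomogeneousPPP μ X lam)
    (hlam : 0 ≤ lam) (x : Plane) :
    μ {ω | pointMeasure (fun n => X n ω) (Metric.closedBall 0 ‖x‖) = 0} =
      ENNReal.ofReal (Real.exp (-(lam * Real.pi) * ‖x‖ ^ 2)) := by
  rw [hX.measure_pointMeasure_eq_zero hlam Metric.isClosed_closedBall.measurableSet
    measure_closedBall_lt_top, Measure.real, EuclideanSpace.volume_closedBall_fin_two,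
    ENNReal.toReal_mul, ENNReal.toReal_pow, ENNReal.toReal_ofReal (norm_nonneg x)]
  congr 2
  rw [ENNReal.toReal_ofReal Real.pi_pos.le]
  ring

/-- The void probability is `exp (-lam π ‖x‖²)`, whose Gaussian integral over the plane is `1 /
lam`. -/
lemma lintegral_measure_closedBall_eq_zero [IsProbabilityMeasure μ]
    (hX : IsHomogeneousPPP μ X lam) (hlam : 0 < lam) :
    ENNReal.ofReal lam * ∫⁻ x : Plane,
      μ {ω | pointMeasure (fun n => X n ω) (Metric.closedBall 0 ‖x‖) = 0} = 1 := by
  simp_rw [hX.measure_closedBall_eq_zero hlam.le]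
  have hb : 0 < lam * Real.pi := by positivity
  have h := GaussianFourier.integral_rexp_neg_mul_sq_norm (V := Plane) hb
  have h' : ∫ x : Plane, Real.exp (-(lam * Real.pi) * ‖x‖ ^ 2) = lam⁻¹ := by
    rw [h]
    simp
    field_simp
  -- A non-integrable function would have Bochner integral `0`, while this one has integral `lam⁻¹ >
  -- 0`.
  have hi : Integrable fun x : Plane => Real.exp (-(lam * Real.pi) * ‖x‖ ^ 2) :=
    not_imp_comm.1 integral_undef (by rw [h']; positivity)
  rw [← ofReal_integral_eq_lintegral_ofReal hi (ae_of_all _ fun x => (Real.exp_pos _).le), h',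
    ← ENNReal.ofReal_mul hlam.le, mul_inv_cancel₀ hlam.ne', ENNReal.ofReal_one]

lemma lintegral_tsum_voidFunctional [IsProbabilityMeasure μ] (hX : IsHomogeneousPPP μ X lam)
    (hlam : 0 ≤ lam) {U : Set (Plane × (TestIndex → ℝ≥0∞))} (hU : MeasurableSet U) :
    ∫⁻ ω, pointMeasure (fun n => X n ω) {nearestPoint fun n => X n ω} *
      U.indicator 1 ((nearestPoint fun n => X n ω), testValues
        ((pointMeasure fun n => X n ω).restrict
          {y | ((nearestPoint fun n => X n ω), y) ∈ fartherPairs})) ∂μ =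
      ENNReal.ofReal lam * ∫⁻ x,
        μ {ω | pointMeasure (fun n => X n ω) (Metric.closedBall 0 ‖x‖) = 0} *
        μ {ω | (x, testValues ((pointMeasure fun n => X n ω).restrict
          {y | (x, y) ∈ fartherPairs})) ∈ U} := by
  have h := hX.lintegral_tsum_restrict_ne hlam (testMeasurable_voidFunctional hU)
  simp_rw [hX.lintegral_voidFunctional hU] at h
  rw [← h]
  refine lintegral_congr_ae ?_
  filter_upwards [hX.ae_locallyBounded hlam, hX.ae_eq_of_norm_eq hlam] with ω h1 h2
  exact (tsum_voidFunctional h1 h2 U).symm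

lemma one_le_pointMeasure_nearestPoint {φ : ℕ → Plane} (hφ : LocallyBounded (pointMeasure φ)) :
    1 ≤ pointMeasure φ {nearestPoint φ} := by
  obtain ⟨n, hn, -⟩ := exists_nearestPoint_eq hφ
  rw [hn, pointMeasure_apply _ (measurableSet_singleton _)]
  exact (by simp : (1 : ℝ≥0∞) ≤ ({φ n} : Set Plane).indicator 1 (φ n)).trans
    (ENNReal.le_tsum (f := fun m => ({φ n} : Set Plane).indicator 1 (φ m)) n)

/-- The multiplicity of the nearest point is at least `1`, and its mean is `1` by the Gaussian
normalisation; hence it is almost surely `1`. -/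
lemma ae_pointMeasure_nearestPoint_eq_one [IsProbabilityMeasure μ]
    (hX : IsHomogeneousPPP μ X lam) (hlam : 0 < lam) :
    ∀ᵐ ω ∂μ, pointMeasure (fun n => X n ω) {nearestPoint fun n => X n ω} = 1 := by
  have h := hX.lintegral_tsum_voidFunctional hlam.le MeasurableSet.univ
  simp only [Set.indicator_univ, Pi.one_apply, mul_one, Set.mem_univ, Set.ofPred_true,
    measure_univ, hX.lintegral_measure_closedBall_eq_zero hlam] at h
  have hm : Measurable fun ω => pointMeasure (fun n => X n ω) {nearestPoint fun n => X n ω} := by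
    have e : ∀ ω, pointMeasure (fun n => X n ω) {nearestPoint fun n => X n ω} =
        ∑' n, {q : Plane × Plane | q.1 = q.2}.indicator 1
          (X n ω, nearestPoint fun n => X n ω) := by
      intro ω
      rw [pointMeasure_apply _ (measurableSet_singleton _)]
      rfl
    simp_rw [e]
    exact Measurable.tsum fun n => (measurable_one.indicator
      (measurableSet_eq_fun measurable_fst measurable_snd)).comp
      ((hX.measurable n).prodMk hX.measurable_nearestPoint)
  have h1 : (fun _ => 1) ≤ᵐ[μ] fun ω =>
      pointMeasure (fun n => X n ω) {nearestPoint fun n => X n ω} := by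
    filter_upwards [hX.ae_locallyBounded hlam.le] with ω hω
    exact one_le_pointMeasure_nearestPoint hω
  have h2 := ae_eq_of_ae_le_of_lintegral_le h1 (by simp) hm.aemeasurable (by rw [h]; simp)
  filter_upwards [h2] with ω hω
  exact hω.symm

/-- The joint law of the nearest point and of the points farther away. -/
lemma measure_nearestPoint_testValues_mem [IsProbabilityMeasure μ]
    (hX : IsHomogeneousPPP μ X lam) (hlam : 0 < lam)
    {U : Set (Plane × (TestIndex → ℝ≥0∞))} (hU : MeasurableSet U) :
    μ {ω | ((nearestPoint fun n => X n ω), testValues ((pointMeasure fun n => X n ω).restrict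
      {y | ((nearestPoint fun n => X n ω), y) ∈ fartherPairs})) ∈ U} =
    ∫⁻ p, μ {ω | (p, testValues ((pointMeasure fun n => X n ω).restrict
      {y | (p, y) ∈ fartherPairs})) ∈ U} ∂(μ.map fun ω => nearestPoint fun n => X n ω) := by
  have hn := hX.measurable_nearestPoint
  have hτ : Measurable fun ω => testValues ((pointMeasure fun n => X n ω).restrict
      {y | ((nearestPoint fun n => X n ω), y) ∈ fartherPairs}) := by
    have h := (hX.measurable_testValues_restrict measurableSet_fartherPairs).comp
      (hn.prodMk measurable_id)
    simpa only [Function.comp_def, id] using h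
  have key : ∀ {U : Set (Plane × (TestIndex → ℝ≥0∞))}, MeasurableSet U →
      μ {ω | ((nearestPoint fun n => X n ω), testValues ((pointMeasure fun n => X n ω).restrict
        {y | ((nearestPoint fun n => X n ω), y) ∈ fartherPairs})) ∈ U} =
      ENNReal.ofReal lam * ∫⁻ x,
        μ {ω | pointMeasure (fun n => X n ω) (Metric.closedBall 0 ‖x‖) = 0} *
        μ {ω | (x, testValues ((pointMeasure fun n => X n ω).restrict
          {y | (x, y) ∈ fartherPairs})) ∈ U} := by
    intro U hU
    have hS : MeasurableSet {ω | ((nearestPoint fun n => X n ω), testValues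
        ((pointMeasure fun n => X n ω).restrict
        {y | ((nearestPoint fun n => X n ω), y) ∈ fartherPairs})) ∈ U} := (hn.prodMk hτ) hU
    rw [← hX.lintegral_tsum_voidFunctional hlam.le hU, ← lintegral_indicator_one hS]
    refine lintegral_congr_ae ?_
    filter_upwards [hX.ae_pointMeasure_nearestPoint_eq_one hlam] with ω hω
    rw [hω, one_mul]
    rfl
  have hw : Measurable fun x : Plane =>
      μ {ω | pointMeasure (fun n => X n ω) (Metric.closedBall 0 ‖x‖) = 0} := by
    simp_rw [hX.measure_closedBall_eq_zero hlam.le]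
    fun_prop
  -- Taking `U = A ×ˢ univ` in `key` shows that the nearest point has density `lam` times the void
  -- probability.
  have hlaw : (μ.map fun ω => nearestPoint fun n => X n ω) =
      (ENNReal.ofReal lam • volume).withDensity fun x : Plane =>
        μ {ω | pointMeasure (fun n => X n ω) (Metric.closedBall 0 ‖x‖) = 0} := by
    ext A hA
    rw [Measure.map_apply hn hA, withDensity_apply _ hA, Measure.restrict_smul,
      lintegral_smul_measure, smul_eq_mul, ← lintegral_indicator hA]
    have h := key (hA.prod MeasurableSet.univ)
    simp only [Set.mem_prod, Set.mem_univ, and_true] at h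
    refine h.trans ?_
    congr 1
    refine lintegral_congr fun x => ?_
    by_cases hx : x ∈ A <;> simp [hx]
  have hm : Measurable fun p => μ {ω | (p, testValues ((pointMeasure fun n => X n ω).restrict
      {y | (p, y) ∈ fartherPairs})) ∈ U} := by
    have h : MeasurableSet {q : Plane × Ω | (q.1, testValues ((pointMeasure fun n =>
        X n q.2).restrict {y | (q.1, y) ∈ fartherPairs})) ∈ U} :=
      (measurable_fst.prodMk (hX.measurable_testValues_restrict measurableSet_fartherPairs)) hU
    exact measurable_measure_prodMk_left h
  rw [key hU, hlaw, lintegral_withDensity_eq_lintegral_mul _ hw hm, lintegral_smul_measure,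
    smul_eq_mul]
  rfl

end IsHomogeneousPPP

/-! ### Conditional law given the nearest point. -/

open Classical in
/-- The sum of `f` over the points of a configuration that are different from `p`. -/
noncomputable def sumOff (p : Plane) (f : Plane → ℝ≥0∞) (φ : ℕ → Plane) : ℝ≥0∞ :=
  ∑' n, if φ n = p then 0 else f (φ n)

/-- Under the law `ν`, the point of the configuration that is nearest to the origin is `p`, and the
other points have the Laplace functional of a Poisson process of density `lam` on the points that
are farther from the origin than `p`. -/
structure IsPoissonBeyond (ν : Measure (ℕ → Plane)) (lam : ℝ) (p : Plane) : Prop where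
  isProbabilityMeasure : IsProbabilityMeasure ν
  nearestPoint_eq : ∀ᵐ φ ∂ν, nearestPoint φ = p ∧ p ∈ Set.range φ
  lintegral_expPos : ∀ f : Plane → ℝ≥0∞, Measurable f → ∫⁻ φ, expPos (sumOff p f φ) ∂ν =
    expPos (ENNReal.ofReal lam * ∫⁻ x in {x | ‖p‖ < ‖x‖}, (expPos (f x) - 1))
  lintegral_expNeg : ∀ f : Plane → ℝ≥0∞, Measurable f → ∫⁻ φ, expNeg (sumOff p f φ) ∂ν =
    expNeg (ENNReal.ofReal lam * ∫⁻ x in {x | ‖p‖ < ‖x‖}, (1 - expNeg (f x)))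
  ae_sumOff_ne_top : ∀ f : Plane → ℝ≥0∞, Measurable f → ∫⁻ x in {x | ‖p‖ < ‖x‖}, f x ≠ ⊤ →
    ∀ᵐ φ ∂ν, sumOff p f φ ≠ ⊤

namespace IsHomogeneousPPP

variable {Ω : Type*} [MeasurableSpace Ω] {μ : Measure Ω} {X : ℕ → Ω → Plane} {lam : ℝ}

/-- Campbell's formula: Mecke's formula for a functional that ignores the configuration. -/
lemma lintegral_tsum_points [IsProbabilityMeasure μ] (hX : IsHomogeneousPPP μ X lam)
    (hlam : 0 ≤ lam) {f : Plane → ℝ≥0∞} (hf : Measurable f) :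
    ∫⁻ ω, ∑' n, f (X n ω) ∂μ = ENNReal.ofReal lam * ∫⁻ x, f x := by
  have h := hX.lintegral_tsum_restrict_ne hlam (Φ := fun x _ => f x)
    ⟨fun q => f q.1, hf.comp measurable_fst, fun _ _ _ => rfl⟩
  simpa using h

lemma ae_tsum_ne_top [IsProbabilityMeasure μ] (hX : IsHomogeneousPPP μ X lam)
    (hlam : 0 ≤ lam) {f : Plane → ℝ≥0∞} (hf : Measurable f) (hf' : ∫⁻ x, f x ≠ ⊤) :
    ∀ᵐ ω ∂μ, ∑' n, f (X n ω) ≠ ⊤ := by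
  have hm : Measurable fun ω => ∑' n, f (X n ω) :=
    Measurable.tsum fun n => hf.comp (hX.measurable n)
  filter_upwards [ae_lt_top hm (by
    rw [hX.lintegral_tsum_points hlam hf]
    exact ENNReal.mul_ne_top ENNReal.ofReal_ne_top hf')] with ω hω
  exact hω.ne

/-- The nearest point is a function of the positions, of which the gains are independent; so the
product kernel disintegrates the joint law, and disintegrations are almost everywhere unique. -/
lemma ae_condDistrib_config [IsProbabilityMeasure μ] (hX : IsHomogeneousPPP μ X lam)
    {g : ℕ → Ω → ℝ} (hg : IsRayleighFading μ X g) :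
    ∀ᵐ p ∂(μ.map fun ω => nearestPoint fun n => X n ω),
      condDistrib (fun ω => ((fun n => X n ω, fun n => g n ω) : Config))
        (fun ω => nearestPoint (fun n => X n ω)) μ p =
      (condDistrib (fun ω n => X n ω) (fun ω => nearestPoint (fun n => X n ω)) μ p).prod
        (μ.map fun ω n => g n ω) := by
  have hn := hX.measurable_nearestPoint
  have hXm := hX.measurable_seq
  have hgm : Measurable fun ω n => g n ω := measurable_pi_lambda _ hg.measurable
  have hγ := Measure.isProbabilityMeasure_map (μ := μ) hgm.aemeasurable
  let κ : Kernel Plane (ℕ → Plane) :=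
    condDistrib (fun ω n => X n ω) (fun ω => nearestPoint (fun n => X n ω)) μ
  have h := condDistrib_ae_eq_of_measure_eq_compProd (μ := μ)
    (Y := fun ω => ((fun n => X n ω, fun n => g n ω) : Config))
    (fun ω => nearestPoint (fun n => X n ω)) (hXm.prodMk hgm).aemeasurable
    (κ := κ ×ₖ Kernel.const _ (μ.map fun ω n => g n ω)) ?_
  · filter_upwards [h] with p hp
    rw [hp, Kernel.prod_apply, Kernel.const_apply]
  · refine Measure.ext_of_lintegral _ fun F hF => ?_
    have hind : IndepFun (fun ω => ((nearestPoint fun n => X n ω), fun n => X n ω))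
        (fun ω n => g n ω) μ :=
      hg.indep_positions.comp (_root_.measurable_nearestPoint.prodMk measurable_id) measurable_id
    have hmap := (indepFun_iff_map_prod_eq_prod_map_map (hn.prodMk hXm).aemeasurable
      hgm.aemeasurable).1 hind
    have hmap' : μ.map (fun ω => ((nearestPoint fun n => X n ω), fun n => X n ω)) =
        μ.map (fun ω => nearestPoint fun n => X n ω) ⊗ₘ κ :=
      (compProd_map_condDistrib hXm.aemeasurable).symm
    have hassoc : Measurable fun q : (Plane × (ℕ → Plane)) × (ℕ → ℝ) => (q.1.1, (q.1.2, q.2)) := by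
      fun_prop
    have hF1 := hF.comp hassoc
    simp only [Function.comp_def] at hF1
    have hF2 : Measurable fun q : Plane × (ℕ → Plane) =>
        ∫⁻ c, F (q.1, (q.2, c)) ∂(μ.map fun ω n => g n ω) := hF1.lintegral_prod_right'
    rw [lintegral_map hF (hn.prodMk (hXm.prodMk hgm)), Measure.lintegral_compProd hF]
    have e1 : ∀ p, ∫⁻ c, F (p, c) ∂((κ ×ₖ Kernel.const _ (μ.map fun ω n => g n ω)) p) =
        ∫⁻ φ, ∫⁻ c, F (p, (φ, c)) ∂(μ.map fun ω n => g n ω) ∂(κ p) := by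
      intro p
      have hFp : Measurable fun c : (ℕ → Plane) × (ℕ → ℝ) => F (p, c) :=
        hF.comp measurable_prodMk_left
      rw [Kernel.lintegral_prod _ _ _ hFp]
      simp only [Kernel.const_apply]
    simp_rw [e1]
    rw [← Measure.lintegral_compProd hF2, ← hmap', ← lintegral_prod _ hF1.aemeasurable, ← hmap,
      lintegral_map hF1 ((hn.prodMk hXm).prodMk hgm)]

/-- The conditional kernel and the unconditional law, both read on the points farther than `p`, give
the same joint law with the nearest point, by `measure_nearestPoint_testValues_mem`. Uniqueness of
the disintegration makes them agree for almost every `p`. -/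
lemma ae_condDistrib_testValues [IsProbabilityMeasure μ] (hX : IsHomogeneousPPP μ X lam)
    (hlam : 0 < lam) :
    ∀ᵐ p ∂(μ.map fun ω => nearestPoint fun n => X n ω),
      (condDistrib (fun ω n => X n ω) (fun ω => nearestPoint (fun n => X n ω)) μ p).map
        (fun φ => testValues ((pointMeasure φ).restrict {y | (p, y) ∈ fartherPairs})) =
      μ.map fun ω => testValues ((pointMeasure fun n => X n ω).restrict
        {y | (p, y) ∈ fartherPairs}) := by
  have hn := hX.measurable_nearestPoint
  have hXm := hX.measurable_seq
  have := Measure.isProbabilityMeasure_map (μ := μ) hXm.aemeasurable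
  let κ : Kernel Plane (ℕ → Plane) :=
    condDistrib (fun ω n => X n ω) (fun ω => nearestPoint (fun n => X n ω)) μ
  let K : Plane × (ℕ → Plane) → TestIndex → ℝ≥0∞ := fun q =>
    testValues ((pointMeasure q.2).restrict {y | (q.1, y) ∈ fartherPairs})
  have hK : Measurable K := measurable_testValues.comp
    (measurable_restrict_pointMeasure measurableSet_fartherPairs)
  have hmk : ∀ (ρ : Kernel Plane (ℕ → Plane)) [IsMarkovKernel ρ] (p : Plane),
      ((Kernel.id ×ₖ ρ).map K) p = (ρ p).map fun φ => K (p, φ) := by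
    intro ρ _ p
    have hKp : Measurable fun φ => K (p, φ) := hK.comp measurable_prodMk_left
    refine Measure.ext_of_lintegral _ fun F hF => ?_
    have hFK := hF.comp hK
    simp only [Function.comp_def] at hFK
    rw [Kernel.lintegral_map _ hK _ hF, Kernel.lintegral_id_prod hFK, lintegral_map hF hKp]
  have h := Kernel.ae_eq_of_compProd_eq
    (μ := μ.map fun ω => nearestPoint fun n => X n ω) (κ := (Kernel.id ×ₖ κ).map K)
    (η := (Kernel.id ×ₖ Kernel.const _ (μ.map fun ω n => X n ω)).map K) ?_
  · filter_upwards [h] with p hp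
    have hKp : Measurable fun φ => K (p, φ) := hK.comp measurable_prodMk_left
    rw [hmk, hmk, Kernel.const_apply, Measure.map_map hKp hXm] at hp
    exact hp
  · ext U hU
    have hUm : Measurable (U.indicator (1 : Plane × (TestIndex → ℝ≥0∞) → ℝ≥0∞)) :=
      measurable_one.indicator hU
    rw [← lintegral_indicator_one hU, ← lintegral_indicator_one hU,
      Measure.lintegral_compProd hUm, Measure.lintegral_compProd hUm]
    have e : ∀ (ρ : Kernel Plane (ℕ → Plane)) [IsMarkovKernel ρ] (p : Plane),
        ∫⁻ t, U.indicator 1 (p, t) ∂((Kernel.id ×ₖ ρ).map K p) =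
          ∫⁻ φ, U.indicator 1 (p, K (p, φ)) ∂(ρ p) := by
      intro ρ _ p
      have h1 : Measurable fun t => U.indicator (1 : Plane × (TestIndex → ℝ≥0∞) → ℝ≥0∞) (p, t) :=
        hUm.comp measurable_prodMk_left
      have h2 : Measurable fun φ => K (p, φ) := hK.comp measurable_prodMk_left
      rw [hmk, lintegral_map h1 h2]
    simp_rw [e]
    have hUK : Measurable fun q : Plane × (ℕ → Plane) =>
        U.indicator (1 : Plane × (TestIndex → ℝ≥0∞) → ℝ≥0∞) (q.1, K q) :=
      hUm.comp (measurable_fst.prodMk hK)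
    rw [← Measure.lintegral_compProd hUK, compProd_map_condDistrib hXm.aemeasurable,
      lintegral_map hUK (hn.prodMk hXm)]
    have e2 : ∀ p, ∫⁻ φ, U.indicator 1 (p, K (p, φ))
        ∂(Kernel.const Plane (μ.map fun ω n => X n ω) p) =
        μ {ω | (p, K (p, fun n => X n ω)) ∈ U} := by
      intro p
      have h1 : Measurable fun φ =>
          U.indicator (1 : Plane × (TestIndex → ℝ≥0∞) → ℝ≥0∞) (p, K (p, φ)) :=
        hUK.comp measurable_prodMk_left
      have h2 : MeasurableSet {ω | (p, K (p, fun n => X n ω)) ∈ U} :=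
        ((measurable_const.prodMk (hK.comp measurable_prodMk_left)).comp hXm) hU
      rw [Kernel.const_apply, lintegral_map h1 hXm, ← lintegral_indicator_one h2]
      rfl
    simp_rw [e2]
    rw [← hX.measure_nearestPoint_testValues_mem hlam hU]
    have h3 : MeasurableSet {ω | ((nearestPoint fun n => X n ω), K ((nearestPoint fun n => X n ω),
        fun n => X n ω)) ∈ U} :=
      (hn.prodMk (hK.comp (hn.prodMk hXm))) hU
    exact lintegral_indicator_one h3

/-- Almost sure properties of the pair (nearest point, positions) pass to almost every conditional
law. -/
lemma ae_condDistrib_support [IsProbabilityMeasure μ] (hX : IsHomogeneousPPP μ X lam)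
    (hlam : 0 ≤ lam) :
    ∀ᵐ p ∂(μ.map fun ω => nearestPoint fun n => X n ω),
      ∀ᵐ φ ∂(condDistrib (fun ω n => X n ω) (fun ω => nearestPoint (fun n => X n ω)) μ p),
        nearestPoint φ = p ∧ LocallyBounded (pointMeasure φ) ∧
          ∀ n m, ‖φ m‖ = ‖φ n‖ → φ m = φ n := by
  have hn := hX.measurable_nearestPoint
  have hXm := hX.measurable_seq
  refine Measure.ae_ae_of_ae_compProd (p := fun q : Plane × (ℕ → Plane) => nearestPoint q.2 = q.1 ∧
    LocallyBounded (pointMeasure q.2) ∧ ∀ n m, ‖q.2 m‖ = ‖q.2 n‖ → q.2 m = q.2 n) ?_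
  rw [compProd_map_condDistrib hXm.aemeasurable]
  have hc : ∀ n : ℕ, Measurable fun q : Plane × (ℕ → Plane) => q.2 n := by fun_prop
  have hset : MeasurableSet {q : Plane × (ℕ → Plane) | nearestPoint q.2 = q.1 ∧
      LocallyBounded (pointMeasure q.2) ∧ ∀ n m, ‖q.2 m‖ = ‖q.2 n‖ → q.2 m = q.2 n} := by
    refine (measurableSet_eq_fun (_root_.measurable_nearestPoint.comp measurable_snd)
      measurable_fst).inter (MeasurableSet.inter ?_ ?_)
    · have : {q : Plane × (ℕ → Plane) | LocallyBounded (pointMeasure q.2)} =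
          ⋂ k : ℕ, {q | pointMeasure q.2 (Metric.ball 0 k) < ⊤} := by
        ext; simp [LocallyBounded]
      change MeasurableSet {q : Plane × (ℕ → Plane) | LocallyBounded (pointMeasure q.2)}
      rw [this]
      refine MeasurableSet.iInter fun k => measurableSet_lt ?_ measurable_const
      exact (Measure.measurable_coe Metric.isOpen_ball.measurableSet).comp
        (_root_.measurable_pointMeasure.comp measurable_snd)
    · have : {q : Plane × (ℕ → Plane) | ∀ n m, ‖q.2 m‖ = ‖q.2 n‖ → q.2 m = q.2 n} =
          ⋂ n, ⋂ m, ({q | ‖q.2 m‖ = ‖q.2 n‖}ᶜ ∪ {q | q.2 m = q.2 n}) := by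
        ext; simp [imp_iff_not_or]
      change MeasurableSet {q : Plane × (ℕ → Plane) | ∀ n m, ‖q.2 m‖ = ‖q.2 n‖ → q.2 m = q.2 n}
      rw [this]
      exact MeasurableSet.iInter fun n => MeasurableSet.iInter fun m =>
        (measurableSet_eq_fun (hc m).norm (hc n).norm).compl.union
          (measurableSet_eq_fun (hc m) (hc n))
  rw [ae_map_iff (hn.prodMk hXm).aemeasurable hset]
  filter_upwards [hX.ae_locallyBounded hlam, hX.ae_eq_of_norm_eq hlam] with ω h1 h2
  exact ⟨rfl, h1, h2⟩

end IsHomogeneousPPP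

lemma measurable_sumOff (p : Plane) {f : Plane → ℝ≥0∞} (hf : Measurable f) :
    Measurable (sumOff p f) := by
  classical
  refine Measurable.tsum fun n => Measurable.ite ?_ measurable_const
    (hf.comp (measurable_pi_apply n))
  exact (measurable_pi_apply (X := fun _ => Plane) n) (measurableSet_singleton p)

lemma sumOff_eq_lintegral (p : Plane) {f : Plane → ℝ≥0∞} (hf : Measurable f) (φ : ℕ → Plane) :
    sumOff p f φ = ∫⁻ x in {x | x ≠ p}, f x ∂(pointMeasure φ) := by
  have hp : MeasurableSet {x : Plane | x ≠ p} := (measurableSet_singleton p).compl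
  rw [← lintegral_indicator hp, lintegral_pointMeasure _ (hf.indicator hp), sumOff]
  refine tsum_congr fun n => ?_
  by_cases h : φ n = p <;> simp [h]

/-- Without ties in norm, a point other than the nearest one is strictly farther from the origin. -/
lemma sumOff_eq_lintegral_fartherPairs {p : Plane} {f : Plane → ℝ≥0∞} (hf : Measurable f)
    {φ : ℕ → Plane} (h1 : nearestPoint φ = p) (h2 : LocallyBounded (pointMeasure φ))
    (h3 : ∀ n m, ‖φ m‖ = ‖φ n‖ → φ m = φ n) :
    sumOff p f φ = ∫⁻ x in {x | (p, x) ∈ fartherPairs}, f x ∂(pointMeasure φ) := by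
  have hD : MeasurableSet {x : Plane | (p, x) ∈ fartherPairs} :=
    measurableSet_slice measurableSet_fartherPairs p
  obtain ⟨n₀, hn₀, hmin⟩ := exists_nearestPoint_eq h2
  rw [h1] at hn₀
  rw [← lintegral_indicator hD, lintegral_pointMeasure _ (hf.indicator hD), sumOff]
  refine tsum_congr fun n => ?_
  by_cases h : φ n = p
  · simp [h, fartherPairs]
  · have : ‖p‖ < ‖φ n‖ := by
      refine lt_of_le_of_ne (hn₀ ▸ hmin n) fun h' => h ?_
      rw [hn₀] at h' ⊢
      exact h3 n₀ n h'.symm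
    simp [h, fartherPairs, this]

namespace IsHomogeneousPPP

variable {Ω : Type*} [MeasurableSpace Ω] {μ : Measure Ω} {X : ℕ → Ω → Plane} {lam : ℝ}

/-- Translates of a homogeneous Poisson process are homogeneous Poisson processes. -/
lemma sub_const (hX : IsHomogeneousPPP μ X lam) (x : Plane) :
    IsHomogeneousPPP μ (fun n ω => X n ω - x) lam := by
  have hm : Measurable fun y : Plane => y - x := measurable_id.sub_const x
  have hc : ∀ B, pointCount (fun n ω => X n ω - x) B = pointCount X ((fun y => y - x) ⁻¹' B) :=
    fun B => rfl
  have hv : ∀ B : Set Plane, volume ((fun y => y - x) ⁻¹' B) = volume B := fun B => by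
    simp_rw [sub_eq_add_neg]
    exact measure_preimage_add_right volume (-x) B
  refine ⟨fun n => hm.comp (hX.measurable n), fun B hB hB' k => ?_, fun m B hB hd => ?_⟩
  · rw [hc, hX.poisson _ (hm hB) (by rwa [hv]), Measure.real, hv]
    rfl
  · simp_rw [hc]
    exact hX.indep m _ (fun i => hm (hB i)) fun i j hij => (hd hij).preimage _

/-- The choices `expPos`, `expNeg` and the indicator of `⊤` for `Ψ` give the three clauses on sums.
The premise ranges over all translates by `x` because the Palm case averages over the position `x`
of a point of `B`; translation invariance makes `v` independent of `x`. -/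
lemma isPoissonBeyond_of_lintegral [IsProbabilityMeasure μ] (hX : IsHomogeneousPPP μ X lam)
    (hlam : 0 ≤ lam) {ν : Measure (ℕ → Plane)} (hν : IsProbabilityMeasure ν) {p : Plane}
    (hp : ∀ᵐ φ ∂ν, nearestPoint φ = p ∧ p ∈ Set.range φ)
    (h : ∀ (f : Plane → ℝ≥0∞) (Ψ : ℝ≥0∞ → ℝ≥0∞) (v : ℝ≥0∞), Measurable f → Measurable Ψ →
      (∀ x, ∫⁻ ω, Ψ (∑' n, {y : Plane | ‖p‖ < ‖y‖}.indicator f (X n ω - x)) ∂μ = v) →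
      ∫⁻ φ, Ψ (sumOff p f φ) ∂ν = v) :
    IsPoissonBeyond ν lam p := by
  have hD : MeasurableSet {y : Plane | ‖p‖ < ‖y‖} := measurableSet_lt measurable_const measurable_norm
  refine ⟨hν, hp, fun f hf => ?_, fun f hf => ?_, fun f hf hf' => ?_⟩
  · refine h f _ _ hf continuous_expPos.measurable fun x => ?_
    rw [(hX.sub_const x).lintegral_expPos hlam (hf.indicator hD), ← lintegral_indicator hD]
    congr 2
    refine lintegral_congr fun y => ?_
    by_cases hy : y ∈ {y : Plane | ‖p‖ < ‖y‖} <;> simp [hy, expPos_zero]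
  · refine h f _ _ hf continuous_expNeg.measurable fun x => ?_
    rw [(hX.sub_const x).lintegral_expNeg hlam (hf.indicator hD), ← lintegral_indicator hD]
    congr 2
    refine lintegral_congr fun y => ?_
    by_cases hy : y ∈ {y : Plane | ‖p‖ < ‖y‖} <;> simp [hy, expNeg_zero]
  · have hΨ : Measurable (({⊤} : Set ℝ≥0∞).indicator (1 : ℝ≥0∞ → ℝ≥0∞)) :=
      measurable_one.indicator (measurableSet_singleton _)
    have h0 := h f _ 0 hf hΨ fun x => by
      have hae := (hX.sub_const x).ae_tsum_ne_top hlam (hf.indicator hD)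
        (by rwa [lintegral_indicator hD])
      refine (lintegral_congr_ae (g := 0) ?_).trans lintegral_zero
      filter_upwards [hae] with ω hω
      simp [hω]
    have hm : Measurable fun φ => ({⊤} : Set ℝ≥0∞).indicator (1 : ℝ≥0∞ → ℝ≥0∞) (sumOff p f φ) :=
      hΨ.comp (measurable_sumOff p hf)
    rw [lintegral_eq_zero_iff hm] at h0
    filter_upwards [h0] with φ hφ h'
    simp [h'] at hφ

/-- Under almost every conditional law the sum off `p` is a measurable function of the test values
beyond `p`, whose law is the unconditional one; only the translate `x = 0` is needed. -/
lemma ae_isPoissonBeyond_condDistrib [IsProbabilityMeasure μ] (hX : IsHomogeneousPPP μ X lam)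
    (hlam : 0 < lam) :
    ∀ᵐ p ∂(μ.map fun ω => nearestPoint fun n => X n ω),
      IsPoissonBeyond (condDistrib (fun ω n => X n ω) (fun ω => nearestPoint (fun n => X n ω)) μ p)
        lam p := by
  filter_upwards [hX.ae_condDistrib_testValues hlam, hX.ae_condDistrib_support hlam.le] with p h1 h2
  refine hX.isPoissonBeyond_of_lintegral hlam.le inferInstance ?_ fun f Ψ v hf hΨ h => ?_
  · filter_upwards [h2] with φ hφ
    obtain ⟨n, hn, -⟩ := exists_nearestPoint_eq hφ.2.1
    exact ⟨hφ.1, n, by rw [← hn, hφ.1]⟩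
  · have hV : MeasurableSet {y : Plane | (p, y) ∈ fartherPairs} :=
      measurableSet_slice measurableSet_fartherPairs p
    obtain ⟨G, hG, hG'⟩ := testMeasurable_lintegral (Y := Unit) (f := fun _ x => f x)
      (hf.comp measurable_snd)
    have hGm : Measurable fun t => Ψ (G ((), t)) := hΨ.comp (hG.comp measurable_prodMk_left)
    have hτ : Measurable fun φ : ℕ → Plane => testValues ((pointMeasure φ).restrict
        {y | (p, y) ∈ fartherPairs}) :=
      measurable_testValues.comp ((measurable_restrict_measure hV).comp
        _root_.measurable_pointMeasure)
    have e1 : ∫⁻ φ, Ψ (sumOff p f φ) ∂(condDistrib (fun ω n => X n ω)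
        (fun ω => nearestPoint (fun n => X n ω)) μ p) =
        ∫⁻ φ, Ψ (G ((), testValues ((pointMeasure φ).restrict {y | (p, y) ∈ fartherPairs})))
          ∂(condDistrib (fun ω n => X n ω) (fun ω => nearestPoint (fun n => X n ω)) μ p) := by
      refine lintegral_congr_ae ?_
      filter_upwards [h2] with φ hφ
      rw [sumOff_eq_lintegral_fartherPairs hf hφ.1 hφ.2.1 hφ.2.2, ← hG' () _ (hφ.2.1.restrict _)]
    have hτX : Measurable fun ω => testValues ((pointMeasure fun n => X n ω).restrict
        {y | (p, y) ∈ fartherPairs}) := hτ.comp hX.measurable_seq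
    rw [e1, ← lintegral_map hGm hτ, h1, lintegral_map hGm hτX, ← h 0]
    refine lintegral_congr_ae ?_
    filter_upwards [hX.ae_locallyBounded hlam.le] with ω hω
    simp only [sub_zero]
    rw [← hG' () _ (hω.restrict _)]
    change Ψ (∫⁻ x, f x ∂((pointMeasure fun n => X n ω).restrict {y | (p, y) ∈ fartherPairs})) = _
    rw [← lintegral_indicator hV, lintegral_pointMeasure _ (hf.indicator hV)]
    rfl

/-! ### The Palm distribution. -/

/-- The law of the positions of the points under the Palm distribution. -/
noncomputable def palmPositions (μ : Measure Ω) (X : ℕ → Ω → Plane) (lam : ℝ) (B : Set Plane) :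
    Measure (ℕ → Plane) :=
  (ENNReal.ofReal lam * volume B)⁻¹ •
    Measure.sum fun n => (μ.restrict {ω | X n ω ∈ B}).map fun ω m => X m ω - X n ω

/-- For each `n`, the restriction to `X n ω ∈ B` and the shift by `X n ω` involve the positions
only, so the independent gains split off. -/
lemma palmLaw_eq_prod [IsProbabilityMeasure μ] (hX : IsHomogeneousPPP μ X lam)
    {g : ℕ → Ω → ℝ} (hg : IsRayleighFading μ X g) {B : Set Plane} (hB : MeasurableSet B) :
    palmLaw μ X g lam B = (palmPositions μ X lam B).prod (μ.map fun ω n => g n ω) := by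
  have hXm := hX.measurable_seq
  have hgm : Measurable fun ω n => g n ω := measurable_pi_lambda _ hg.measurable
  have hγ := Measure.isProbabilityMeasure_map (μ := μ) hgm.aemeasurable
  have hmap := (indepFun_iff_map_prod_eq_prod_map_map hXm.aemeasurable
    hgm.aemeasurable).1 hg.indep_positions
  rw [palmLaw, palmPositions, Measure.prod_smul_left, Measure.prod_sum_left]
  congr 2
  funext n
  have hsh : Measurable fun φ : ℕ → Plane => fun m => φ m - φ n := by fun_prop
  have hshX : Measurable fun ω m => X m ω - X n ω := hsh.comp hXm
  have hBn : MeasurableSet {ω | X n ω ∈ B} := hX.measurable n hB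
  have hBφ : MeasurableSet {φ : ℕ → Plane | φ n ∈ B} := measurable_pi_apply n hB
  refine Measure.ext_of_lintegral _ fun F hF => ?_
  have hF1 : Measurable fun φ : ℕ → Plane => ∫⁻ c, F (φ, c) ∂(μ.map fun ω n => g n ω) :=
    hF.lintegral_prod_right'
  rw [lintegral_map hF (hshX.prodMk hgm), lintegral_prod _ hF.aemeasurable,
    lintegral_map hF1 hshX, ← lintegral_indicator hBn, ← lintegral_indicator hBn]
  have hH : Measurable fun q : (ℕ → Plane) × (ℕ → ℝ) =>
      {φ : ℕ → Plane | φ n ∈ B}.indicator (fun φ => F (fun m => φ m - φ n, q.2)) q.1 := by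
    have h1 : Measurable fun q : (ℕ → Plane) × (ℕ → ℝ) => F (fun m => q.1 m - q.1 n, q.2) :=
      hF.comp ((hsh.comp measurable_fst).prodMk measurable_snd)
    exact h1.indicator (measurable_fst hBφ)
  have e1 := lintegral_map (μ := μ) hH (hXm.prodMk hgm)
  rw [hmap, lintegral_prod _ hH.aemeasurable, lintegral_map hH.lintegral_prod_right' hXm] at e1
  refine e1.symm.trans (lintegral_congr fun ω => ?_)
  by_cases hω : X n ω ∈ B <;> simp [hω]

/-- Slivnyak's theorem, from Mecke's formula: the process seen from one of its points, with that
location removed, is averaged like the whole process seen from a fixed `x`. That average is `v` for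
every `x`, so integrating over `B` yields `lam |B| v`, which the normalisation reduces to `v`. -/
lemma isPoissonBeyond_palmPositions [IsProbabilityMeasure μ] (hX : IsHomogeneousPPP μ X lam)
    (hlam : 0 < lam) {B : Set Plane} (hB : MeasurableSet B) (hB0 : 0 < volume B)
    (hB' : volume B < ⊤) : IsPoissonBeyond (palmPositions μ X lam B) lam 0 := by
  have hXm := hX.measurable_seq
  have hsh : ∀ n, Measurable fun ω m => X m ω - X n ω := fun n =>
    measurable_pi_lambda _ fun m => (hX.measurable m).sub (hX.measurable n)
  have hBn : ∀ n, MeasurableSet {ω | X n ω ∈ B} := fun n => hX.measurable n hB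
  have hc0 : ENNReal.ofReal lam * volume B ≠ 0 :=
    mul_ne_zero (by simpa using hlam) hB0.ne'
  have hct : ENNReal.ofReal lam * volume B ≠ ⊤ := ENNReal.mul_ne_top ENNReal.ofReal_ne_top hB'.ne
  have hint : ∀ {F : (ℕ → Plane) → ℝ≥0∞}, Measurable F → ∫⁻ φ, F φ ∂(palmPositions μ X lam B) =
      (ENNReal.ofReal lam * volume B)⁻¹ *
        ∫⁻ ω, ∑' n, B.indicator 1 (X n ω) * F (fun m => X m ω - X n ω) ∂μ := by
    intro F hF
    rw [palmPositions, lintegral_smul_measure, lintegral_sum_measure, smul_eq_mul,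
      lintegral_tsum]
    · congr 1
      refine tsum_congr fun n => ?_
      rw [lintegral_map hF (hsh n), ← lintegral_indicator (hBn n)]
      refine lintegral_congr fun ω => ?_
      by_cases h : X n ω ∈ B <;> simp [h]
    · intro n
      exact (((measurable_one.indicator hB).comp (hX.measurable n)).mul
        (hF.comp (hsh n))).aemeasurable
  refine hX.isPoissonBeyond_of_lintegral hlam.le ⟨?_⟩ ?_ fun f Ψ v hf hΨ h => ?_
  · have h1 := hint measurable_one
    simp only [Pi.one_apply, lintegral_one, mul_one, ← pointMeasure_apply _ hB] at h1
    rw [h1, hX.lintegral_pointMeasure_apply hlam.le hB hB', ENNReal.inv_mul_cancel hc0 hct]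
  · refine Measure.ae_smul_measure ?_ _
    rw [Measure.ae_sum_iff]
    intro n
    have hset : MeasurableSet {φ : ℕ → Plane | nearestPoint φ = 0 ∧ (0 : Plane) ∈ Set.range φ} := by
      refine (measurableSet_eq_fun _root_.measurable_nearestPoint measurable_const).inter ?_
      have : {φ : ℕ → Plane | (0 : Plane) ∈ Set.range φ} = ⋃ n, {φ | φ n = 0} := by ext; simp
      change MeasurableSet {φ : ℕ → Plane | (0 : Plane) ∈ Set.range φ}
      rw [this]
      exact MeasurableSet.iUnion fun n => measurable_pi_apply n (measurableSet_singleton 0)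
    rw [ae_map_iff (hsh n).aemeasurable hset]
    refine ae_of_all _ fun ω => ?_
    -- After the shift the `n`-th point sits at the origin; its norm `0` is minimal and forces the
    -- nearest point to be `0`.
    have hex : ∃ k, ∀ m, ‖X k ω - X n ω‖ ≤ ‖X m ω - X n ω‖ := ⟨n, fun m => by simp⟩
    refine ⟨?_, n, by simp⟩
    classical
    rw [nearestPoint, dif_pos hex]
    simpa using Nat.find_spec hex n
  · have hD : MeasurableSet {y : Plane | ‖(0 : Plane)‖ < ‖y‖} :=
      measurableSet_lt measurable_const measurable_norm
    have hfs : Measurable (Function.uncurry fun (x y : Plane) => f (y - x)) :=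
      hf.comp (measurable_snd.sub measurable_fst)
    have hΦ : TestMeasurable fun (x : Plane) M => B.indicator 1 x * Ψ (∫⁻ y, f (y - x) ∂M) :=
      (testMeasurable_lintegral hfs).comp (G := fun q => B.indicator 1 q.1 * Ψ q.2)
        (((measurable_one.indicator hB).comp measurable_fst).mul (hΨ.comp measurable_snd))
    have hM := hX.lintegral_tsum_restrict_ne hlam.le hΦ
    have e1 : ∀ ω n, sumOff 0 f (fun m => X m ω - X n ω) =
        ∫⁻ y in {y | y ≠ X n ω}, f (y - X n ω) ∂(pointMeasure fun n => X n ω) := by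
      intro ω n
      rw [← sumOff_eq_lintegral (f := fun y => f (y - X n ω)) _
        (hf.comp (measurable_id.sub_const _)), sumOff, sumOff]
      simp only [sub_eq_zero]
    have e2 : ∀ x, ∫⁻ ω, B.indicator 1 x *
        Ψ (∫⁻ y, f (y - x) ∂(pointMeasure fun n => X n ω)) ∂μ = B.indicator (fun _ => v) x := by
      intro x
      by_cases hx : x ∈ B
      · rw [Set.indicator_of_mem hx, Set.indicator_of_mem hx, ← h x]
        simp only [Pi.one_apply, one_mul]
        refine lintegral_congr_ae ?_
        filter_upwards [hX.ae_pointMeasure_eq_zero hlam.le (measurableSet_singleton x)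
          (measure_singleton x)] with ω hω
        have hfx : Measurable fun y => f (y - x) := hf.comp (measurable_id.sub_const x)
        rw [lintegral_pointMeasure _ hfx]
        rw [pointMeasure_apply_eq_zero_iff _ (measurableSet_singleton x)] at hω
        congr 1
        refine tsum_congr fun n => ?_
        rw [Set.indicator_of_mem]
        simpa [sub_eq_zero] using hω n
      · simp [hx]
    refine (hint (hΨ.comp (measurable_sumOff 0 hf))).trans ?_
    simp only [Function.comp_apply, e1]
    rw [hM]
    simp_rw [e2]
    rw [lintegral_indicator_const hB, mul_comm v, ← mul_assoc, ← mul_assoc, mul_assoc _ _ (volume B),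
      ENNReal.inv_mul_cancel hc0 hct, one_mul]

end IsHomogeneousPPP

/-! ### Series with i.i.d. exponential coefficients. -/

instance : IsProbabilityMeasure (expMeasure 1) := isProbabilityMeasure_expMeasure one_pos

/-- The law of a sequence of i.i.d. exponential random variables of mean `1`. -/
noncomputable def expSeq : Measure (ℕ → ℝ) := Measure.infinitePi fun _ => expMeasure 1

instance : IsProbabilityMeasure expSeq :=
  inferInstanceAs (IsProbabilityMeasure (Measure.infinitePi fun _ : ℕ => expMeasure 1))

lemma IsRayleighFading.map_eq_expSeq {Ω : Type*} [MeasurableSpace Ω] {μ : Measure Ω}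
    {X : ℕ → Ω → Plane} {g : ℕ → Ω → ℝ} (hg : IsRayleighFading μ X g) :
    (μ.map fun ω n => g n ω) = expSeq := by
  rw [iIndepFun.map_fun_eq_infinitePi_map hg.measurable hg.iIndep, expSeq]
  simp only [hg.law]

lemma measurePreserving_eval_expSeq (n : ℕ) :
    MeasurePreserving (fun x : ℕ → ℝ => x n) expSeq (expMeasure 1) :=
  measurePreserving_eval_infinitePi (fun _ => expMeasure 1) n

lemma iIndepFun_eval_expSeq : iIndepFun (fun (n : ℕ) (x : ℕ → ℝ) => x n) expSeq := by
  rw [iIndepFun_iff_map_fun_eq_infinitePi_map (fun n => measurable_pi_apply n)]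
  simp only [(measurePreserving_eval_expSeq _).map_eq]
  exact Measure.map_id

lemma lintegral_expMeasure {f : ℝ → ℝ≥0∞} (hf : Measurable f) :
    ∫⁻ x, f x ∂(expMeasure 1) = ∫⁻ x in Set.Ioi 0, ENNReal.ofReal (Real.exp (-x)) * f x := by
  have h : expMeasure 1 = volume.withDensity (exponentialPDF 1) := rfl
  have hm : Measurable (exponentialPDF 1) := (measurable_exponentialPDFReal 1).ennreal_ofReal
  rw [h, lintegral_withDensity_eq_lintegral_mul _ hm hf, setLIntegral_congr Ioi_ae_eq_Ici,
    ← lintegral_indicator measurableSet_Ici]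
  refine lintegral_congr fun x => ?_
  by_cases hx : 0 ≤ x
  · rw [Set.indicator_of_mem (Set.mem_Ici.2 hx), Pi.mul_apply, exponentialPDF_of_nonneg hx,
      one_mul, one_mul]
  · rw [Set.indicator_of_notMem (mt Set.mem_Ici.1 hx), Pi.mul_apply,
      exponentialPDF_of_neg (not_le.1 hx), zero_mul]

lemma ae_expMeasure_nonneg : ∀ᵐ x ∂(expMeasure 1), 0 ≤ x := by
  have h := lintegral_expMeasure (f := (Set.Iio (0 : ℝ)).indicator 1)
    (measurable_one.indicator measurableSet_Iio)
  rw [lintegral_indicator_one measurableSet_Iio, setLIntegral_congr_fun measurableSet_Ioi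
    (g := fun _ => 0) fun x hx => ?_, lintegral_zero] at h
  · rw [ae_iff]
    simp only [not_le]
    exact h
  · have : x ∉ Set.Iio (0 : ℝ) := fun h => lt_asymm (Set.mem_Iio.1 h) hx
    simp only [Set.indicator_of_notMem this, mul_zero]

lemma ae_expSeq_nonneg : ∀ᵐ x ∂expSeq, ∀ n, 0 ≤ x n := by
  refine ae_all_iff.2 fun n => ?_
  have h := ae_expMeasure_nonneg
  rw [← (measurePreserving_eval_expSeq n).map_eq] at h
  exact ae_of_ae_map (measurable_pi_apply n).aemeasurable h

lemma lintegral_exp_neg_mul_expMeasure {t : ℝ} (ht : -1 < t) :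
    ∫⁻ x, ENNReal.ofReal (Real.exp (-(t * x))) ∂(expMeasure 1) = ENNReal.ofReal (1 + t)⁻¹ := by
  rw [lintegral_expMeasure (by fun_prop)]
  have h1 : ∀ x : ℝ, ENNReal.ofReal (Real.exp (-x)) * ENNReal.ofReal (Real.exp (-(t * x))) =
      ENNReal.ofReal (Real.exp (-(1 + t) * x)) := fun x => by
    rw [← ENNReal.ofReal_mul (Real.exp_pos _).le, ← Real.exp_add]
    ring_nf
  simp_rw [h1]
  have ht' : -(1 + t) < 0 := by linarith
  rw [← ofReal_integral_eq_lintegral_ofReal (integrableOn_exp_mul_Ioi ht' 0)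
    (ae_of_all _ fun x => (Real.exp_pos _).le), integral_exp_mul_Ioi ht']
  rw [mul_zero, Real.exp_zero, neg_div_neg_eq, one_div]

/-- Against the density the integrand is `exp (-(1 + t) x) ≥ 1` on a half-line of infinite length.
-/
lemma lintegral_exp_neg_mul_expMeasure_of_le {t : ℝ} (ht : t ≤ -1) :
    ∫⁻ x, ENNReal.ofReal (Real.exp (-(t * x))) ∂(expMeasure 1) = ⊤ := by
  rw [lintegral_expMeasure (by fun_prop), eq_top_iff]
  calc (⊤ : ℝ≥0∞) = ∫⁻ x in Set.Ioi (0 : ℝ), 1 := by simp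
    _ ≤ _ := setLIntegral_mono' measurableSet_Ioi fun x (hx : 0 < x) => by
      rw [← ENNReal.ofReal_mul (Real.exp_pos _).le, ← Real.exp_add, ← ENNReal.ofReal_one]
      refine ENNReal.ofReal_le_ofReal (Real.one_le_exp ?_)
      nlinarith

/-- The expected sum is the sum of the coefficients times the finite mean of one variable. -/
lemma ae_summable_expSeq {a : ℕ → ℝ} (ha : ∀ n, 0 ≤ a n) (hs : Summable a) :
    ∀ᵐ x ∂expSeq, Summable fun n => a n * x n := by
  set c := ∫⁻ x, ENNReal.ofReal x ∂(expMeasure 1) with hc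
  have hc' : c ≠ ⊤ := by
    have h := lintegral_exp_neg_mul_expMeasure (t := -(1/2)) (by norm_num)
    -- The mean is bounded by `x ≤ 2 exp (x / 2)` and the Laplace transform at `-1/2`.
    have h2 : c ≤ 2 * ∫⁻ x, ENNReal.ofReal (Real.exp (-(-(1/2) * x))) ∂(expMeasure 1) := by
      rw [← lintegral_const_mul _ (by fun_prop)]
      refine lintegral_mono fun x => ?_
      rw [← ENNReal.ofReal_ofNat, ← ENNReal.ofReal_mul (by norm_num)]
      refine ENNReal.ofReal_le_ofReal ?_
      have := Real.add_one_le_exp (-(-(1/2) * x))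
      linarith
    refine ne_top_of_le_ne_top ?_ h2
    rw [h]
    exact ENNReal.mul_ne_top (by simp) ENNReal.ofReal_ne_top
  have hm : ∀ n, Measurable fun x : ℕ → ℝ => ENNReal.ofReal (a n * x n) := fun n => by fun_prop
  have h : ∫⁻ x, ∑' n, ENNReal.ofReal (a n * x n) ∂expSeq ≠ ⊤ := by
    rw [lintegral_tsum fun n => (hm n).aemeasurable]
    have h1 : ∀ n, ∫⁻ x, ENNReal.ofReal (a n * x n) ∂expSeq = ENNReal.ofReal (a n) * c := by
      intro n
      simp_rw [ENNReal.ofReal_mul (ha n)]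
      rw [lintegral_const_mul _ (by fun_prop)]
      congr 1
      exact (measurePreserving_eval_expSeq n).lintegral_comp (f := ENNReal.ofReal) (by fun_prop)
    simp_rw [h1]
    rw [ENNReal.tsum_mul_right]
    exact ENNReal.mul_ne_top hs.tsum_ofReal_ne_top hc'
  filter_upwards [ae_lt_top (Measurable.tsum hm) h, ae_expSeq_nonneg] with x hx hx0
  have h2 := ENNReal.summable_toReal hx.ne
  refine h2.congr fun n => ?_
  exact ENNReal.toReal_ofReal (mul_nonneg (ha n) (hx0 n))

lemma lintegral_prod_expSeq (t : ℕ → ℝ) (s : Finset ℕ) :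
    ∫⁻ x, ENNReal.ofReal (Real.exp (-∑ n ∈ s, t n * x n)) ∂expSeq =
      ∏ n ∈ s, ∫⁻ x, ENNReal.ofReal (Real.exp (-(t n * x))) ∂(expMeasure 1) := by
  have h1 : ∀ x : ℕ → ℝ, ENNReal.ofReal (Real.exp (-∑ n ∈ s, t n * x n)) =
      ∏ n ∈ s, ENNReal.ofReal (Real.exp (-(t n * x n))) := fun x => by
    rw [← Finset.sum_neg_distrib, Real.exp_sum,
      ENNReal.ofReal_prod_of_nonneg fun n _ => (Real.exp_pos _).le]
  simp_rw [h1]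
  have hm : ∀ n, Measurable fun y : ℝ => ENNReal.ofReal (Real.exp (-(t n * y))) :=
    fun n => by fun_prop
  have hi : iIndepFun (fun n (x : ℕ → ℝ) => ENNReal.ofReal (Real.exp (-(t n * x n)))) expSeq :=
    iIndepFun_eval_expSeq.comp (fun n y => ENNReal.ofReal (Real.exp (-(t n * y)))) hm
  rw [lintegral_prod_eq_prod_lintegral_of_indepFun s _ hi
    fun n => (hm n).comp (measurable_pi_apply n)]
  refine Finset.prod_congr rfl fun n _ => ?_
  exact (measurePreserving_eval_expSeq n).lintegral_comp (hm n)

/-- Independence gives the product of the factors `1 / (1 + t n)`. It is written as the exponential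
of a sum of logarithms so that it can enter the Laplace functional as a sum over points. -/
lemma lintegral_exp_neg_tsum_expSeq {t : ℕ → ℝ} (ht : ∀ n, 0 ≤ t n) (hs : Summable t) :
    ∫⁻ x, ENNReal.ofReal (Real.exp (-∑' n, t n * x n)) ∂expSeq =
      expNeg (∑' n, ENNReal.ofReal (Real.log (1 + t n))) := by
  have h1 : ∀ N, ∫⁻ x, ENNReal.ofReal (Real.exp (-∑ n ∈ Finset.range N, t n * x n)) ∂expSeq =
      expNeg (∑ n ∈ Finset.range N, ENNReal.ofReal (Real.log (1 + t n))) := by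
    intro N
    rw [lintegral_prod_expSeq, map_sum_of_map_add expNeg_zero expNeg_add]
    refine Finset.prod_congr rfl fun n _ => ?_
    have h0 := ht n
    rw [lintegral_exp_neg_mul_expMeasure (by linarith),
      expNeg_ofReal (Real.log_nonneg (by linarith)), Real.exp_neg, Real.exp_log (by linarith)]
  have h2 : Tendsto (fun N => expNeg (∑ n ∈ Finset.range N, ENNReal.ofReal (Real.log (1 + t n))))
      atTop (𝓝 (expNeg (∑' n, ENNReal.ofReal (Real.log (1 + t n))))) :=
    (continuous_expNeg.tendsto _).comp (ENNReal.tendsto_nat_tsum _)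
  refine tendsto_nhds_unique ?_ h2
  simp_rw [← h1]
  refine tendsto_lintegral_of_dominated_convergence (fun _ => 1) (fun N => by fun_prop)
    (fun N => ?_) (by simp) ?_
  · filter_upwards [ae_expSeq_nonneg] with x hx
    rw [← ENNReal.ofReal_one]
    refine ENNReal.ofReal_le_ofReal (Real.exp_le_one_iff.2 (neg_nonpos.2 ?_))
    exact Finset.sum_nonneg fun n _ => mul_nonneg (ht n) (hx n)
  · filter_upwards [ae_summable_expSeq ht hs] with x hx
    exact (ENNReal.continuous_ofReal.tendsto _).comp
      ((Real.continuous_exp.tendsto _).comp hx.hasSum.tendsto_sum_nat.neg)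

/-- A coefficient `t n ≥ 1` makes its factor infinite, hence the value `⊤` in the sum; the partial
sums increase, so monotone convergence applies without a bound. -/
lemma lintegral_exp_tsum_expSeq {t : ℕ → ℝ} (ht : ∀ n, 0 ≤ t n) (hs : Summable t) :
    ∫⁻ x, ENNReal.ofReal (Real.exp (∑' n, t n * x n)) ∂expSeq =
      expPos (∑' n, if t n < 1 then ENNReal.ofReal (-Real.log (1 - t n)) else ⊤) := by
  have h1 : ∀ N, ∫⁻ x, ENNReal.ofReal (Real.exp (∑ n ∈ Finset.range N, t n * x n)) ∂expSeq =
      expPos (∑ n ∈ Finset.range N,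
        if t n < 1 then ENNReal.ofReal (-Real.log (1 - t n)) else ⊤) := by
    intro N
    have h := lintegral_prod_expSeq (fun n => -t n) (Finset.range N)
    simp only [neg_mul, Finset.sum_neg_distrib, neg_neg] at h
    rw [h, map_sum_of_map_add expPos_zero expPos_add]
    refine Finset.prod_congr rfl fun n _ => ?_
    have h0 := ht n
    split_ifs with hn
    · have h3 := lintegral_exp_neg_mul_expMeasure (t := -t n) (by linarith)
      simp only [neg_mul, neg_neg] at h3
      rw [h3, expPos_ofReal (neg_nonneg.2 (Real.log_nonpos (by linarith) (by linarith))),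
        Real.exp_neg, Real.exp_log (by linarith), sub_eq_add_neg]
    · have h3 := lintegral_exp_neg_mul_expMeasure_of_le (t := -t n) (by linarith)
      simp only [neg_mul, neg_neg] at h3
      rw [h3, expPos_top]
  have h2 : Tendsto (fun N => expPos (∑ n ∈ Finset.range N,
      if t n < 1 then ENNReal.ofReal (-Real.log (1 - t n)) else ⊤))
      atTop (𝓝 (expPos (∑' n, if t n < 1 then ENNReal.ofReal (-Real.log (1 - t n)) else ⊤))) :=
    (continuous_expPos.tendsto _).comp (ENNReal.tendsto_nat_tsum _)
  refine tendsto_nhds_unique ?_ h2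
  simp_rw [← h1]
  refine lintegral_tendsto_of_tendsto_of_monotone
    (fun N => Measurable.aemeasurable (by fun_prop)) ?_ ?_
  · filter_upwards [ae_expSeq_nonneg] with x hx N M hNM
    refine ENNReal.ofReal_le_ofReal (Real.exp_le_exp.2 ?_)
    exact Finset.sum_le_sum_of_subset_of_nonneg (Finset.range_mono hNM)
      fun n _ _ => mul_nonneg (ht n) (hx n)
  · filter_upwards [ae_summable_expSeq ht hs] with x hx
    exact (ENNReal.continuous_ofReal.tendsto _).comp
      ((Real.continuous_exp.tendsto _).comp hx.hasSum.tendsto_sum_nat)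

/-! ### Polar coordinates about the receiver and the equivalent density. -/

/-- No bound on `k` is needed: `Real.arccos` is `π` below `-1` and `0` above `1`, which are the
correct limits for `|θ| < π`. -/
lemma Real.lt_cos_iff_abs_lt_arccos {k θ : ℝ} (hθ : |θ| < Real.pi) :
    k < Real.cos θ ↔ |θ| < Real.arccos k := by
  rcases lt_or_ge k (-1) with h1 | h1
  · rw [Real.arccos_of_le_neg_one h1.le]
    exact ⟨fun _ => hθ, fun _ => h1.trans_le (Real.neg_one_le_cos θ)⟩
  rcases lt_or_ge 1 k with h2 | h2
  · rw [Real.arccos_of_one_le h2.le]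
    exact ⟨fun h => absurd (h.trans_le (Real.cos_le_one θ)) h2.not_gt,
      fun h => absurd h (abs_nonneg θ).not_gt⟩
  · rw [← Real.cos_abs]
    conv_lhs => rw [← Real.cos_arccos h1 h2]
    exact Real.strictAntiOn_cos.lt_iff_gt ⟨Real.arccos_nonneg k, Real.arccos_le_pi k⟩
      ⟨abs_nonneg θ, hθ.le⟩

lemma volume_setOf_lt_cos (k : ℝ) :
    volume ({θ | k < Real.cos θ} ∩ Set.Ioo (-Real.pi) Real.pi) =
      ENNReal.ofReal (2 * Real.arccos k) := by
  have h : {θ | k < Real.cos θ} ∩ Set.Ioo (-Real.pi) Real.pi =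
      Set.Ioo (-Real.arccos k) (Real.arccos k) := by
    ext θ
    simp only [Set.mem_inter_iff, Set.mem_ofPred_eq, Set.mem_Ioo, ← abs_lt]
    constructor
    · exact fun h => (Real.lt_cos_iff_abs_lt_arccos h.2).1 h.1
    · intro h
      have h' := h.trans_le (Real.arccos_le_pi k)
      exact ⟨(Real.lt_cos_iff_abs_lt_arccos h').2 h, h'⟩
  rw [h, Real.volume_Ioo]
  ring_nf

lemma equivDensity_eq_mul (lam a b r : ℝ) : equivDensity lam a b r = lam * equivDensity 1 a b r := by
  unfold equivDensity
  split_ifs <;> ring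

/-- Outside the range where the circles meet, the argument leaves `(-1, 1)`, and the clamped values
`0` and `π` of `Real.arccos` reproduce the constant cases. The case `a = b` with `r ≤ 0` cannot
occur. -/
lemma equivDensity_one_of_pos {a b r : ℝ} (ha : 0 ≤ a) (hb : 0 < b) (hr : 0 < r) :
    equivDensity 1 a b r =
      1 - Real.arccos ((r ^ 2 - (a ^ 2 - b ^ 2)) / (2 * r * b)) / Real.pi := by
  have hrb : 0 < 2 * r * b := by positivity
  have hone : |r - b| ≥ a → 1 ≤ (r ^ 2 - (a ^ 2 - b ^ 2)) / (2 * r * b) := fun h => by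
    rw [le_div_iff₀ hrb]
    have h2 := mul_self_le_mul_self ha h
    rw [abs_mul_abs_self] at h2
    nlinarith
  unfold equivDensity
  rw [if_neg hb.ne']
  split_ifs with h1 h2 h3 h4
  · rw [Real.arccos_of_one_le (hone (le_abs.2 (Or.inl (by linarith))))]
    simp
  · rw [abs_of_pos (sub_pos.2 h3)] at h2
    rw [Real.arccos_of_le_neg_one, div_self Real.pi_ne_zero, sub_self]
    rw [div_le_iff₀ hrb]
    nlinarith
  · rw [abs_of_neg (sub_neg.2 h4)] at h2
    rw [Real.arccos_of_one_le (hone (le_abs.2 (Or.inr (by linarith))))]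
    simp
  · have : a = b := le_antisymm (not_lt.1 h3) (not_lt.1 h4)
    simp only [this, sub_self, abs_zero] at h2
    exact absurd hr h2.not_gt
  · ring

lemma equivDensity_one_nonneg (a b r : ℝ) : 0 ≤ equivDensity 1 a b r := by
  have h : Real.arccos ((r ^ 2 - (a ^ 2 - b ^ 2)) / (2 * r * b)) / Real.pi ≤ 1 :=
    (div_le_one Real.pi_pos).2 (Real.arccos_le_pi _)
  unfold equivDensity
  split_ifs <;> linarith

lemma measurable_equivDensity (lam a b : ℝ) : Measurable (equivDensity lam a b) := by
  have h : Measurable fun r : ℝ =>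
      lam * (1 - Real.arccos ((r ^ 2 - (a ^ 2 - b ^ 2)) / (2 * r * b)) / Real.pi) := by
    have := Real.measurable_arccos
    fun_prop
  unfold equivDensity
  by_cases hb : b = 0
  · simp only [if_pos hb]
    exact Measurable.ite measurableSet_Ici measurable_const measurable_const
  · simp only [if_neg hb]
    exact Measurable.ite measurableSet_Ioi measurable_const
      (Measurable.ite measurableSet_Iic measurable_const h)

lemma normSq_polar_add (r θ b : ℝ) :
    ‖Complex.polarCoord.symm (r, θ) + b‖ ^ 2 = r ^ 2 + 2 * r * b * Real.cos θ + b ^ 2 := by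
  rw [Complex.sq_norm, Complex.polarCoord_symm_apply, Complex.normSq_apply]
  simp [-Complex.ofReal_cos, -Complex.ofReal_sin]
  have := Real.sin_sq_add_cos_sq θ
  linear_combination r ^ 2 * this

/-- By the law of cosines the condition is `-d < cos θ`, satisfied on an arc of angle `2 arccos (-d)
= 2 (π - arccos d)`. -/
lemma ae_volume_angles {a b : ℝ} (ha : 0 ≤ a) (hb : 0 ≤ b) :
    ∀ᵐ r ∂(volume.restrict (Set.Ioi (0 : ℝ))),
      volume ({θ | a < ‖Complex.polarCoord.symm (r, θ) + b‖} ∩ Set.Ioo (-Real.pi) Real.pi) =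
        ENNReal.ofReal (2 * Real.pi * equivDensity 1 a b r) := by
  have hset : ∀ r, {θ | a < ‖Complex.polarCoord.symm (r, θ) + b‖} =
      {θ | a ^ 2 < r ^ 2 + 2 * r * b * Real.cos θ + b ^ 2} := fun r => by
    ext θ
    simp only [Set.mem_ofPred_eq]
    rw [← normSq_polar_add, sq_lt_sq₀ ha (norm_nonneg _)]
  rcases hb.eq_or_lt with rfl | hb
  -- For `b = 0` the circle is wholly inside or outside. The radius `r = a`, where the strict
  -- condition and the definition of `equivDensity` disagree, is negligible.
  · have hne : ∀ᵐ r ∂(volume.restrict (Set.Ioi (0 : ℝ))), r ≠ a :=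
      ae_restrict_of_ae (Measure.ae_ne volume a)
    filter_upwards [hne, ae_restrict_mem measurableSet_Ioi] with r hr (hr0 : 0 < r)
    rw [hset]
    unfold equivDensity
    simp only [if_true, mul_zero, zero_mul, add_zero, ne_eq, OfNat.ofNat_ne_zero,
      not_false_eq_true, zero_pow, sq_lt_sq₀ ha hr0.le]
    rcases lt_or_gt_of_ne hr with h | h
    · simp [h.not_gt, h.not_ge]
    · simp only [h, Set.ofPred_true, Set.univ_inter, Real.volume_Ioo, h.le, if_true, mul_one]
      ring_nf
  · filter_upwards [ae_restrict_mem measurableSet_Ioi] with r (hr : 0 < r)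
    have hrb : 0 < 2 * r * b := by positivity
    have h1 : {θ | a < ‖Complex.polarCoord.symm (r, θ) + b‖} =
        {θ | -((r ^ 2 - (a ^ 2 - b ^ 2)) / (2 * r * b)) < Real.cos θ} := by
      rw [hset]
      ext θ
      simp only [Set.mem_ofPred_eq]
      rw [← neg_div, div_lt_iff₀ hrb]
      constructor <;> intro h <;> linarith
    rw [h1, volume_setOf_lt_cos, equivDensity_one_of_pos ha hb hr, Real.arccos_neg]
    congr 1
    field_simp

lemma lintegral_complex_norm {a b : ℝ} (ha : 0 ≤ a) (hb : 0 ≤ b) {F : ℝ → ℝ≥0∞}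
    (hF : Measurable F) :
    ∫⁻ z in {z : ℂ | a < ‖z + b‖}, F ‖z‖ =
      ∫⁻ r in Set.Ioi (0 : ℝ), ENNReal.ofReal (2 * Real.pi * r * equivDensity 1 a b r) * F r := by
  have hS : MeasurableSet {z : ℂ | a < ‖z + b‖} := measurableSet_lt (by fun_prop) (by fun_prop)
  rw [← lintegral_indicator hS, ← Complex.lintegral_comp_polarCoord_symm]
  have hpm : Measurable fun p : ℝ × ℝ => Complex.polarCoord.symm p := by
    have : (fun p : ℝ × ℝ => Complex.polarCoord.symm p) =
        fun p : ℝ × ℝ => (p.1 : ℂ) * (Real.cos p.2 + Real.sin p.2 * Complex.I) := by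
      ext p
      rw [Complex.polarCoord_symm_apply]
    rw [this]
    fun_prop
  have hg : Measurable ({z : ℂ | a < ‖z + b‖}.indicator fun z => F ‖z‖) :=
    Measurable.indicator (by fun_prop) hS
  have hgm : Measurable fun p : ℝ × ℝ => ENNReal.ofReal p.1 •
      ({z : ℂ | a < ‖z + b‖}.indicator fun z => F ‖z‖) (Complex.polarCoord.symm p) :=
    (ENNReal.measurable_ofReal.comp measurable_fst).smul (hg.comp hpm)
  have ht : polarCoord.target = Set.Ioi (0 : ℝ) ×ˢ Set.Ioo (-Real.pi) Real.pi := rfl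
  rw [ht, Measure.volume_eq_prod, ← Measure.prod_restrict, lintegral_prod _ hgm.aemeasurable]
  refine lintegral_congr_ae ?_
  filter_upwards [ae_volume_angles ha hb, ae_restrict_mem measurableSet_Ioi] with r hr hr0
  have hr0' : (0 : ℝ) < r := hr0
  have hA : MeasurableSet {θ | a < ‖Complex.polarCoord.symm (r, θ) + b‖} :=
    (hpm.comp measurable_prodMk_left) hS
  have h1 : ∀ θ, ({z : ℂ | a < ‖z + b‖}.indicator fun z => F ‖z‖) (Complex.polarCoord.symm (r, θ)) =
      {θ | a < ‖Complex.polarCoord.symm (r, θ) + b‖}.indicator (fun _ => F r) θ := by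
    intro θ
    have : ‖Complex.polarCoord.symm (r, θ)‖ = r := by
      rw [Complex.norm_polarCoord_symm, abs_of_pos hr0']
    by_cases h : a < ‖Complex.polarCoord.symm (r, θ) + b‖
    · rw [Set.indicator_of_mem (Set.mem_ofPred_eq ▸ h),
        Set.indicator_of_mem (Set.mem_ofPred_eq ▸ h), this]
    · rw [Set.indicator_of_notMem (Set.mem_ofPred_eq ▸ h),
        Set.indicator_of_notMem (Set.mem_ofPred_eq ▸ h)]
  simp only [h1, smul_eq_mul]
  rw [lintegral_const_mul _ (measurable_const.indicator hA), lintegral_indicator_const hA,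
    Measure.restrict_apply hA, hr, mul_comm (F r), ← mul_assoc, ← ENNReal.ofReal_mul hr0'.le]
  congr 2
  ring

lemma exists_linearIsometryEquiv_norm (x : Plane) :
    ∃ e : ℂ ≃ₗᵢ[ℝ] Plane, e (‖x‖ : ℂ) = x := by
  let e₀ : ℂ ≃ₗᵢ[ℝ] Plane := Complex.orthonormalBasisOneI.repr
  obtain ⟨u, hu⟩ : ∃ u : Circle, (u : ℂ) * (‖x‖ : ℂ) = e₀.symm x := by
    refine ⟨Circle.exp (e₀.symm x).arg, ?_⟩
    rw [Circle.coe_exp, mul_comm, ← e₀.symm.norm_map x]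
    exact Complex.norm_mul_exp_arg_mul_I _
  refine ⟨(rotation u).trans e₀, ?_⟩
  rw [LinearIsometryEquiv.trans_apply, rotation_apply, hu, LinearIsometryEquiv.apply_symm_apply]

/-- A translation moves the receiver to the origin, and an isometry with `ℂ` puts the displacement
`y` on the positive real axis. -/
lemma lintegral_norm_sub {a : ℝ} (ha : 0 ≤ a) (y : Plane) {F : ℝ → ℝ≥0∞} (hF : Measurable F) :
    ∫⁻ x in {x : Plane | a < ‖x‖}, F ‖x - y‖ =
      ∫⁻ r in Set.Ioi (0 : ℝ), ENNReal.ofReal (2 * Real.pi * r * equivDensity 1 a ‖y‖ r) * F r := by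
  obtain ⟨e, he⟩ := exists_linearIsometryEquiv_norm y
  have hS : MeasurableSet {x : Plane | a < ‖x‖} := measurableSet_lt (by fun_prop) (by fun_prop)
  have hS' : MeasurableSet {z : ℂ | a < ‖z + ‖y‖‖} := measurableSet_lt (by fun_prop) (by fun_prop)
  rw [← lintegral_complex_norm ha (norm_nonneg y) hF, ← lintegral_indicator hS,
    ← lintegral_indicator hS', ← lintegral_add_right_eq_self _ y]
  have hm : Measurable fun x : Plane =>
      ({x : Plane | a < ‖x‖}.indicator fun x => F ‖x - y‖) (x + y) :=
    (Measurable.indicator (by fun_prop) hS).comp (measurable_id.add_const y)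
  rw [← e.measurePreserving.lintegral_comp hm]
  refine lintegral_congr fun z => ?_
  have h1 : ‖e z + y‖ = ‖z + ‖y‖‖ := by
    rw [← e.norm_map (z + ‖y‖), map_add, he]
  by_cases h : a < ‖e z + y‖
  · rw [Set.indicator_of_mem (Set.mem_ofPred_eq ▸ h), Set.indicator_of_mem, add_sub_cancel_right,
      e.norm_map]
    rwa [Set.mem_ofPred_eq, ← h1]
  · rw [Set.indicator_of_notMem (Set.mem_ofPred_eq ▸ h), Set.indicator_of_notMem]
    rwa [Set.mem_ofPred_eq, ← h1]

/-- Stated as an equality of measures, so that it also serves Bochner integrals of functions of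
either sign. -/
lemma map_norm_sub {a : ℝ} (ha : 0 ≤ a) (y : Plane) :
    ((volume.restrict {x : Plane | a < ‖x‖}).map fun x => ‖x - y‖) =
      (volume.restrict (Set.Ioi (0 : ℝ))).withDensity
        fun r => ENNReal.ofReal (2 * Real.pi * r * equivDensity 1 a ‖y‖ r) := by
  have hm := measurable_equivDensity 1 a ‖y‖
  refine Measure.ext_of_lintegral _ fun F hF => ?_
  rw [lintegral_map hF (by fun_prop), lintegral_norm_sub ha y hF,
    lintegral_withDensity_eq_lintegral_mul _ (by fun_prop) hF]
  rfl

lemma integrable_equivDensity {lam a : ℝ} (ha : 0 ≤ a) (y : Plane) {F : ℝ → ℝ} (hF : Measurable F)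
    (hF' : IntegrableOn (fun x : Plane => F ‖x - y‖) {x | a < ‖x‖}) :
    IntegrableOn (fun r => equivDensity lam a ‖y‖ r * r * F r) (Set.Ioi 0) ∧
      2 * Real.pi * ∫ r in Set.Ioi 0, equivDensity lam a ‖y‖ r * r * F r =
        lam * ∫ x in {x : Plane | a < ‖x‖}, F ‖x - y‖ := by
  have hm := measurable_equivDensity 1 a ‖y‖
  have hw : Measurable fun r => ENNReal.ofReal (2 * Real.pi * r * equivDensity 1 a ‖y‖ r) := by
    fun_prop
  have hn : AEMeasurable (fun x : Plane => ‖x - y‖) (volume.restrict {x : Plane | a < ‖x‖}) := by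
    fun_prop
  have hlt : ∀ᵐ r ∂(volume.restrict (Set.Ioi (0 : ℝ))),
      ENNReal.ofReal (2 * Real.pi * r * equivDensity 1 a ‖y‖ r) < ⊤ :=
    ae_of_all _ fun _ => ENNReal.ofReal_lt_top
  have h1 : Integrable F ((volume.restrict {x : Plane | a < ‖x‖}).map fun x => ‖x - y‖) :=
    (integrable_map_measure hF.aestronglyMeasurable hn).2 hF'
  have h2 : ∫ x in {x : Plane | a < ‖x‖}, F ‖x - y‖ =
      ∫ r, F r ∂((volume.restrict {x : Plane | a < ‖x‖}).map fun x => ‖x - y‖) :=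
    (integral_map hn hF.aestronglyMeasurable).symm
  rw [map_norm_sub ha] at h1 h2
  rw [integrable_withDensity_iff_integrable_smul' hw hlt] at h1
  rw [integral_withDensity_eq_integral_toReal_smul hw hlt] at h2
  have h3 : ∀ r ∈ Set.Ioi (0 : ℝ), equivDensity lam a ‖y‖ r * r * F r = lam / (2 * Real.pi) *
      ((ENNReal.ofReal (2 * Real.pi * r * equivDensity 1 a ‖y‖ r)).toReal • F r) := by
    intro r hr
    have hr' : (0 : ℝ) < r := hr
    rw [ENNReal.toReal_ofReal (mul_nonneg (by positivity) (equivDensity_one_nonneg _ _ _)),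
      equivDensity_eq_mul, smul_eq_mul]
    field_simp
  rw [integrableOn_congr_fun h3 measurableSet_Ioi, setIntegral_congr_fun measurableSet_Ioi h3, h2,
    integral_const_mul]
  refine ⟨h1.const_mul _, ?_⟩
  field_simp

/-! ### Interference under a law that is Poisson beyond `p`. -/

open Classical in
/-- The mean power received at `xR` from the `n`-th point of `φ`, where the points at `p` are
silent. -/
noncomputable def meanPower (P α : ℝ) (p xR : Plane) (φ : ℕ → Plane) (n : ℕ) : ℝ :=
  if φ n = p then 0 else P * ‖φ n - xR‖ ^ (-α)

lemma measurable_meanPower (P α : ℝ) (p xR : Plane) (n : ℕ) :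
    Measurable fun φ => meanPower P α p xR φ n := by
  have h : MeasurableSet {φ : ℕ → Plane | φ n = p} :=
    measurable_pi_apply (X := fun _ : ℕ => Plane) n (measurableSet_singleton p)
  unfold meanPower
  exact Measurable.ite h measurable_const (by fun_prop)

lemma meanPower_nonneg {P : ℝ} (hP : 0 ≤ P) (α : ℝ) (p xR : Plane) (φ : ℕ → Plane) (n : ℕ) :
    0 ≤ meanPower P α p xR φ n := by
  unfold meanPower
  split_ifs
  · exact le_rfl
  · positivity

/-- The nearest point is at distance `0` from itself and so lies in its cell, whereas any other
point of the configuration is at least as close to itself as to the nearest point. -/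
lemma receivedPower_eq (P α : ℝ) (xR : Plane) (c : Config) (n : ℕ) :
    receivedPower P α xR c n = meanPower P α (nearestPoint c.1) xR c.1 n * c.2 n := by
  have h : c.1 n ∈ voronoiCell (Set.range c.1) (nearestPoint c.1) ↔ c.1 n = nearestPoint c.1 := by
    constructor
    · intro h
      by_contra hne
      have := h (c.1 n) ⟨⟨n, rfl⟩, hne⟩
      rw [sub_self, norm_zero] at this
      exact absurd this (norm_nonneg _).not_gt
    · rintro h x ⟨-, hx⟩
      rw [h, sub_self, norm_zero, norm_pos_iff, sub_ne_zero]
      exact fun h' => hx h'.symm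
  unfold receivedPower meanPower
  simp only [h]
  split_ifs <;> ring

lemma sumOff_eq_tsum_meanPower {P α : ℝ} {p xR : Plane} {h : ℝ → ℝ≥0∞} (h0 : h 0 = 0)
    (φ : ℕ → Plane) :
    sumOff p (fun x => h (P * ‖x - xR‖ ^ (-α))) φ = ∑' n, h (meanPower P α p xR φ n) := by
  unfold sumOff meanPower
  refine tsum_congr fun n => ?_
  split_ifs with hn
  · exact h0.symm
  · rfl

/-- Comparison with `(1 + ‖x‖) ^ (-α)`, integrable because `α` exceeds the dimension `2`. The factor
`2 ^ α` comes from `1 + ‖x‖ ≤ 2` inside the unit disc and `1 + ‖x‖ ≤ 2 ‖x‖` outside. The truncation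
at `1` removes the non-integrable pole at `xR`. -/
lemma integrable_min_one_rpow {α : ℝ} (hα : 2 < α) {P : ℝ} (hP : 0 ≤ P) (xR : Plane) :
    Integrable fun x : Plane => min 1 (P * ‖x - xR‖ ^ (-α)) := by
  have hα0 : 0 < α := by linarith
  have hint : Integrable fun x : Plane => (1 + ‖x‖) ^ (-α) :=
    integrable_one_add_norm (by simpa using hα)
  refine ((hint.const_mul (max 1 P * 2 ^ α)).mono'
    (Measurable.aestronglyMeasurable (f := fun x : Plane => min 1 (P * ‖x‖ ^ (-α)))
      (by fun_prop)) (ae_of_all _ fun x => ?_)).comp_sub_right xR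
  rw [Real.norm_of_nonneg (le_min zero_le_one (by positivity)), mul_assoc]
  have hpos : 0 < 1 + ‖x‖ := by positivity
  rcases le_or_gt ‖x‖ 1 with hx | hx
  · have h1 : (1 : ℝ) ≤ 2 ^ α * (1 + ‖x‖) ^ (-α) := by
      rw [Real.rpow_neg hpos.le, ← div_eq_mul_inv, one_le_div (by positivity)]
      exact Real.rpow_le_rpow hpos.le (by linarith) hα0.le
    calc min 1 (P * ‖x‖ ^ (-α)) ≤ 1 * 1 := by rw [one_mul]; exact min_le_left _ _
      _ ≤ _ := mul_le_mul (le_max_left _ _) h1 zero_le_one (by positivity)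
  · have hx0 : 0 < ‖x‖ := by linarith
    have h1 : ‖x‖ ^ (-α) ≤ 2 ^ α * (1 + ‖x‖) ^ (-α) := by
      rw [Real.rpow_neg hpos.le, ← div_eq_mul_inv, Real.rpow_neg hx0.le,
        ← Real.div_rpow (by norm_num) hpos.le, ← Real.inv_rpow hx0.le]
      refine Real.rpow_le_rpow (by positivity) ?_ hα0.le
      rw [inv_le_comm₀ hx0 (by positivity), inv_div]
      linarith
    exact (min_le_right _ _).trans (mul_le_mul (le_max_right _ _) h1 (by positivity) (by positivity))

lemma gammaFun_nonneg {t : ℝ} (ht : 0 ≤ t) : 0 ≤ gammaFun t := by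
  unfold gammaFun
  have : 1 / (1 + t) ≤ 1 := (div_le_one (by positivity)).2 (by linarith)
  linarith

lemma gammaFun_le {t : ℝ} (ht : 0 ≤ t) : gammaFun t ≤ min 1 t := by
  unfold gammaFun
  refine le_min ?_ ?_
  · have : 0 ≤ 1 / (1 + t) := by positivity
    linarith
  · rw [sub_le_iff_le_add, ← sub_le_iff_le_add', le_div_iff₀ (by positivity)]
    nlinarith

lemma measurable_gammaFun : Measurable gammaFun := by
  unfold gammaFun
  fun_prop

lemma integrable_gammaFun {α : ℝ} (hα : 2 < α) {P : ℝ} (hP : 0 ≤ P) (xR : Plane) :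
    Integrable fun x : Plane => gammaFun (P * ‖x - xR‖ ^ (-α)) := by
  refine (integrable_min_one_rpow hα hP xR).mono'
    (measurable_gammaFun.comp (by fun_prop)).aestronglyMeasurable (ae_of_all _ fun x => ?_)
  have h0 : 0 ≤ P * ‖x - xR‖ ^ (-α) := by positivity
  rw [Real.norm_of_nonneg (gammaFun_nonneg h0)]
  exact gammaFun_le h0

/-- The truncated terms tend to zero, so only finitely many of them are actually truncated. -/
lemma summable_of_summable_min_one {a : ℕ → ℝ} (h : Summable fun n => min 1 (a n)) :
    Summable a := by
  refine (summable_congr_cofinite ?_).1 h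
  have h1 := h.tendsto_cofinite_zero.eventually_lt_const (zero_lt_one)
  filter_upwards [h1] with n hn
  exact min_eq_right (le_of_not_ge fun h' => hn.ne (min_eq_left h'))

/-- The interference as an extended nonnegative number. -/
noncomputable def interferenceSum (P α : ℝ) (p xR : Plane) (c : Config) : ℝ≥0∞ :=
  ∑' n, ENNReal.ofReal (meanPower P α p xR c.1 n * c.2 n)

lemma measurable_interferenceSum (P α : ℝ) (p xR : Plane) :
    Measurable (interferenceSum P α p xR) := by
  refine Measurable.tsum fun n => ENNReal.measurable_ofReal.comp ?_
  exact ((measurable_meanPower P α p xR n).comp measurable_fst).mul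
    ((measurable_pi_apply n).comp measurable_snd)

namespace IsPoissonBeyond

variable {ν : Measure (ℕ → Plane)} {lam : ℝ} {p : Plane} {P α : ℝ}

/-- The untruncated powers may have infinite mean when `xR` is farther out than `p`; almost sure
summability is first obtained for the truncated powers. -/
lemma ae_summable_meanPower (hν : IsPoissonBeyond ν lam p) (hP : 0 ≤ P) (hα : 2 < α) (xR : Plane) :
    ∀ᵐ φ ∂ν, Summable (meanPower P α p xR φ) := by
  have hi := integrable_min_one_rpow hα hP xR
  have h := hν.ae_sumOff_ne_top (fun x => ENNReal.ofReal (min 1 (P * ‖x - xR‖ ^ (-α))))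
    (by fun_prop) (hi.restrict (s := {x | ‖p‖ < ‖x‖})).lintegral_lt_top.ne
  filter_upwards [h] with φ hφ
  rw [sumOff_eq_tsum_meanPower (h := fun t => ENNReal.ofReal (min 1 t)) (by simp)] at hφ
  refine summable_of_summable_min_one ((ENNReal.summable_toReal hφ).congr fun n => ?_)
  exact ENNReal.toReal_ofReal (le_min zero_le_one (meanPower_nonneg hP _ _ _ _ _))

lemma ae_ae_summable (hν : IsPoissonBeyond ν lam p) (hP : 0 ≤ P) (hα : 2 < α) (xR : Plane) :
    ∀ᵐ φ ∂ν, Summable (meanPower P α p xR φ) ∧ ∀ᵐ w ∂expSeq, (∀ n, 0 ≤ w n) ∧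
      Summable fun n => meanPower P α p xR φ n * w n := by
  filter_upwards [hν.ae_summable_meanPower hP hα xR] with φ hφ
  refine ⟨hφ, ?_⟩
  filter_upwards [ae_expSeq_nonneg, ae_summable_expSeq (fun n => meanPower_nonneg hP α p xR φ n) hφ]
    with w h1 h2 using ⟨h1, h2⟩

lemma toReal_interferenceSum (hP : 0 ≤ P) {xR : Plane} {c : Config} (h0 : ∀ n, 0 ≤ c.2 n)
    (hs : Summable fun n => meanPower P α p xR c.1 n * c.2 n) :
    (interferenceSum P α p xR c).toReal = ∑' n, meanPower P α p xR c.1 n * c.2 n := by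
  have h1 : ∀ n, 0 ≤ meanPower P α p xR c.1 n * c.2 n :=
    fun n => mul_nonneg (meanPower_nonneg hP _ _ _ _ _) (h0 n)
  rw [interferenceSum, ← ENNReal.ofReal_tsum_of_nonneg h1 hs, ENNReal.toReal_ofReal (tsum_nonneg h1)]

lemma ae_prod (hν : IsPoissonBeyond ν lam p) (hP : 0 ≤ P) (hα : 2 < α) (xR : Plane) :
    ∀ᵐ c ∂(ν.prod expSeq), nearestPoint c.1 = p ∧ Summable (receivedPower P α xR c) ∧
      interference P α xR c = (interferenceSum P α p xR c).toReal := by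
  have := hν.isProbabilityMeasure
  have h1 : ∀ᵐ c ∂(ν.prod expSeq), nearestPoint c.1 = p :=
    Measure.quasiMeasurePreserving_fst.ae (hν.nearestPoint_eq.mono fun φ h => h.1)
  have h2 : ∀ᵐ c ∂(ν.prod expSeq), ∀ n, 0 ≤ c.2 n :=
    Measure.quasiMeasurePreserving_snd.ae ae_expSeq_nonneg
  have h3 : ∀ᵐ c ∂(ν.prod expSeq), interferenceSum P α p xR c < ⊤ := by
    rw [Measure.ae_prod_iff_ae_ae (measurableSet_lt (measurable_interferenceSum P α p xR)
      measurable_const)]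
    filter_upwards [hν.ae_ae_summable hP hα xR] with φ hφ
    filter_upwards [hφ.2] with w hw
    exact hw.2.tsum_ofReal_lt_top
  filter_upwards [h1, h2, h3] with c hc1 hc2 hc3
  have hs : Summable fun n => meanPower P α p xR c.1 n * c.2 n :=
    (ENNReal.summable_toReal hc3.ne).congr fun n =>
      ENNReal.toReal_ofReal (mul_nonneg (meanPower_nonneg hP _ _ _ _ _) (hc2 n))
  have he : receivedPower P α xR c = fun n => meanPower P α p xR c.1 n * c.2 n := by
    funext n
    rw [receivedPower_eq, hc1]
  refine ⟨hc1, he ▸ hs, ?_⟩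
  rw [interference, he, toReal_interferenceSum hP hc2 hs]

lemma aemeasurable_interference (hν : IsPoissonBeyond ν lam p) (hP : 0 ≤ P) (hα : 2 < α)
    (xR : Plane) : AEMeasurable (interference P α xR) (ν.prod expSeq) :=
  ⟨fun c => (interferenceSum P α p xR c).toReal, (measurable_interferenceSum P α p xR).ennreal_toReal,
    (hν.ae_prod hP hα xR).mono fun _ h => h.2.2⟩

lemma lintegral_exp_interference (hν : IsPoissonBeyond ν lam p) (hP : 0 ≤ P) (hα : 2 < α)
    (xR : Plane) (s : ℝ) :
    ∫⁻ c, ENNReal.ofReal (Real.exp (-s * interference P α xR c)) ∂(ν.prod expSeq) =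
      ∫⁻ φ, ∫⁻ w, ENNReal.ofReal (Real.exp (-s * ∑' n, meanPower P α p xR φ n * w n)) ∂expSeq ∂ν := by
  have := hν.isProbabilityMeasure
  have hm := (measurable_interferenceSum P α p xR).ennreal_toReal
  have hm' : Measurable fun c => ENNReal.ofReal
      (Real.exp (-s * (interferenceSum P α p xR c).toReal)) := by fun_prop
  calc _ = ∫⁻ c, ENNReal.ofReal (Real.exp (-s * (interferenceSum P α p xR c).toReal))
          ∂(ν.prod expSeq) := by
        refine lintegral_congr_ae ?_
        filter_upwards [hν.ae_prod hP hα xR] with c hc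
        rw [hc.2.2]
    _ = _ := by
        rw [lintegral_prod _ hm'.aemeasurable]
        refine lintegral_congr_ae ?_
        filter_upwards [hν.ae_ae_summable hP hα xR] with φ hφ
        refine lintegral_congr_ae ?_
        filter_upwards [hφ.2] with w hw
        have h := toReal_interferenceSum (p := p) (α := α) (c := (φ, w)) hP hw.1 hw.2
        simp only [h]

/-- Averaging over the gains leaves `expNeg` of the sum of `log (1 + t)`, and `1 - exp (-log (1 +
t)) = γ(t)`. -/
lemma laplace_of_nonneg (hν : IsPoissonBeyond ν lam p) (hlam : 0 ≤ lam) (hP : 0 ≤ P) (hα : 2 < α)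
    (xR : Plane) {s : ℝ} (hs : 0 ≤ s) :
    ∫⁻ c, ENNReal.ofReal (Real.exp (-s * interference P α xR c)) ∂(ν.prod expSeq) =
      ENNReal.ofReal (Real.exp
        (-(lam * ∫ x in {x | ‖p‖ < ‖x‖}, gammaFun (s * P * ‖x - xR‖ ^ (-α))))) := by
  have hint := (integrable_gammaFun hα (mul_nonneg hs hP) xR).restrict (s := {x | ‖p‖ < ‖x‖})
  rw [hν.lintegral_exp_interference hP hα xR s]
  have h1 : ∀ᵐ φ ∂ν,
      ∫⁻ w, ENNReal.ofReal (Real.exp (-s * ∑' n, meanPower P α p xR φ n * w n)) ∂expSeq =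
      expNeg (sumOff p (fun x => ENNReal.ofReal (Real.log (1 + s * (P * ‖x - xR‖ ^ (-α))))) φ) := by
    filter_upwards [hν.ae_ae_summable hP hα xR] with φ hφ
    rw [sumOff_eq_tsum_meanPower (h := fun t => ENNReal.ofReal (Real.log (1 + s * t))) (by simp),
      ← lintegral_exp_neg_tsum_expSeq
        (fun n => mul_nonneg hs (meanPower_nonneg hP α p xR φ n)) (hφ.1.mul_left s)]
    simp only [mul_assoc, tsum_mul_left, neg_mul]
  rw [lintegral_congr_ae h1, hν.lintegral_expNeg _ (by fun_prop)]
  have h2 : ∀ x, 1 - expNeg (ENNReal.ofReal (Real.log (1 + s * (P * ‖x - xR‖ ^ (-α))))) =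
      ENNReal.ofReal (gammaFun (s * P * ‖x - xR‖ ^ (-α))) := by
    intro x
    have h0 : 0 ≤ s * (P * ‖x - xR‖ ^ (-α)) := by positivity
    rw [expNeg_ofReal (Real.log_nonneg (by linarith)), Real.exp_neg, Real.exp_log (by linarith),
      ← ENNReal.ofReal_one, ← ENNReal.ofReal_sub _ (by positivity), gammaFun, one_div, mul_assoc]
  simp_rw [h2]
  have h3 : ∀ x, 0 ≤ gammaFun (s * P * ‖x - xR‖ ^ (-α)) := fun x => gammaFun_nonneg (by positivity)
  rw [← ofReal_integral_eq_lintegral_ofReal hint (ae_of_all _ h3), ← ENNReal.ofReal_mul hlam,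
    expNeg_ofReal (mul_nonneg hlam (integral_nonneg h3))]

/-- With `u = -s`, finiteness forces `u P ‖x - xR‖^(-α) < 1` for almost every `x` beyond `p`, where
`exp (-log (1 - t)) - 1 = -γ(-t)`. The finite integral of this nonnegative function is the required
convergence. -/
lemma laplace_of_nonpos (hν : IsPoissonBeyond ν lam p) (hlam : 0 < lam) (hP : 0 ≤ P) (hα : 2 < α)
    (xR : Plane) {s : ℝ} (hs : s ≤ 0)
    (hfin : ∫⁻ c, ENNReal.ofReal (Real.exp (-s * interference P α xR c)) ∂(ν.prod expSeq) ≠ ⊤) :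
    IntegrableOn (fun x => gammaFun (s * P * ‖x - xR‖ ^ (-α))) {x | ‖p‖ < ‖x‖} ∧
    ∫⁻ c, ENNReal.ofReal (Real.exp (-s * interference P α xR c)) ∂(ν.prod expSeq) =
      ENNReal.ofReal (Real.exp
        (-(lam * ∫ x in {x | ‖p‖ < ‖x‖}, gammaFun (s * P * ‖x - xR‖ ^ (-α))))) := by
  obtain ⟨u, rfl⟩ : ∃ u, s = -u := ⟨-s, (neg_neg s).symm⟩
  have hu : 0 ≤ u := neg_nonpos.1 hs
  set h : ℝ → ℝ≥0∞ := fun t => if u * t < 1 then ENNReal.ofReal (-Real.log (1 - u * t)) else ⊤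
    with hh
  have hm : Measurable h :=
    Measurable.ite (measurableSet_lt (by fun_prop) measurable_const) (by fun_prop) measurable_const
  have hfm : Measurable fun x : Plane => h (P * ‖x - xR‖ ^ (-α)) := hm.comp (by fun_prop)
  have h1 : ∀ᵐ φ ∂ν,
      ∫⁻ w, ENNReal.ofReal (Real.exp (-(-u) * ∑' n, meanPower P α p xR φ n * w n)) ∂expSeq =
      expPos (sumOff p (fun x => h (P * ‖x - xR‖ ^ (-α))) φ) := by
    filter_upwards [hν.ae_ae_summable hP hα xR] with φ hφ
    rw [sumOff_eq_tsum_meanPower (h := h) (by simp [hh]), hh,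
      ← lintegral_exp_tsum_expSeq
        (fun n => mul_nonneg hu (meanPower_nonneg hP α p xR φ n)) (hφ.1.mul_left u)]
    simp only [mul_assoc, tsum_mul_left, neg_neg]
  rw [hν.lintegral_exp_interference hP hα xR, lintegral_congr_ae h1,
    hν.lintegral_expPos _ hfm] at hfin ⊢
  -- Since `lam > 0`, an infinite exponent integral would make the expectation infinite.
  have hfin' : ∫⁻ x in {x | ‖p‖ < ‖x‖}, (expPos (h (P * ‖x - xR‖ ^ (-α))) - 1) ≠ ⊤ := by
    intro h'
    rw [h', ENNReal.mul_top (by simpa using hlam)] at hfin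
    exact hfin expPos_top
  have hgm : Measurable fun x : Plane => expPos (h (P * ‖x - xR‖ ^ (-α))) - 1 :=
    (continuous_expPos.measurable.comp hfm).sub_const 1
  have h2 : ∀ᵐ x ∂(volume.restrict {x : Plane | ‖p‖ < ‖x‖}),
      0 ≤ -gammaFun (-u * P * ‖x - xR‖ ^ (-α)) ∧ expPos (h (P * ‖x - xR‖ ^ (-α))) - 1 =
        ENNReal.ofReal (-gammaFun (-u * P * ‖x - xR‖ ^ (-α))) := by
    filter_upwards [ae_lt_top hgm hfin'] with x hx
    have h0 : 0 ≤ u * (P * ‖x - xR‖ ^ (-α)) := by positivity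
    have hlt : u * (P * ‖x - xR‖ ^ (-α)) < 1 := by
      by_contra hge
      simp [hh, hge, expPos_top] at hx
    have e1 : -gammaFun (-u * P * ‖x - xR‖ ^ (-α)) = (1 - u * (P * ‖x - xR‖ ^ (-α)))⁻¹ - 1 := by
      rw [gammaFun, one_div, neg_sub, mul_assoc, neg_mul, sub_eq_add_neg 1 (u * _)]
    rw [e1]
    refine ⟨sub_nonneg.2 ((one_le_inv₀ (by linarith)).2 (by linarith)), ?_⟩
    rw [hh]
    simp only [if_pos hlt]
    rw [expPos_ofReal (neg_nonneg.2 (Real.log_nonpos (by linarith) (by linarith))), Real.exp_neg,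
      Real.exp_log (by linarith), ENNReal.ofReal_sub _ zero_le_one, ENNReal.ofReal_one]
  rw [lintegral_congr_ae (h2.mono fun x hx => hx.2)] at hfin' ⊢
  have hF : Measurable fun x : Plane => -gammaFun (-u * P * ‖x - xR‖ ^ (-α)) :=
    (measurable_gammaFun.comp (by fun_prop)).neg
  have hint : Integrable (fun x : Plane => -gammaFun (-u * P * ‖x - xR‖ ^ (-α)))
      (volume.restrict {x : Plane | ‖p‖ < ‖x‖}) :=
    (lintegral_ofReal_ne_top_iff_integrable hF.aestronglyMeasurable
      (h2.mono fun x hx => hx.1)).1 hfin'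
  refine ⟨by simpa [IntegrableOn] using hint.neg, ?_⟩
  have h3 := integral_nonneg_of_ae (h2.mono fun x hx => hx.1)
  rw [← ofReal_integral_eq_lintegral_ofReal hint (h2.mono fun x hx => hx.1),
    ← ENNReal.ofReal_mul hlam.le, expPos_ofReal (mul_nonneg hlam.le h3), integral_neg, mul_neg]

theorem hasRadialLaplaceTransform (hν : IsPoissonBeyond ν lam p) (hlam : 0 < lam) (hP : 0 ≤ P)
    (hα : 2 < α) (xR : Plane) :
    HasRadialLaplaceTransform (ν.prod expSeq) (interference P α xR) P α
      (equivDensity lam ‖p‖ ‖xR‖) := by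
  have hm : ∀ s, AEStronglyMeasurable (fun c => Real.exp (-s * interference P α xR c))
      (ν.prod expSeq) := fun s =>
    (Real.measurable_exp.comp_aemeasurable
      ((hν.aemeasurable_interference hP hα xR).const_mul (-s))).aestronglyMeasurable
  have h0 : ∀ s, ∀ᵐ c ∂(ν.prod expSeq), 0 ≤ Real.exp (-s * interference P α xR c) :=
    fun s => ae_of_all _ fun c => (Real.exp_pos _).le
  refine ⟨fun s hs => ?_, fun s hs => ?_⟩
  · rw [← lintegral_ofReal_ne_top_iff_integrable (hm s) (h0 s),
      hν.laplace_of_nonneg hlam.le hP hα xR hs]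
    exact ENNReal.ofReal_ne_top
  · obtain ⟨hint, heq⟩ :
        IntegrableOn (fun x => gammaFun (s * P * ‖x - xR‖ ^ (-α))) {x | ‖p‖ < ‖x‖} ∧
        ∫⁻ c, ENNReal.ofReal (Real.exp (-s * interference P α xR c)) ∂(ν.prod expSeq) =
        ENNReal.ofReal (Real.exp
          (-(lam * ∫ x in {x | ‖p‖ < ‖x‖}, gammaFun (s * P * ‖x - xR‖ ^ (-α))))) := by
      rcases le_total 0 s with h | h
      · exact ⟨(integrable_gammaFun hα (mul_nonneg h hP) xR).restrict,
          hν.laplace_of_nonneg hlam.le hP hα xR h⟩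
      · exact hν.laplace_of_nonpos hlam hP hα xR h
          ((lintegral_ofReal_ne_top_iff_integrable (hm s) (h0 s)).2 hs)
    have hF : Measurable fun r : ℝ => gammaFun (s * P * r ^ (-α)) :=
      measurable_gammaFun.comp (by fun_prop)
    obtain ⟨h1, h2⟩ := integrable_equivDensity (lam := lam) (norm_nonneg p) xR hF hint
    refine ⟨h1, ?_⟩
    rw [integral_eq_lintegral_of_nonneg_ae (h0 s) (hm s), heq,
      ENNReal.toReal_ofReal (Real.exp_pos _).le, neg_mul, h2]

end IsPoissonBeyond

/-! ### The two cases of the theorem. -/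

theorem proposition1 {Ω : Type*} [MeasurableSpace Ω] (μ : Measure Ω) [IsProbabilityMeasure μ]
    (X : ℕ → Ω → Plane) (g : ℕ → Ω → ℝ) (lam P α : ℝ)
    (hlam : 0 < lam) (hP : 0 < P) (hα : 2 < α)
    (hX : IsHomogeneousPPP μ X lam) (hg : IsRayleighFading μ X g) :
    -- the typical node is not an access point: conditioning on `x* = p`
    (∀ᵐ p ∂(μ.map (fun ω => nearestPoint (fun n => X n ω))), ∀ xR : Plane,
      (∀ᵐ c ∂(condDistrib (fun ω => ((fun n => X n ω, fun n => g n ω) : Config))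
          (fun ω => nearestPoint (fun n => X n ω)) μ p),
        nearestPoint c.1 = p ∧ Summable (receivedPower P α xR c)) ∧
      HasRadialLaplaceTransform
        (condDistrib (fun ω => ((fun n => X n ω, fun n => g n ω) : Config))
          (fun ω => nearestPoint (fun n => X n ω)) μ p)
        (interference P α xR) P α (equivDensity lam ‖p‖ ‖xR‖)) ∧
    -- the typical node is an access point: conditioning on `x* = o`
    (∀ B : Set Plane, MeasurableSet B → 0 < volume B → volume B < ⊤ → ∀ xR : Plane,
      (∀ᵐ c ∂(palmLaw μ X g lam B),
        nearestPoint c.1 = 0 ∧ Summable (receivedPower P α xR c)) ∧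
      HasRadialLaplaceTransform (palmLaw μ X g lam B)
        (interference P α xR) P α (equivDensity lam 0 ‖xR‖)) := by
  constructor
  -- The exceptional null set of `p` is fixed before `xR` is introduced, so the conclusion holds for
  -- all receiver positions simultaneously.
  · filter_upwards [hX.ae_condDistrib_config hg, hX.ae_isPoissonBeyond_condDistrib hlam]
      with p hp hν xR
    rw [hp, hg.map_eq_expSeq]
    exact ⟨(hν.ae_prod hP.le hα xR).mono fun c hc => ⟨hc.1, hc.2.1⟩,
      hν.hasRadialLaplaceTransform hlam hP.le hα xR⟩
  · intro B hB hB0 hB' xR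
    have hν := hX.isPoissonBeyond_palmPositions hlam hB hB0 hB'
    rw [hX.palmLaw_eq_prod hg hB, hg.map_eq_expSeq]
    refine ⟨(hν.ae_prod hP.le hα xR).mono fun c hc => ⟨hc.1, hc.2.1⟩, ?_⟩
    have h := hν.hasRadialLaplaceTransform hlam hP.le hα xR
    rwa [norm_zero] at h
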